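/- Let $\mathbb{k}$ be $\mathbb{R}$ or $\mathbb{C}$. All bornological vector spaces, algebras and modules below are complete over $\mathbb{k}$ (every bounded set lies in a bounded completant disc), $\otimes$ denotes the complete bornological tensor product, and $M\otimes_A N$ is the quotient of $M\otimes N$ by the closure of the span of the elements $ma\otimes n-m\otimes an$. For a bornological algebra $A$, let $A^+$ be $A$ if $A$ has a unit and the unitalization $A\oplus\mathbb{k}$ otherwise; $A$-modules are unital $A^+$-modules with bounded action. An algebra $A$ is quasi-unital if for every bounded $S\subset A$ there is a sequence $(\mu_n)$ in $A$ such that $\mu_n x\to x$ and $x\mu_n\to x$ uniformly for $x\in S$, and if the multiplication maps $A^+\otimes A\to A$ and $A\otimes A^+\to A$ have bounded sections that are left, respectively right, $A^+$-linear. It is multiplicatively convex if every bounded set is absorbed by a bounded disc that is closed under multiplication. A right $A$-module $M$ is essential if the natural map $M\otimes_A A\to M$ is a bornological isomorphism (similarly for left modules). It is projective if $\mathcal{L}_A(M,\cdot)$ takes exact sequences with a bounded $\mathbb{k}$-linear splitting to exact sequences with a bounded $\mathbb{k}$-linear splitting (similarly for left modules). It is finitely generated if for some $n$ there is a bounded $A$-linear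 surjection $(A^+)^n\to M$ with a bounded $\mathbb{k}$-linear section. It is finite if it is finitely generated, projective and essential. Let $A$ and $B$ be quasi-unital bornological algebras, and suppose that $B$ is multiplicatively convex. Let $X$ be a Morita equivalence $A$-$B$-bimodule, that is, an $A$-$B$-bimodule which is essential on both sides and for which there are a $B$-$A$-bimodule $Y$, essential and projective on both sides, and bornological bimodule isomorphisms $A\simeq X\otimes_B Y$ and $B\simeq Y\otimes_A X$. Then for every finite right $A$-module $M$, the right $B$-module $M\otimes_A X$ is finite. -/

import Mathlib

open scoped Pointwise

namespace Borno

/-! ### Complete bornological vector spaces -/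

section Vector

variable (𝕜 : Type*) [RCLike 𝕜] {V : Type*} [AddCommGroup V] [Module 𝕜 V]

/-- A disc: a nonempty, circled and convex set. -/
structure IsDisc (D : Set V) : Prop where
  nonempty : D.Nonempty
  circled : ∀ c : 𝕜, ‖c‖ ≤ 1 → ∀ x ∈ D, c • x ∈ D
  convex : ∀ t : ℝ, 0 ≤ t → t ≤ 1 → ∀ x ∈ D, ∀ y ∈ D,
    ((t : ℝ) : 𝕜) • x + ((1 - t : ℝ) : 𝕜) • y ∈ D

/-- The sequence `x` converges to `l` with respect to (the gauge of) `D`. -/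
def TendstoIn (D : Set V) (x : ℕ → V) (l : V) : Prop :=
  ∀ ε : ℝ, 0 < ε → ∃ N : ℕ, ∀ n, N ≤ n → x n - l ∈ ((ε : ℝ) : 𝕜) • D

/-- A completant disc: the gauge of `D` is a norm on the linear span of `D`, and the span is
complete for this norm. -/
structure IsCompletant (D : Set V) : Prop extends IsDisc 𝕜 D where
  norming : ∀ x : V, (∀ ε : ℝ, 0 < ε → x ∈ ((ε : ℝ) : 𝕜) • D) → x = 0
  complete : ∀ x : ℕ → V, (∀ n, x n ∈ Submodule.span 𝕜 D) →
    (∀ ε : ℝ, 0 < ε → ∃ N : ℕ, ∀ m, N ≤ m → ∀ n, N ≤ n → x m - x n ∈ ((ε : ℝ) : 𝕜) • D) →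
    ∃ l ∈ Submodule.span 𝕜 D, TendstoIn 𝕜 D x l

end Vector

/-- A complete bornological vector space: the bornology is closed under sums and homotheties and
every bounded set is contained in a bounded completant disc. -/
class CompleteBVS (𝕜 : Type*) [RCLike 𝕜] (V : Type*) [AddCommGroup V] [Module 𝕜 V]
    [Bornology V] : Prop where
  isBounded_add : ∀ S T : Set V, Bornology.IsBounded S → Bornology.IsBounded T →
    Bornology.IsBounded (S + T)
  isBounded_smul : ∀ (c : 𝕜) (S : Set V), Bornology.IsBounded S → Bornology.IsBounded (c • S)
  exists_completant : ∀ S : Set V, Bornology.IsBounded S →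
    ∃ D : Set V, S ⊆ D ∧ Bornology.IsBounded D ∧ IsCompletant 𝕜 D

section Maps

variable {𝕜 : Type*} [RCLike 𝕜] {V W Z : Type*}
  [AddCommGroup V] [Module 𝕜 V] [Bornology V]
  [AddCommGroup W] [Module 𝕜 W] [Bornology W]
  [AddCommGroup Z] [Module 𝕜 Z] [Bornology Z]

/-- A linear map is bounded if it sends bounded sets to bounded sets. -/
def IsBdd (f : V →ₗ[𝕜] W) : Prop :=
  ∀ S : Set V, Bornology.IsBounded S → Bornology.IsBounded (f '' S)

/-- A bilinear map is bounded if it sends products of bounded sets to bounded sets. -/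
def IsBddBilin (f : V →ₗ[𝕜] W →ₗ[𝕜] Z) : Prop :=
  ∀ (S : Set V) (T : Set W), Bornology.IsBounded S → Bornology.IsBounded T →
    Bornology.IsBounded (Set.image2 (fun v w => f v w) S T)

/-- A bornological isomorphism: a bounded linear bijection with bounded inverse. -/
def IsBornIso (f : V →ₗ[𝕜] W) : Prop :=
  Function.Bijective f ∧
    ∀ S : Set V, Bornology.IsBounded (f '' S) ↔ Bornology.IsBounded S

variable (𝕜) in
/-- A linear subspace is (bornologically) closed if it contains the limits of its convergent
sequences. -/
def BClosed (K : Submodule 𝕜 V) : Prop :=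
  ∀ D : Set V, Bornology.IsBounded D → ∀ (x : ℕ → V) (l : V), (∀ n, x n ∈ K) →
    TendstoIn 𝕜 D x l → l ∈ K

/-- The closure of a linear subspace: the smallest closed subspace containing it. -/
def bclosure (K : Submodule 𝕜 V) : Submodule 𝕜 V :=
  sInf {U : Submodule 𝕜 V | K ≤ U ∧ BClosed 𝕜 U}

end Maps

section DiscLemmas

variable {𝕜 : Type*} [RCLike 𝕜] {V : Type*} [AddCommGroup V] [Module 𝕜 V]

theorem IsDisc.comb {D : Set V} (hD : IsDisc 𝕜 D) {x y : V} (hx : x ∈ D) (hy : y ∈ D)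
    {a b : ℝ} (ha : 0 ≤ a) (hb : 0 ≤ b) :
    (a : 𝕜) • x + (b : 𝕜) • y ∈ ((a + b : ℝ) : 𝕜) • D := by
  rcases eq_or_lt_of_le (add_nonneg ha hb) with h | h
  · have ha0 : a = 0 := by linarith
    have hb0 : b = 0 := by linarith
    subst ha0 hb0
    exact ⟨x, hx, by simp⟩
  · refine ⟨_, hD.convex (a / (a + b)) (by positivity) ((div_le_one h).2 (by linarith))
      x hx y hy, ?_⟩
    have e1 : (a + b) * (a / (a + b)) = a := by field_simp
    have e2 : (a + b) * (1 - a / (a + b)) = b := by field_simp; ring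
    simp only [smul_add, smul_smul, ← RCLike.ofReal_mul, e1, e2]

theorem IsDisc.zero_mem {D : Set V} (hD : IsDisc 𝕜 D) : (0 : V) ∈ D := by
  obtain ⟨x, hx⟩ := hD.nonempty
  simpa using hD.circled 0 (by simp) x hx

theorem IsDisc.add_mem {D : Set V} (hD : IsDisc 𝕜 D) {x y : V} {a b : ℝ}
    (ha : 0 ≤ a) (hb : 0 ≤ b) (hx : x ∈ (a : 𝕜) • D) (hy : y ∈ (b : 𝕜) • D) :
    x + y ∈ ((a + b : ℝ) : 𝕜) • D := by
  obtain ⟨u, hu, rfl⟩ := hx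
  obtain ⟨v, hv, rfl⟩ := hy
  exact hD.comb hu hv ha hb

theorem IsDisc.smul_mem' {D : Set V} (hD : IsDisc 𝕜 D) {x : V} {a b : ℝ} (c : 𝕜)
    (ha : 0 ≤ a) (hb : ‖c‖ * a ≤ b) (hx : x ∈ (a : 𝕜) • D) : c • x ∈ (b : 𝕜) • D := by
  obtain ⟨u, hu, rfl⟩ := hx
  have hb0 : 0 ≤ b := le_trans (by positivity) hb
  rcases eq_or_lt_of_le hb0 with h | h
  · have : ‖c‖ * a = 0 := le_antisymm (by linarith) (by positivity)
    have hz : c * (a : 𝕜) = 0 := by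
      rw [← norm_eq_zero, norm_mul, RCLike.norm_ofReal, abs_of_nonneg ha, this]
    exact ⟨0, hD.zero_mem, by simp [smul_smul, hz]⟩
  · refine ⟨(c * a / b) • u, hD.circled _ ?_ u hu, ?_⟩
    · rw [norm_div, norm_mul, RCLike.norm_ofReal, RCLike.norm_ofReal, abs_of_nonneg ha,
        abs_of_pos h]
      exact (div_le_one h).2 hb
    · have : (b : 𝕜) ≠ 0 := by exact_mod_cast h.ne'
      simp only [smul_smul]
      congr 1
      field_simp

theorem IsDisc.mono {D : Set V} (hD : IsDisc 𝕜 D) {x : V} {a b : ℝ}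
    (ha : 0 ≤ a) (hab : a ≤ b) (hx : x ∈ (a : 𝕜) • D) : x ∈ (b : 𝕜) • D := by
  simpa using hD.smul_mem' (1 : 𝕜) ha (by simpa using hab) hx

theorem IsDisc.neg_mem {D : Set V} (hD : IsDisc 𝕜 D) {x : V} {a : ℝ}
    (ha : 0 ≤ a) (hx : x ∈ (a : 𝕜) • D) : -x ∈ (a : 𝕜) • D := by
  simpa using hD.smul_mem' (-1 : 𝕜) ha (by simp) hx

theorem IsDisc.sub_mem {D : Set V} (hD : IsDisc 𝕜 D) {x y : V} {a b : ℝ}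
    (ha : 0 ≤ a) (hb : 0 ≤ b) (hx : x ∈ (a : 𝕜) • D) (hy : y ∈ (b : 𝕜) • D) :
    x - y ∈ ((a + b : ℝ) : 𝕜) • D := by
  rw [sub_eq_add_neg]; exact hD.add_mem ha hb hx (hD.neg_mem hb hy)

theorem IsDisc.zero_mem' {D : Set V} (hD : IsDisc 𝕜 D) (a : ℝ) : (0 : V) ∈ (a : 𝕜) • D :=
  ⟨0, hD.zero_mem, by simp⟩

theorem IsDisc.sum_mem {ι : Type*} {D : Set V} (hD : IsDisc 𝕜 D) (c : ι → 𝕜) (z : ι → V)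
    (hz : ∀ i, c i ≠ 0 → z i ∈ D) (F : Finset ι) {r : ℝ} (hr : ∑ i ∈ F, ‖c i‖ ≤ r) :
    ∑ i ∈ F, c i • z i ∈ (r : 𝕜) • D := by
  classical
  refine hD.mono (Finset.sum_nonneg fun _ _ => norm_nonneg _) hr ?_
  clear hr
  induction F using Finset.induction_on with
  | empty => simpa using hD.zero_mem' (𝕜 := 𝕜) 0
  | insert i F hi ih =>
    rw [Finset.sum_insert hi, Finset.sum_insert hi]
    refine hD.add_mem (norm_nonneg _) (Finset.sum_nonneg fun _ _ => norm_nonneg _) ?_ ih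
    by_cases h : c i = 0
    · simpa [h] using hD.zero_mem' (𝕜 := 𝕜) 0
    · exact hD.smul_mem' (a := 1) (c i) zero_le_one (by simp) ⟨z i, hz i h, by simp⟩

theorem IsDisc.mem_span {D : Set V} {x : V} {a : ℝ} (hx : x ∈ (a : 𝕜) • D) :
    x ∈ Submodule.span 𝕜 D := by
  obtain ⟨u, hu, rfl⟩ := hx
  exact Submodule.smul_mem _ _ (Submodule.subset_span hu)

theorem IsDisc.exists_of_span {D : Set V} (hD : IsDisc 𝕜 D) {x : V}
    (hx : x ∈ Submodule.span 𝕜 D) : ∃ a : ℝ, 0 < a ∧ x ∈ (a : 𝕜) • D := by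
  induction hx using Submodule.span_induction with
  | mem x h => exact ⟨1, one_pos, x, h, by simp⟩
  | zero => exact ⟨1, one_pos, hD.zero_mem' 1⟩
  | add x y _ _ h1 h2 =>
    obtain ⟨a, ha, h1⟩ := h1
    obtain ⟨b, hb, h2⟩ := h2
    exact ⟨a + b, by positivity, hD.add_mem ha.le hb.le h1 h2⟩
  | smul c x _ h =>
    obtain ⟨a, ha, h⟩ := h
    exact ⟨‖c‖ * a + 1, by positivity, hD.smul_mem' c ha.le (by linarith) h⟩

/-- Completeness can be tested on geometric series. -/
theorem IsDisc.completant_of_series {D : Set V} (hD : IsDisc 𝕜 D)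
    (hn : ∀ x : V, (∀ ε : ℝ, 0 < ε → x ∈ ((ε : ℝ) : 𝕜) • D) → x = 0)
    (hs : ∀ d : ℕ → V, (∀ k, d k ∈ D) → ∃ l ∈ Submodule.span 𝕜 D,
      TendstoIn 𝕜 D (fun n => ∑ k ∈ Finset.range n, (((1 / 2 : ℝ) ^ k : ℝ) : 𝕜) • d k) l) :
    IsCompletant 𝕜 D := by
  refine ⟨hD, hn, fun x hx hc => ?_⟩
  have hc' : ∀ k : ℕ, ∃ N : ℕ, ∀ m, N ≤ m → ∀ n, N ≤ n →
      x m - x n ∈ (((1 / 2 : ℝ) ^ k : ℝ) : 𝕜) • D := fun k => hc _ (by positivity)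
  choose N hN using hc'
  set φ : ℕ → ℕ := fun k => ∑ i ∈ Finset.range (k + 1), N i with hφ
  have hφN : ∀ k, N k ≤ φ k := fun k =>
    Finset.single_le_sum (f := N) (fun _ _ => Nat.zero_le _) (Finset.self_mem_range_succ k)
  have hφs : ∀ k, φ k ≤ φ (k + 1) := fun k => by
    simp only [hφ]; rw [Finset.sum_range_succ N (k + 1)]; exact Nat.le_add_right _ _
  have hd : ∀ k, ∃ d ∈ D, (((1 / 2 : ℝ) ^ k : ℝ) : 𝕜) • d = x (φ (k + 1)) - x (φ k) :=
    fun k => hN k _ ((hφN k).trans (hφs k)) _ (hφN k)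
  choose d hdD hd using hd
  obtain ⟨l, hl, hlt⟩ := hs d hdD
  have hpart : ∀ n, ∑ k ∈ Finset.range n, (((1 / 2 : ℝ) ^ k : ℝ) : 𝕜) • d k
      = x (φ n) - x (φ 0) := fun n => by
    simp only [hd]; exact Finset.sum_range_sub (fun k => x (φ k)) n
  refine ⟨l + x (φ 0), Submodule.add_mem _ hl (hx _), fun ε hε => ?_⟩
  obtain ⟨n₁, hn₁⟩ := hlt (ε / 2) (by positivity)
  obtain ⟨k, hk⟩ := exists_pow_lt_of_lt_one (show 0 < ε / 2 by positivity)
    (show (1 / 2 : ℝ) < 1 by norm_num)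
  set K := max n₁ k
  have hK : (1 / 2 : ℝ) ^ K ≤ ε / 2 :=
    (pow_le_pow_of_le_one (by norm_num) (by norm_num) (le_max_right _ _)).trans hk.le
  refine ⟨φ K, fun n hn => ?_⟩
  have h1 : x n - x (φ K) ∈ ((ε / 2 : ℝ) : 𝕜) • D :=
    hD.mono (by positivity) hK (hN K _ ((hφN K).trans hn) _ (hφN K))
  have h2 := hn₁ K (le_max_left _ _)
  simp only [hpart] at h2
  have := hD.add_mem (by positivity) (by positivity) h1 h2
  rw [add_halves] at this
  convert this using 1
  abel

theorem IsCompletant.series {D : Set V} (hD : IsCompletant 𝕜 D) (d : ℕ → V)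
    (hd : ∀ k, d k ∈ D) : ∃ l ∈ Submodule.span 𝕜 D,
      TendstoIn 𝕜 D (fun n => ∑ k ∈ Finset.range n, (((1 / 2 : ℝ) ^ k : ℝ) : 𝕜) • d k) l := by
  have key : ∀ m n, m ≤ n → (∑ k ∈ Finset.range n, (((1 / 2 : ℝ) ^ k : ℝ) : 𝕜) • d k)
      - (∑ k ∈ Finset.range m, (((1 / 2 : ℝ) ^ k : ℝ) : 𝕜) • d k)
      ∈ ((2 * (1 / 2 : ℝ) ^ m : ℝ) : 𝕜) • D := fun m n hmn => by
    rw [← Finset.sum_Ico_eq_sub _ hmn]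
    refine hD.toIsDisc.sum_mem _ d (fun i _ => hd i) _ ?_
    have e : ∀ k : ℕ, ‖(((1 / 2 : ℝ) ^ k : ℝ) : 𝕜)‖ = (1 / 2 : ℝ) ^ k := fun k => by
      rw [RCLike.norm_ofReal, abs_of_nonneg (by positivity)]
    simp only [e]
    rw [geom_sum_Ico (by norm_num) hmn]
    have : (0 : ℝ) ≤ (1 / 2) ^ n := by positivity
    linarith [show ((1 / 2 : ℝ) ^ n - (1 / 2) ^ m) / (1 / 2 - 1)
      = 2 * (1 / 2) ^ m - 2 * (1 / 2) ^ n by ring]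
  refine hD.complete _ (fun n => Submodule.sum_mem _ fun k _ =>
    Submodule.smul_mem _ _ (Submodule.subset_span (hd k))) fun ε hε => ?_
  obtain ⟨k, hk⟩ := exists_pow_lt_of_lt_one (show 0 < ε / 2 by positivity)
    (show (1 / 2 : ℝ) < 1 by norm_num)
  have hb : ∀ m, k ≤ m → 2 * (1 / 2 : ℝ) ^ m ≤ ε := fun m hm => by
    have := pow_le_pow_of_le_one (show (0 : ℝ) ≤ 1 / 2 by norm_num) (by norm_num) hm
    linarith
  refine ⟨k, fun m hm n hn => ?_⟩
  rcases le_total m n with h | h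
  · have := hD.toIsDisc.neg_mem (by positivity)
      (hD.toIsDisc.mono (by positivity) (hb m hm) (key m n h))
    simpa using this
  · exact hD.toIsDisc.mono (by positivity) (hb n hn) (key n m h)

end DiscLemmas


section Quotient

variable {𝕜 : Type*} [RCLike 𝕜] {V : Type*} [AddCommGroup V] [Module 𝕜 V] [Bornology V]

theorem le_bclosure (K : Submodule 𝕜 V) : K ≤ bclosure K := le_sInf fun _ h => h.1

theorem bclosure_le {K U : Submodule 𝕜 V} (h : K ≤ U) (hU : BClosed 𝕜 U) : bclosure K ≤ U :=
  sInf_le ⟨h, hU⟩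

theorem bclosed_bclosure (K : Submodule 𝕜 V) : BClosed 𝕜 (bclosure K) := by
  intro D hD x l hx hl
  refine (Submodule.mem_sInf).2 fun U hU => ?_
  exact hU.2 D hD x l (fun n => bclosure_le hU.1 hU.2 (hx n)) hl

/-- The quotient bornology: the bounded sets are those contained in images of bounded sets. -/
@[reducible] def quotBornology (K : Submodule 𝕜 V) : Bornology (V ⧸ K) :=
  Bornology.ofBounded {B | ∃ S : Set V, Bornology.IsBounded S ∧ B ⊆ K.mkQ '' S}
    ⟨∅, Bornology.isBounded_empty, Set.empty_subset _⟩
    (fun _ ⟨S, hS, h⟩ _ h' => ⟨S, hS, h'.trans h⟩)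
    (fun _ ⟨S, hS, h⟩ _ ⟨S', hS', h'⟩ => ⟨S ∪ S', hS.union hS', by
      rw [Set.image_union]; exact Set.union_subset_union h h'⟩)
    (fun x => by
      obtain ⟨v, rfl⟩ := K.mkQ_surjective x
      exact ⟨{v}, Bornology.isBounded_singleton, by simp⟩)

theorem isBounded_quot_iff {K : Submodule 𝕜 V} {B : Set (V ⧸ K)} :
    @Bornology.IsBounded _ (quotBornology K) B ↔
      ∃ S : Set V, Bornology.IsBounded S ∧ B ⊆ K.mkQ '' S := by
  exact Bornology.isBounded_ofBounded_iff _

/-- The quotient of a complete bornological vector space by a closed subspace is complete. -/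
theorem completeBVS_quot [CompleteBVS 𝕜 V] {K : Submodule 𝕜 V} (hK : BClosed 𝕜 K) :
    @CompleteBVS 𝕜 _ (V ⧸ K) _ _ (quotBornology K) := by
  let _ := quotBornology K
  refine ⟨fun S T hS hT => ?_, fun c S hS => ?_, fun B hB => ?_⟩
  · obtain ⟨S', hS', hS⟩ := isBounded_quot_iff.1 hS
    obtain ⟨T', hT', hT⟩ := isBounded_quot_iff.1 hT
    refine isBounded_quot_iff.2 ⟨S' + T', CompleteBVS.isBounded_add 𝕜 _ _ hS' hT', ?_⟩
    rw [Set.image_add]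
    exact Set.add_subset_add hS hT
  · obtain ⟨S', hS', hS⟩ := isBounded_quot_iff.1 hS
    refine isBounded_quot_iff.2 ⟨c • S', CompleteBVS.isBounded_smul _ _ hS', ?_⟩
    rw [Set.image_smul_comm _ _ _ (fun b => map_smul _ _ _)]
    exact Set.smul_set_mono hS
  · obtain ⟨S, hS, hBS⟩ := isBounded_quot_iff.1 hB
    obtain ⟨D, hSD, hD, hDc⟩ := CompleteBVS.exists_completant (𝕜 := 𝕜) S hS
    have hdisc : IsDisc 𝕜 (K.mkQ '' D) := by
      refine ⟨hDc.nonempty.image _, ?_, ?_⟩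
      · rintro c hc _ ⟨x, hx, rfl⟩
        exact ⟨c • x, hDc.circled c hc x hx, by simp⟩
      · rintro t h0 h1 _ ⟨x, hx, rfl⟩ _ ⟨y, hy, rfl⟩
        exact ⟨_, hDc.convex t h0 h1 x hx y hy, by simp⟩
    refine ⟨K.mkQ '' D, hBS.trans (Set.image_mono hSD),
      isBounded_quot_iff.2 ⟨D, hD, subset_rfl⟩, hdisc.completant_of_series ?_ ?_⟩
    · intro q hq
      obtain ⟨v, rfl⟩ := K.mkQ_surjective q
      have h1 : ∀ n : ℕ, ∃ d ∈ D, v - ((1 / ((n : ℝ) + 1) : ℝ) : 𝕜) • d ∈ K := by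
        intro n
        obtain ⟨_, ⟨d, hd, rfl⟩, h⟩ := hq (1 / ((n : ℝ) + 1)) (by positivity)
        refine ⟨d, hd, ?_⟩
        rw [← Submodule.Quotient.mk_eq_zero K, Submodule.Quotient.mk_sub, sub_eq_zero]
        exact h.symm
      choose d hd hdK using h1
      have : v ∈ K := by
        refine hK D hD _ v hdK fun ε hε => ?_
        obtain ⟨N, hN⟩ := exists_nat_one_div_lt hε
        refine ⟨N, fun n hn => ?_⟩
        have h2 : ((1 / ((n : ℝ) + 1) : ℝ) : 𝕜) • d n ∈ ((1 / ((n : ℝ) + 1) : ℝ) : 𝕜) • D :=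
          ⟨d n, hd n, rfl⟩
        have h3 := hDc.toIsDisc.neg_mem (by positivity) h2
        have h4 := hDc.toIsDisc.mono (by positivity) (b := ε)
          ((Nat.one_div_le_one_div hn).trans hN.le) h3
        simpa using h4
      simpa using this
    · intro d hd
      choose e heD he using hd
      obtain ⟨l, hl, hlt⟩ := hDc.series e heD
      refine ⟨K.mkQ l, ?_, fun ε hε => ?_⟩
      · rw [Submodule.span_image]; exact ⟨l, hl, rfl⟩
      · obtain ⟨N, hN⟩ := hlt ε hε
        refine ⟨N, fun n hn => ?_⟩
        obtain ⟨u, hu, h⟩ := hN n hn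
        refine ⟨K.mkQ u, ⟨u, hu, rfl⟩, ?_⟩
        have := congrArg K.mkQ h
        simp only [map_smul, map_sub, map_sum, he] at this
        exact this

end Quotient

/-! ### The completed tensor product

An element of the completed tensor product of `M` and `N` is represented by an absolutely summable
family of scalars supported in a product of bounded sets, standing for `∑ c (m, n) • (m ⊗ n)`; the
completed tensor product is the quotient by the closure of the bilinearity relations. -/

section PreTensor

variable (𝕜 : Type*) [RCLike 𝕜] (M N : Type*) [Bornology M] [Bornology N]

/-- Absolutely summable families on `M × N` supported in a product of bounded sets. -/
def preTensorSub : Submodule 𝕜 (lp (fun _ : M × N => 𝕜) 1) where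
  carrier := {c | ∃ (S : Set M) (T : Set N), Bornology.IsBounded S ∧ Bornology.IsBounded T ∧
    ∀ p, c p ≠ 0 → p ∈ S ×ˢ T}
  zero_mem' := ⟨∅, ∅, Bornology.isBounded_empty, Bornology.isBounded_empty, by simp⟩
  add_mem' := by
    rintro a b ⟨S, T, hS, hT, h⟩ ⟨S', T', hS', hT', h'⟩
    refine ⟨S ∪ S', T ∪ T', hS.union hS', hT.union hT', fun p hp => ?_⟩
    by_cases ha : a p = 0
    · have hb : b p ≠ 0 := fun hb => hp (by simp [ha, hb])
      exact ⟨Or.inr (h' p hb).1, Or.inr (h' p hb).2⟩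
    · exact ⟨Or.inl (h p ha).1, Or.inl (h p ha).2⟩
  smul_mem' := by
    rintro k a ⟨S, T, hS, hT, h⟩
    refine ⟨S, T, hS, hT, fun p hp => h p fun ha => hp (by simp [ha])⟩

/-- Absolutely summable families on `M × N` supported in a product of bounded sets. -/
def PreTensor : Type _ := ↥(preTensorSub 𝕜 M N)

noncomputable instance : AddCommGroup (PreTensor 𝕜 M N) :=
  inferInstanceAs (AddCommGroup ↥(preTensorSub 𝕜 M N))

noncomputable instance : Module 𝕜 (PreTensor 𝕜 M N) :=
  inferInstanceAs (Module 𝕜 ↥(preTensorSub 𝕜 M N))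

variable {𝕜 M N}

/-- The underlying summable family. -/
noncomputable def PreTensor.val : PreTensor 𝕜 M N →ₗ[𝕜] lp (fun _ : M × N => 𝕜) 1 :=
  (preTensorSub 𝕜 M N).subtype

/-- The entry of a family at `p`. -/
noncomputable def PreTensor.coef (p : M × N) : PreTensor 𝕜 M N →ₗ[𝕜] 𝕜 :=
  (lp.evalCLM 𝕜 (fun _ : M × N => 𝕜) 1 p).toLinearMap ∘ₗ PreTensor.val

theorem PreTensor.coef_apply (p : M × N) (c : PreTensor 𝕜 M N) : PreTensor.coef p c = c.val p := rfl

theorem PreTensor.val_injective : Function.Injective (PreTensor.val (𝕜 := 𝕜) (M := M) (N := N)) :=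
  Subtype.val_injective

/-- The families supported in `S × T` with `ℓ¹`-norm at most `r`. -/
def preDisc (S : Set M) (T : Set N) (r : ℝ) : Set (PreTensor 𝕜 M N) :=
  {c | ‖c.val‖ ≤ r ∧ ∀ p, c.val p ≠ 0 → p ∈ S ×ˢ T}

/-- The family with the single entry `1` at `(m, n)`. -/
noncomputable def PreTensor.delta (m : M) (n : N) : PreTensor 𝕜 M N := by
  classical
  exact ⟨lp.single 1 (m, n) 1, {m}, {n}, Bornology.isBounded_singleton,
    Bornology.isBounded_singleton, fun p hp => by
      by_contra hne
      refine hp ?_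
      rw [lp.single_apply]
      exact Pi.single_eq_of_ne (by simpa [Prod.ext_iff] using hne) _⟩

open scoped Classical in
theorem PreTensor.val_delta (m : M) (n : N) :
    (PreTensor.delta (𝕜 := 𝕜) m n).val = lp.single 1 (m, n) (1 : 𝕜) := by
  unfold PreTensor.delta PreTensor.val
  rfl

/-- A set of families is bounded if the families are supported in a common product of bounded
sets and their `ℓ¹`-norms are bounded. -/
noncomputable instance : Bornology (PreTensor 𝕜 M N) :=
  Bornology.ofBounded {B | ∃ (S : Set M) (T : Set N) (r : ℝ), Bornology.IsBounded S ∧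
      Bornology.IsBounded T ∧ B ⊆ preDisc S T r}
    ⟨∅, ∅, 0, Bornology.isBounded_empty, Bornology.isBounded_empty, Set.empty_subset _⟩
    (fun _ ⟨S, T, r, hS, hT, h⟩ _ h' => ⟨S, T, r, hS, hT, h'.trans h⟩)
    (fun _ ⟨S, T, r, hS, hT, h⟩ _ ⟨S', T', r', hS', hT', h'⟩ =>
      ⟨S ∪ S', T ∪ T', max r r', hS.union hS', hT.union hT', Set.union_subset
        (fun c hc => ⟨(h hc).1.trans (le_max_left _ _), fun p hp =>
          Set.prod_mono Set.subset_union_left Set.subset_union_left ((h hc).2 p hp)⟩)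
        (fun c hc => ⟨(h' hc).1.trans (le_max_right _ _), fun p hp =>
          Set.prod_mono Set.subset_union_right Set.subset_union_right ((h' hc).2 p hp)⟩)⟩)
    (fun c => by
      obtain ⟨S, T, hS, hT, h⟩ := c.2
      exact ⟨S, T, ‖c.val‖, hS, hT, by rintro _ rfl; exact ⟨le_rfl, h⟩⟩)

theorem isBounded_pre_iff {B : Set (PreTensor 𝕜 M N)} : Bornology.IsBounded B ↔
    ∃ (S : Set M) (T : Set N) (r : ℝ), Bornology.IsBounded S ∧
      Bornology.IsBounded T ∧ B ⊆ preDisc S T r :=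
  Bornology.isBounded_ofBounded_iff _

theorem mem_smul_preDisc {S : Set M} {T : Set N} {r ε : ℝ} (hε : 0 < ε)
    {c : PreTensor 𝕜 M N} : c ∈ ((ε : ℝ) : 𝕜) • (preDisc S T r : Set (PreTensor 𝕜 M N)) ↔
      ‖c.val‖ ≤ ε * r ∧ ∀ p, c.val p ≠ 0 → p ∈ S ×ˢ T := by
  have hε' : (ε : 𝕜) ≠ 0 := by exact_mod_cast hε.ne'
  constructor
  · rintro ⟨d, ⟨hd, hd'⟩, rfl⟩
    refine ⟨?_, fun p hp => hd' p fun h => hp (by simp [h])⟩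
    simp only [map_smul, norm_smul, RCLike.norm_ofReal, abs_of_pos hε]
    gcongr
  · rintro ⟨h, h'⟩
    refine ⟨(ε : 𝕜)⁻¹ • c, ⟨?_, fun p hp => h' p fun h => hp (by simp [h])⟩, ?_⟩
    · simp only [map_smul, norm_smul, norm_inv, RCLike.norm_ofReal, abs_of_pos hε]
      rw [inv_mul_le_iff₀ hε]; exact h
    · simp only [smul_smul, mul_inv_cancel₀ hε', one_smul]

theorem preDisc_isDisc (S : Set M) (T : Set N) {r : ℝ} (hr : 0 ≤ r) :
    IsDisc 𝕜 (preDisc S T r : Set (PreTensor 𝕜 M N)) := by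
  refine ⟨⟨0, by simpa using hr, by simp⟩, ?_, ?_⟩
  · rintro c hc x ⟨hx, hx'⟩
    refine ⟨?_, fun p hp => hx' p fun h => hp (by simp [h])⟩
    simp only [map_smul, norm_smul]
    exact (mul_le_of_le_one_left (norm_nonneg _) hc).trans hx
  · rintro t h0 h1 x ⟨hx, hx'⟩ y ⟨hy, hy'⟩
    refine ⟨?_, fun p hp => ?_⟩
    · simp only [map_add, map_smul]
      refine (norm_add_le _ _).trans ?_
      rw [norm_smul, norm_smul, RCLike.norm_ofReal, RCLike.norm_ofReal, abs_of_nonneg h0,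
        abs_of_nonneg (sub_nonneg.2 h1)]
      have := mul_le_mul_of_nonneg_left hx h0
      have := mul_le_mul_of_nonneg_left hy (sub_nonneg.2 h1)
      linarith
    · by_cases h : x.val p = 0
      · refine hy' p fun h' => hp ?_
        rw [← PreTensor.coef_apply] at h h' ⊢
        simp only [map_add, map_smul, h, h', smul_zero, add_zero]
      · exact hx' p h

theorem preDisc_completant (S : Set M) (T : Set N) {r : ℝ} (hr : 0 < r)
    (hS : Bornology.IsBounded S) (hT : Bornology.IsBounded T) :
    IsCompletant 𝕜 (preDisc S T r : Set (PreTensor 𝕜 M N)) := by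
  refine (preDisc_isDisc S T hr.le).completant_of_series ?_ ?_
  · intro x hx
    apply PreTensor.val_injective
    rw [map_zero, ← norm_le_zero_iff]
    refine le_of_forall_pos_le_add fun ε hε => ?_
    have := ((mem_smul_preDisc (by positivity)).1 (hx (ε / r) (by positivity))).1
    rwa [div_mul_cancel₀ _ hr.ne', ← zero_add ε] at this
  · intro d hd
    set g : ℕ → lp (fun _ : M × N => 𝕜) 1 := fun k => (((1 / 2 : ℝ) ^ k : ℝ) : 𝕜) • (d k).val
    have hg : Summable g := by
      refine Summable.of_norm_bounded (g := fun k => (1 / 2 : ℝ) ^ k * r)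
        ((summable_geometric_of_lt_one (by norm_num) (by norm_num)).mul_right r) fun k => ?_
      simp only [g, norm_smul, RCLike.norm_ofReal]
      rw [abs_of_nonneg (by positivity)]
      exact mul_le_mul_of_nonneg_left (hd k).1 (by positivity)
    have hsupp : ∀ p, (∑' k, g k : lp (fun _ : M × N => 𝕜) 1) p ≠ 0 → p ∈ S ×ˢ T := by
      intro p hp
      by_contra hpn
      refine hp ?_
      have h1 : ∀ n, (∑ k ∈ Finset.range n, g k : lp (fun _ : M × N => 𝕜) 1) p = 0 := fun n => by
        rw [lp.coeFn_sum, Finset.sum_apply]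
        refine Finset.sum_eq_zero fun k _ => ?_
        have : (d k).val p = 0 := by_contra fun h => hpn ((hd k).2 p h)
        simp [g, this]
      have h2 := hg.hasSum.tendsto_sum_nat
      have h3 := ((lp.evalCLM 𝕜 (fun _ : M × N => 𝕜) 1 p).continuous.tendsto _).comp h2
      refine tendsto_nhds_unique h3 ?_
      refine tendsto_const_nhds.congr fun n => (h1 n).symm
    set l : PreTensor 𝕜 M N := ⟨∑' k, g k, S, T, hS, hT, hsupp⟩
    have hlv : l.val = ∑' k, g k := rfl
    refine ⟨l, IsDisc.mem_span (a := ‖l.val‖ / r + 1) ?_, fun ε hε => ?_⟩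
    · refine (mem_smul_preDisc (by positivity)).2 ⟨?_, hsupp⟩
      rw [add_mul, div_mul_cancel₀ _ hr.ne']; linarith
    · have h2 := hg.hasSum.tendsto_sum_nat
      obtain ⟨n₀, hn₀⟩ := Metric.tendsto_atTop.1 h2 (ε * r) (by positivity)
      refine ⟨n₀, fun n hn => (mem_smul_preDisc hε).2 ⟨?_, fun p hp => ?_⟩⟩
      · have := hn₀ n hn
        rw [dist_eq_norm] at this
        simpa [hlv, g] using this.le
      · by_contra hpn
        refine hp ?_
        have e1 : l.val p = 0 := by_contra fun h => hpn (hsupp p h)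
        have e2 : ∀ k, (d k).val p = 0 := fun k => by_contra fun h => hpn ((hd k).2 p h)
        simp only [← PreTensor.coef_apply] at e1 e2 ⊢
        simp only [map_sub, map_sum, map_smul, e1, e2, smul_zero, Finset.sum_const_zero, sub_zero]

instance : CompleteBVS 𝕜 (PreTensor 𝕜 M N) := by
  refine ⟨fun A B hA hB => ?_, fun c A hA => ?_, fun A hA => ?_⟩
  · obtain ⟨S, T, r, hS, hT, h⟩ := isBounded_pre_iff.1 hA
    obtain ⟨S', T', r', hS', hT', h'⟩ := isBounded_pre_iff.1 hB
    refine isBounded_pre_iff.2 ⟨S ∪ S', T ∪ T', r + r', hS.union hS', hT.union hT', ?_⟩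
    rintro _ ⟨a, ha, b, hb, rfl⟩
    refine ⟨?_, fun p hp => ?_⟩
    · simp only [map_add]
      exact (norm_add_le _ _).trans (add_le_add (h ha).1 (h' hb).1)
    · by_cases hap : a.val p = 0
      · have hbp := (h' hb).2 p fun h' => hp (by simp [hap, h'])
        exact ⟨Or.inr hbp.1, Or.inr hbp.2⟩
      · exact ⟨Or.inl ((h ha).2 p hap).1, Or.inl ((h ha).2 p hap).2⟩
  · obtain ⟨S, T, r, hS, hT, h⟩ := isBounded_pre_iff.1 hA
    refine isBounded_pre_iff.2 ⟨S, T, ‖c‖ * r, hS, hT, ?_⟩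
    rintro _ ⟨a, ha, rfl⟩
    refine ⟨?_, fun p hp => (h ha).2 p fun h => hp (by simp [h])⟩
    simp only [map_smul, norm_smul]
    exact mul_le_mul_of_nonneg_left (h ha).1 (norm_nonneg _)
  · obtain ⟨S, T, r, hS, hT, h⟩ := isBounded_pre_iff.1 hA
    refine ⟨preDisc S T (max r 1), fun a ha => ⟨(h ha).1.trans (le_max_left _ _), (h ha).2⟩,
      isBounded_pre_iff.2 ⟨S, T, _, hS, hT, subset_rfl⟩,
      preDisc_completant S T (lt_max_of_lt_right one_pos) hS hT⟩

end PreTensor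


section Sums

variable {𝕜 : Type*} [RCLike 𝕜] {V W Z : Type*}
  [AddCommGroup V] [Module 𝕜 V] [Bornology V]
  [AddCommGroup W] [Module 𝕜 W] [Bornology W]
  [AddCommGroup Z] [Module 𝕜 Z] [Bornology Z]

theorem eq_zero_of_small [CompleteBVS 𝕜 Z] {D : Set Z} (hD : Bornology.IsBounded D) {z : Z}
    (h : ∀ ε : ℝ, 0 < ε → z ∈ ((ε : ℝ) : 𝕜) • D) : z = 0 := by
  obtain ⟨D', hDD', _, hD'⟩ := CompleteBVS.exists_completant (𝕜 := 𝕜) D hD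
  exact hD'.norming z fun ε hε => Set.smul_set_mono hDD' (h ε hε)

/-- The kernel of a bounded map into a complete space is closed. -/
theorem IsBdd.bclosed_ker [CompleteBVS 𝕜 Z] {g : V →ₗ[𝕜] Z} (hg : IsBdd g) :
    BClosed 𝕜 (LinearMap.ker g) := by
  intro D hD x l hx hl
  have h : -(g l) = 0 := eq_zero_of_small (𝕜 := 𝕜) (hg D hD) fun ε hε => by
    obtain ⟨N, hN⟩ := hl ε hε
    obtain ⟨d, hd, he⟩ := hN N le_rfl
    refine ⟨g d, ⟨d, hd, rfl⟩, ?_⟩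
    have := congrArg g he
    simp only [map_smul, map_sub, LinearMap.mem_ker.1 (hx N), zero_sub] at this
    exact this
  simpa using h

variable (𝕜) in
/-- Unconditional convergence of a series, with respect to some bounded set. -/
def HasBSum {ι : Type*} (g : ι → Z) (l : Z) : Prop :=
  ∃ D : Set Z, Bornology.IsBounded D ∧ ∀ ε : ℝ, 0 < ε → ∃ F₀ : Finset ι, ∀ F, F₀ ⊆ F →
    ∑ p ∈ F, g p - l ∈ ((ε : ℝ) : 𝕜) • D

theorem HasBSum.enlarge [CompleteBVS 𝕜 Z] {ι : Type*} {g : ι → Z} {l : Z}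
    (h : HasBSum 𝕜 g l) : ∃ D₀ : Set Z, Bornology.IsBounded D₀ ∧ ∀ D, D₀ ⊆ D →
      ∀ ε : ℝ, 0 < ε → ∃ F₀ : Finset ι, ∀ F, F₀ ⊆ F →
        ∑ p ∈ F, g p - l ∈ ((ε : ℝ) : 𝕜) • D := by
  obtain ⟨D, hD, h⟩ := h
  refine ⟨D, hD, fun D' hD' ε hε => ?_⟩
  obtain ⟨F₀, hF⟩ := h ε hε
  exact ⟨F₀, fun F hF' => Set.smul_set_mono hD' (hF F hF')⟩

theorem HasBSum.unique [CompleteBVS 𝕜 Z] {ι : Type*} {g : ι → Z} {l l' : Z}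
    (h : HasBSum 𝕜 g l) (h' : HasBSum 𝕜 g l') : l = l' := by
  classical
  obtain ⟨D₁, hD₁, h⟩ := h.enlarge
  obtain ⟨D₂, hD₂, h'⟩ := h'.enlarge
  obtain ⟨D, hDD, hD, hDc⟩ := CompleteBVS.exists_completant (𝕜 := 𝕜) _ (hD₁.union hD₂)
  rw [← sub_eq_zero]
  refine hDc.norming _ fun ε hε => ?_
  obtain ⟨F, hF⟩ := h D (Set.subset_union_left.trans hDD) (ε / 2) (by positivity)
  obtain ⟨F', hF'⟩ := h' D (Set.subset_union_right.trans hDD) (ε / 2) (by positivity)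
  have := hDc.toIsDisc.sub_mem (by positivity) (by positivity)
    (hF' (F ∪ F') Finset.subset_union_right) (hF (F ∪ F') Finset.subset_union_left)
  rw [add_halves] at this
  convert this using 1
  abel

theorem HasBSum.add [CompleteBVS 𝕜 Z] {ι : Type*} {g g' : ι → Z} {l l' : Z}
    (h : HasBSum 𝕜 g l) (h' : HasBSum 𝕜 g' l') : HasBSum 𝕜 (g + g') (l + l') := by
  classical
  obtain ⟨D₁, hD₁, h⟩ := h.enlarge
  obtain ⟨D₂, hD₂, h'⟩ := h'.enlarge
  obtain ⟨D, hDD, hD, hDc⟩ := CompleteBVS.exists_completant (𝕜 := 𝕜) _ (hD₁.union hD₂)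
  refine ⟨D, hD, fun ε hε => ?_⟩
  obtain ⟨F, hF⟩ := h D (Set.subset_union_left.trans hDD) (ε / 2) (by positivity)
  obtain ⟨F', hF'⟩ := h' D (Set.subset_union_right.trans hDD) (ε / 2) (by positivity)
  refine ⟨F ∪ F', fun G hG => ?_⟩
  have := hDc.toIsDisc.add_mem (by positivity) (by positivity)
    (hF G (Finset.subset_union_left.trans hG)) (hF' G (Finset.subset_union_right.trans hG))
  rw [add_halves] at this
  convert this using 1
  simp only [Pi.add_apply, Finset.sum_add_distrib]
  abel

theorem HasBSum.smul [CompleteBVS 𝕜 Z] {ι : Type*} {g : ι → Z} {l : Z} (c : 𝕜)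
    (h : HasBSum 𝕜 g l) : HasBSum 𝕜 (c • g) (c • l) := by
  obtain ⟨D, hD, h⟩ := h
  refine ⟨c • D, CompleteBVS.isBounded_smul _ _ hD, fun ε hε => ?_⟩
  obtain ⟨F₀, hF⟩ := h ε hε
  refine ⟨F₀, fun F hF' => ?_⟩
  rw [smul_comm]
  refine ⟨_, hF F hF', ?_⟩
  simp [smul_sub, Finset.smul_sum]

/-- Absolutely convergent series in a completant disc converge. -/
theorem IsCompletant.hasBSum {ι : Type*} {D : Set Z} (hDb : Bornology.IsBounded D)
    (hD : IsCompletant 𝕜 D) (c : ι → 𝕜) (z : ι → Z) (hz : ∀ i, c i ≠ 0 → z i ∈ D)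
    (hc : Summable fun i => ‖c i‖) {r : ℝ} (hr : ∑' i, ‖c i‖ ≤ r) :
    ∃ l, HasBSum 𝕜 (fun i => c i • z i) l ∧ l ∈ ((r + 1 : ℝ) : 𝕜) • D := by
  classical
  have hd := hD.toIsDisc
  have tail : ∀ k : ℕ, ∃ F : Finset ι, ∀ G, Disjoint G F → ∑ i ∈ G, ‖c i‖ ≤ (1 / 2 : ℝ) ^ k := by
    intro k
    obtain ⟨F, hF⟩ := (summable_iff_vanishing_norm.1 hc) ((1 / 2 : ℝ) ^ k) (by positivity)
    refine ⟨F, fun G hG => ?_⟩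
    have := hF G hG
    rw [Real.norm_of_nonneg (Finset.sum_nonneg fun _ _ => norm_nonneg _)] at this
    exact this.le
  choose F hF using tail
  set E : ℕ → Finset ι := fun k => (Finset.range (k + 1)).biUnion F with hE
  have hFE : ∀ k n, k ≤ n → F k ⊆ E n := fun k n h =>
    Finset.subset_biUnion_of_mem F (Finset.mem_range.2 (Nat.lt_succ_of_le h))
  have near : ∀ (k : ℕ) (G H : Finset ι), F k ⊆ G → F k ⊆ H →
      ∑ i ∈ G, c i • z i - ∑ i ∈ H, c i • z i ∈ ((2 * (1 / 2 : ℝ) ^ k : ℝ) : 𝕜) • D := by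
    intro k G H hG hH
    have e : ∑ i ∈ G, c i • z i - ∑ i ∈ H, c i • z i
        = ∑ i ∈ G \ H, c i • z i - ∑ i ∈ H \ G, c i • z i :=
      (Finset.sum_sdiff_sub_sum_sdiff).symm
    rw [e, two_mul]
    refine hd.sub_mem (by positivity) (by positivity)
      (hd.sum_mem c z hz _ (hF k _ ?_)) (hd.sum_mem c z hz _ (hF k _ ?_))
    · exact Finset.sdiff_disjoint.mono_right hH
    · exact Finset.sdiff_disjoint.mono_right hG
  have small : ∀ ε : ℝ, 0 < ε → ∃ k : ℕ, 2 * (1 / 2 : ℝ) ^ k ≤ ε := fun ε hε => by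
    obtain ⟨k, hk⟩ := exists_pow_lt_of_lt_one (show 0 < ε / 2 by positivity)
      (show (1 / 2 : ℝ) < 1 by norm_num)
    exact ⟨k, by linarith⟩
  obtain ⟨l, -, hl⟩ := hD.complete (fun n => ∑ i ∈ E n, c i • z i)
    (fun n => IsDisc.mem_span (hd.sum_mem c z hz _ le_rfl)) (fun ε hε => by
      obtain ⟨k, hk⟩ := small ε hε
      exact ⟨k, fun m hm n hn => hd.mono (by positivity) hk
        (near k _ _ (hFE k m hm) (hFE k n hn))⟩)
  refine ⟨l, ⟨D, hDb, fun ε hε => ?_⟩, ?_⟩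
  · obtain ⟨k, hk⟩ := small (ε / 2) (by positivity)
    obtain ⟨N, hN⟩ := hl (ε / 2) (by positivity)
    refine ⟨F k, fun G hG => ?_⟩
    have h1 := hd.mono (by positivity) hk (near k G (E (max N k)) hG (hFE _ _ (le_max_right _ _)))
    have := hd.add_mem (by positivity) (by positivity) h1 (hN _ (le_max_left N k))
    rw [add_halves] at this
    convert this using 1
    abel
  · obtain ⟨N, hN⟩ := hl 1 one_pos
    have h0 : 0 ≤ r := (tsum_nonneg fun _ => norm_nonneg _).trans hr
    have h1 := hd.sum_mem c z hz (E N) ((hc.sum_le_tsum _ fun _ _ => norm_nonneg _).trans hr)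
    have := hd.sub_mem h0 zero_le_one h1 (hN N le_rfl)
    simpa using this

end Sums

section PreLift

set_option linter.unusedSectionVars false

variable {𝕜 : Type*} [RCLike 𝕜] {M N Z : Type*}
  [AddCommGroup M] [Module 𝕜 M] [Bornology M]
  [AddCommGroup N] [Module 𝕜 N] [Bornology N]
  [AddCommGroup Z] [Module 𝕜 Z] [Bornology Z] [CompleteBVS 𝕜 Z]

theorem PreTensor.summable_norm (c : PreTensor 𝕜 M N) : Summable fun p => ‖c.val p‖ := by
  simpa using (lp.memℓp c.val).summable (by simp)

theorem PreTensor.norm_val (c : PreTensor 𝕜 M N) : ‖c.val‖ = ∑' p, ‖c.val p‖ := by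
  simpa using lp.norm_eq_tsum_rpow (p := 1) (by simp) c.val

theorem PreTensor.exists_sum (f : M →ₗ[𝕜] N →ₗ[𝕜] Z) {S : Set M} {T : Set N} {r : ℝ} {D : Set Z}
    (hDb : Bornology.IsBounded D) (hD : IsCompletant 𝕜 D)
    (hf : Set.image2 (fun m n => f m n) S T ⊆ D) {c : PreTensor 𝕜 M N} (hc : c ∈ preDisc S T r) :
    ∃ l, HasBSum 𝕜 (fun p => c.val p • f p.1 p.2) l ∧ l ∈ ((r + 1 : ℝ) : 𝕜) • D :=
  hD.hasBSum hDb _ (fun p : M × N => f p.1 p.2)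
    (fun p hp => hf ⟨p.1, (hc.2 p hp).1, p.2, (hc.2 p hp).2, rfl⟩)
    c.summable_norm (by rw [← c.norm_val]; exact hc.1)

theorem PreTensor.exists_sum' {f : M →ₗ[𝕜] N →ₗ[𝕜] Z} (hf : IsBddBilin f) (c : PreTensor 𝕜 M N) :
    ∃ l, HasBSum 𝕜 (fun p => c.val p • f p.1 p.2) l := by
  obtain ⟨S, T, r, hS, hT, h⟩ := isBounded_pre_iff.1 (Bornology.isBounded_singleton (x := c))
  obtain ⟨D, hSD, hDb, hD⟩ := CompleteBVS.exists_completant (𝕜 := 𝕜) _ (hf S T hS hT)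
  obtain ⟨l, hl, -⟩ := exists_sum f hDb hD hSD (h rfl)
  exact ⟨l, hl⟩

/-- The map `c ↦ ∑ c (m, n) • f m n`. -/
noncomputable def PreTensor.lift (f : M →ₗ[𝕜] N →ₗ[𝕜] Z) (hf : IsBddBilin f) :
    PreTensor 𝕜 M N →ₗ[𝕜] Z where
  toFun c := (exists_sum' hf c).choose
  map_add' a b := by
    refine (exists_sum' hf (a + b)).choose_spec.unique (𝕜 := 𝕜) ?_
    have := (exists_sum' hf a).choose_spec.add (exists_sum' hf b).choose_spec
    convert this using 1
    funext p
    have e : (a + b).val p = a.val p + b.val p := (coef p).map_add a b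
    simp only [Pi.add_apply, e, add_smul]
  map_smul' k a := by
    refine (exists_sum' hf (k • a)).choose_spec.unique (𝕜 := 𝕜) ?_
    have := (exists_sum' hf a).choose_spec.smul k
    have e : (fun p => (k • a).val p • f p.1 p.2) = k • fun p => a.val p • f p.1 p.2 := by
      funext p
      have e : (k • a).val p = k * a.val p := (coef p).map_smul k a
      simp only [Pi.smul_apply, e, mul_smul]
    rw [e]
    exact this

theorem PreTensor.hasBSum_lift (f : M →ₗ[𝕜] N →ₗ[𝕜] Z) (hf : IsBddBilin f)
    (c : PreTensor 𝕜 M N) : HasBSum 𝕜 (fun p => c.val p • f p.1 p.2) (PreTensor.lift f hf c) :=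
  (exists_sum' hf c).choose_spec

theorem PreTensor.lift_mem (f : M →ₗ[𝕜] N →ₗ[𝕜] Z) (hfb : IsBddBilin f)
    {S : Set M} {T : Set N} {r : ℝ} {D : Set Z}
    (hDb : Bornology.IsBounded D) (hD : IsCompletant 𝕜 D)
    (hf : Set.image2 (fun m n => f m n) S T ⊆ D) {c : PreTensor 𝕜 M N} (hc : c ∈ preDisc S T r) :
    PreTensor.lift f hfb c ∈ ((r + 1 : ℝ) : 𝕜) • D := by
  obtain ⟨l, hl, hlD⟩ := exists_sum f hDb hD hf hc
  rwa [(hasBSum_lift f hfb c).unique hl]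

theorem PreTensor.lift_delta (f : M →ₗ[𝕜] N →ₗ[𝕜] Z) (hf : IsBddBilin f) (m : M) (n : N) :
    PreTensor.lift f hf (PreTensor.delta m n) = f m n := by
  classical
  refine (hasBSum_lift f hf _).unique (𝕜 := 𝕜) ⟨{0}, Bornology.isBounded_singleton,
    fun ε hε => ⟨{(m, n)}, fun F hF => ?_⟩⟩
  refine ⟨0, rfl, ?_⟩
  rw [Finset.sum_eq_single_of_mem (m, n) (hF (Finset.mem_singleton_self _))]
  · rw [val_delta]; simp
  · intro p _ hp
    rw [val_delta, lp.single_apply_ne _ _ _ hp, zero_smul]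

theorem PreTensor.lift_isBdd (f : M →ₗ[𝕜] N →ₗ[𝕜] Z) (hf : IsBddBilin f) :
    IsBdd (PreTensor.lift f hf) := by
  intro B hB
  obtain ⟨S, T, r, hS, hT, h⟩ := isBounded_pre_iff.1 hB
  obtain ⟨D, hSD, hDb, hD⟩ := CompleteBVS.exists_completant (𝕜 := 𝕜) _ (hf S T hS hT)
  refine (CompleteBVS.isBounded_smul ((r + 1 : ℝ) : 𝕜) D hDb).subset ?_
  rintro _ ⟨c, hc, rfl⟩
  exact lift_mem f hf hDb hD hSD (h hc)

/-- A closed subspace containing all `delta m n` is everything. -/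
theorem PreTensor.eq_top {U : Submodule 𝕜 (PreTensor 𝕜 M N)} (hU : BClosed 𝕜 U)
    (h : ∀ m n, PreTensor.delta m n ∈ U) : U = ⊤ := by
  classical
  rw [eq_top_iff]
  rintro c -
  obtain ⟨S, T, r, hS, hT, hc⟩ := isBounded_pre_iff.1 (Bornology.isBounded_singleton (x := c))
  have hc := hc rfl
  have hs := lp.hasSum_single (E := fun _ : M × N => 𝕜) (p := 1) (by simp) c.val
  have hF : ∀ k : ℕ, ∃ F : Finset (M × N),
      ‖∑ p ∈ F, lp.single 1 p (c.val p) - c.val‖ < (1 / 2 : ℝ) ^ k := fun k => by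
    obtain ⟨F, hF⟩ := (Metric.tendsto_atTop.1 hs) ((1 / 2 : ℝ) ^ k) (by positivity)
    exact ⟨F, by simpa [dist_eq_norm] using hF F le_rfl⟩
  choose F hF using hF
  have hval : ∀ k, (∑ p ∈ F k, c.val p • PreTensor.delta p.1 p.2 : PreTensor 𝕜 M N).val
      = ∑ p ∈ F k, lp.single 1 p (c.val p) := fun k => by
    rw [map_sum]
    refine Finset.sum_congr rfl fun p _ => ?_
    rw [map_smul, val_delta, ← lp.single_smul, smul_eq_mul, mul_one]
  refine hU (preDisc S T 1) (isBounded_pre_iff.2 ⟨S, T, 1, hS, hT, subset_rfl⟩)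
    (fun k => ∑ p ∈ F k, c.val p • PreTensor.delta p.1 p.2) c
    (fun k => Submodule.sum_mem _ fun p _ => Submodule.smul_mem _ _ (h _ _)) fun ε hε => ?_
  obtain ⟨k, hk⟩ := exists_pow_lt_of_lt_one hε (show (1 / 2 : ℝ) < 1 by norm_num)
  refine ⟨k, fun n hn => (mem_smul_preDisc hε).2 ⟨?_, fun p hp => ?_⟩⟩
  · rw [map_sub, hval, mul_one]
    exact ((hF n).le.trans (pow_le_pow_of_le_one (by norm_num) (by norm_num) hn)).trans hk.le
  · by_contra hpn
    refine hp ?_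
    have e1 : c.val p = 0 := by_contra fun h => hpn (hc.2 p h)
    have e2 : (∑ q ∈ F n, lp.single 1 q (c.val q) : lp (fun _ : M × N => 𝕜) 1) p = 0 := by
      rw [lp.coeFn_sum, Finset.sum_apply]
      refine Finset.sum_eq_zero fun q _ => ?_
      rw [lp.single_apply]
      by_cases hq : p = q
      · subst hq; simp [e1]
      · exact Pi.single_eq_of_ne hq _
    rw [map_sub, hval]
    change (∑ q ∈ F n, lp.single 1 q (c.val q) : lp (fun _ : M × N => 𝕜) 1) p - c.val p = 0
    rw [e1, e2, sub_zero]

end PreLift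


section CTensor

variable (𝕜 : Type*) [RCLike 𝕜] (M N : Type*)
  [AddCommGroup M] [Module 𝕜 M] [Bornology M]
  [AddCommGroup N] [Module 𝕜 N] [Bornology N]

/-- The bilinearity relations. -/
noncomputable def tensorRel : Submodule 𝕜 (PreTensor 𝕜 M N) :=
  Submodule.span 𝕜
    ({c | ∃ (m m' : M) (n : N), c = PreTensor.delta (m + m') n
        - PreTensor.delta m n - PreTensor.delta m' n} ∪
     {c | ∃ (m : M) (n n' : N), c = PreTensor.delta m (n + n')
        - PreTensor.delta m n - PreTensor.delta m n'} ∪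
     {c | ∃ (k : 𝕜) (m : M) (n : N), c = PreTensor.delta (k • m) n - k • PreTensor.delta m n} ∪
     {c | ∃ (k : 𝕜) (m : M) (n : N), c = PreTensor.delta m (k • n) - k • PreTensor.delta m n})

/-- The completed tensor product of `M` and `N` over the ground field. -/
def CTensor : Type _ := PreTensor 𝕜 M N ⧸ bclosure (tensorRel 𝕜 M N)

noncomputable instance : AddCommGroup (CTensor 𝕜 M N) :=
  inferInstanceAs (AddCommGroup (PreTensor 𝕜 M N ⧸ bclosure (tensorRel 𝕜 M N)))

noncomputable instance : Module 𝕜 (CTensor 𝕜 M N) :=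
  inferInstanceAs (Module 𝕜 (PreTensor 𝕜 M N ⧸ bclosure (tensorRel 𝕜 M N)))

noncomputable instance : Bornology (CTensor 𝕜 M N) :=
  quotBornology (bclosure (tensorRel 𝕜 M N))

instance : CompleteBVS 𝕜 (CTensor 𝕜 M N) := completeBVS_quot (bclosed_bclosure _)

variable {𝕜 M N}

/-- The quotient map onto the completed tensor product. -/
noncomputable def CTensor.mk : PreTensor 𝕜 M N →ₗ[𝕜] CTensor 𝕜 M N :=
  (bclosure (tensorRel 𝕜 M N)).mkQ

theorem CTensor.mk_surjective : Function.Surjective (CTensor.mk (𝕜 := 𝕜) (M := M) (N := N)) :=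
  Submodule.mkQ_surjective _

theorem CTensor.isBounded_iff {B : Set (CTensor 𝕜 M N)} : Bornology.IsBounded B ↔
    ∃ (S : Set M) (T : Set N) (r : ℝ), Bornology.IsBounded S ∧ Bornology.IsBounded T ∧
      B ⊆ CTensor.mk '' preDisc S T r := by
  refine isBounded_quot_iff.trans ⟨?_, ?_⟩
  · rintro ⟨C, hC, h⟩
    obtain ⟨S, T, r, hS, hT, hC⟩ := isBounded_pre_iff.1 hC
    exact ⟨S, T, r, hS, hT, h.trans (Set.image_mono hC)⟩
  · rintro ⟨S, T, r, hS, hT, h⟩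
    exact ⟨_, isBounded_pre_iff.2 ⟨S, T, r, hS, hT, subset_rfl⟩, h⟩

theorem CTensor.mk_isBdd : IsBdd (CTensor.mk (𝕜 := 𝕜) (M := M) (N := N)) :=
  fun S hS => isBounded_quot_iff.2 ⟨S, hS, subset_rfl⟩

theorem CTensor.mk_eq_of_rel {x y : PreTensor 𝕜 M N} (h : x - y ∈ tensorRel 𝕜 M N) :
    CTensor.mk x = CTensor.mk y :=
  (Submodule.Quotient.eq _).2 (le_bclosure _ h)

/-- The canonical bilinear map `(m, n) ↦ m ⊗ n`. -/
noncomputable def CTensor.tmul : M →ₗ[𝕜] N →ₗ[𝕜] CTensor 𝕜 M N :=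
  LinearMap.mk₂ 𝕜 (fun m n => CTensor.mk (PreTensor.delta m n))
    (fun m m' n => by
      rw [← map_add]
      refine mk_eq_of_rel (Submodule.subset_span (Or.inl (Or.inl (Or.inl ⟨m, m', n, ?_⟩))))
      abel)
    (fun k m n => by
      rw [← map_smul]
      exact mk_eq_of_rel (Submodule.subset_span (Or.inl (Or.inr ⟨k, m, n, rfl⟩))))
    (fun m n n' => by
      rw [← map_add]
      refine mk_eq_of_rel (Submodule.subset_span (Or.inl (Or.inl (Or.inr ⟨m, n, n', ?_⟩))))
      abel)
    (fun k m n => by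
      rw [← map_smul]
      exact mk_eq_of_rel (Submodule.subset_span (Or.inr ⟨k, m, n, rfl⟩)))

theorem CTensor.mk_delta (m : M) (n : N) :
    CTensor.mk (PreTensor.delta m n) = CTensor.tmul (𝕜 := 𝕜) m n := rfl

theorem CTensor.tmul_isBddBilin : IsBddBilin (CTensor.tmul (𝕜 := 𝕜) (M := M) (N := N)) := by
  classical
  intro S T hS hT
  refine CTensor.isBounded_iff.2 ⟨S, T, 1, hS, hT, ?_⟩
  rintro _ ⟨m, hm, n, hn, rfl⟩
  refine ⟨PreTensor.delta m n, ⟨?_, fun p hp => ?_⟩, rfl⟩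
  · rw [PreTensor.val_delta]
    exact (lp.norm_single (E := fun _ : M × N => 𝕜) (p := 1) (by simp) (m, n) (1 : 𝕜)).trans_le
      (by simp)
  · have : p = (m, n) := by
      by_contra h
      refine hp ?_
      rw [PreTensor.val_delta, lp.single_apply_ne _ _ _ h]
    subst this
    exact ⟨hm, hn⟩

variable {Z : Type*} [AddCommGroup Z] [Module 𝕜 Z] [Bornology Z] [CompleteBVS 𝕜 Z]

/-- The bounded linear map on the completed tensor product induced by a bounded bilinear map. -/
noncomputable def CTensor.lift (f : M →ₗ[𝕜] N →ₗ[𝕜] Z) (hf : IsBddBilin f) :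
    CTensor 𝕜 M N →ₗ[𝕜] Z :=
  (bclosure (tensorRel 𝕜 M N)).liftQ (PreTensor.lift f hf) (by
    refine bclosure_le ?_ (PreTensor.lift_isBdd f hf).bclosed_ker
    refine Submodule.span_le.2 ?_
    rintro c (((⟨m, m', n, rfl⟩ | ⟨m, n, n', rfl⟩) | ⟨k, m, n, rfl⟩) | ⟨k, m, n, rfl⟩) <;>
    simp [PreTensor.lift_delta])

theorem CTensor.lift_mk (f : M →ₗ[𝕜] N →ₗ[𝕜] Z) (hf : IsBddBilin f) (c : PreTensor 𝕜 M N) :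
    CTensor.lift f hf (CTensor.mk c) = PreTensor.lift f hf c := rfl

theorem CTensor.lift_tmul (f : M →ₗ[𝕜] N →ₗ[𝕜] Z) (hf : IsBddBilin f) (m : M) (n : N) :
    CTensor.lift f hf (CTensor.tmul m n) = f m n :=
  PreTensor.lift_delta f hf m n

theorem CTensor.lift_isBdd (f : M →ₗ[𝕜] N →ₗ[𝕜] Z) (hf : IsBddBilin f) :
    IsBdd (CTensor.lift f hf) := by
  intro B hB
  obtain ⟨C, hC, h⟩ := isBounded_quot_iff.1 hB
  refine (PreTensor.lift_isBdd f hf C hC).subset ?_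
  rintro _ ⟨b, hb, rfl⟩
  obtain ⟨c, hc, rfl⟩ := h hb
  exact ⟨c, hc, rfl⟩

/-- Bounded linear maps on the completed tensor product are determined on elementary tensors. -/
theorem CTensor.ext {g h : CTensor 𝕜 M N →ₗ[𝕜] Z} (hg : IsBdd g) (hh : IsBdd h)
    (H : ∀ m n, g (CTensor.tmul m n) = h (CTensor.tmul m n)) : g = h := by
  have hb : IsBdd ((g - h) ∘ₗ CTensor.mk) := by
    intro S hS
    have hS' := CTensor.mk_isBdd S hS
    refine (CompleteBVS.isBounded_add 𝕜 _ _ (hg _ hS')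
      (CompleteBVS.isBounded_smul (-1 : 𝕜) _ (hh _ hS'))).subset ?_
    rintro _ ⟨c, hc, rfl⟩
    refine ⟨_, ⟨_, ⟨c, hc, rfl⟩, rfl⟩, _, ⟨_, ⟨_, ⟨c, hc, rfl⟩, rfl⟩, rfl⟩, ?_⟩
    simp [sub_eq_add_neg]
  have htop := PreTensor.eq_top hb.bclosed_ker fun m n => by
    simp only [LinearMap.mem_ker, LinearMap.comp_apply, CTensor.mk_delta, LinearMap.sub_apply,
      H, sub_self]
  refine LinearMap.ext fun t => ?_
  obtain ⟨c, rfl⟩ := CTensor.mk_surjective t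
  have : c ∈ LinearMap.ker ((g - h) ∘ₗ CTensor.mk) := htop ▸ Submodule.mem_top
  simpa [sub_eq_zero] using this

end CTensor

/-! ### Bornological algebras and modules -/

/-- A complete bornological algebra, not necessarily unital. -/
class BornAlgebra (𝕜 : Type*) [RCLike 𝕜] (A : Type*) [NonUnitalRing A] [Module 𝕜 A]
    [Bornology A] : Prop extends CompleteBVS 𝕜 A, IsScalarTower 𝕜 A A, SMulCommClass 𝕜 A A where
  isBounded_mul : ∀ S T : Set A, Bornology.IsBounded S → Bornology.IsBounded T →
    Bornology.IsBounded (S * T)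

/-- A bornological right module: a bounded action of `A` (equivalently, a bounded unital action of
`A⁺`). If `A` has a unit, then `A⁺ = A`, so that the unit of `A` has to act as the identity. -/
class BornRightModule (𝕜 : Type*) [RCLike 𝕜] (A : Type*) [NonUnitalRing A] [Module 𝕜 A]
    [Bornology A] (M : Type*) [AddCommGroup M] [Module 𝕜 M] [Bornology M] where
  act : M →ₗ[𝕜] A →ₗ[𝕜] M
  act_mul : ∀ m a b, act m (a * b) = act (act m a) b
  act_unit : ∀ e : A, (∀ a, e * a = a ∧ a * e = a) → ∀ m, act m e = m
  act_isBdd : IsBddBilin act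

/-- A bornological left module. -/
class BornLeftModule (𝕜 : Type*) [RCLike 𝕜] (A : Type*) [NonUnitalRing A] [Module 𝕜 A]
    [Bornology A] (M : Type*) [AddCommGroup M] [Module 𝕜 M] [Bornology M] where
  act : A →ₗ[𝕜] M →ₗ[𝕜] M
  mul_act : ∀ a b m, act (a * b) m = act a (act b m)
  act_unit : ∀ e : A, (∀ a, e * a = a ∧ a * e = a) → ∀ m, act e m = m
  act_isBdd : IsBddBilin act

section Actions

variable (𝕜 : Type*) [RCLike 𝕜] (A : Type*) [NonUnitalRing A] [Module 𝕜 A] [Bornology A]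
  (B : Type*) [NonUnitalRing B] [Module 𝕜 B] [Bornology B]
  (M : Type*) [AddCommGroup M] [Module 𝕜 M] [Bornology M]

/-- The right action: `ract 𝕜 A M m a` is `m · a`. -/
def ract [BornRightModule 𝕜 A M] : M →ₗ[𝕜] A →ₗ[𝕜] M := BornRightModule.act

/-- The left action: `lact 𝕜 A M a m` is `a · m`. -/
def lact [BornLeftModule 𝕜 A M] : A →ₗ[𝕜] M →ₗ[𝕜] M := BornLeftModule.act

variable {A M} in
theorem ract_mul [BornRightModule 𝕜 A M] (m : M) (a b : A) :
    ract 𝕜 A M m (a * b) = ract 𝕜 A M (ract 𝕜 A M m a) b := BornRightModule.act_mul m a b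

variable {A M} in
theorem mul_lact [BornLeftModule 𝕜 A M] (a b : A) (m : M) :
    lact 𝕜 A M (a * b) m = lact 𝕜 A M a (lact 𝕜 A M b m) := BornLeftModule.mul_act a b m

theorem ract_isBddBilin [BornRightModule 𝕜 A M] : IsBddBilin (ract 𝕜 A M) :=
  BornRightModule.act_isBdd

theorem lact_isBddBilin [BornLeftModule 𝕜 A M] : IsBddBilin (lact 𝕜 A M) :=
  BornLeftModule.act_isBdd

/-- An `A`-`B`-bimodule: the two actions commute. -/
class IsBimodule [BornLeftModule 𝕜 A M] [BornRightModule 𝕜 B M] : Prop where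
  assoc : ∀ (a : A) (m : M) (b : B),
    ract 𝕜 B M (lact 𝕜 A M a m) b = lact 𝕜 A M a (ract 𝕜 B M m b)

theorem mul_isBddBilin [BornAlgebra 𝕜 A] : IsBddBilin (LinearMap.mul 𝕜 A) := fun S T hS hT =>
  (BornAlgebra.isBounded_mul (𝕜 := 𝕜) S T hS hT).subset (by
    rintro _ ⟨a, ha, b, hb, rfl⟩; exact ⟨a, ha, b, hb, rfl⟩)

instance [BornAlgebra 𝕜 A] : BornRightModule 𝕜 A A where
  act := LinearMap.mul 𝕜 A
  act_mul _ _ _ := (mul_assoc _ _ _).symm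
  act_unit _ he _ := (he _).2
  act_isBdd := mul_isBddBilin 𝕜 A

instance [BornAlgebra 𝕜 A] : BornLeftModule 𝕜 A A where
  act := LinearMap.mul 𝕜 A
  mul_act _ _ _ := mul_assoc _ _ _
  act_unit _ he _ := (he _).1
  act_isBdd := mul_isBddBilin 𝕜 A

theorem ract_self [BornAlgebra 𝕜 A] (a b : A) : ract 𝕜 A A a b = a * b := rfl

theorem lact_self [BornAlgebra 𝕜 A] (a b : A) : lact 𝕜 A A a b = a * b := rfl

theorem ract_balanced [BornAlgebra 𝕜 A] [BornRightModule 𝕜 A M] (m : M) (a b : A) :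
    ract 𝕜 A M (ract 𝕜 A M m a) b = ract 𝕜 A M m (lact 𝕜 A A a b) := by
  rw [lact_self, ract_mul]

theorem lact_balanced [BornAlgebra 𝕜 A] [BornLeftModule 𝕜 A M] (a b : A) (m : M) :
    lact 𝕜 A M (ract 𝕜 A A a b) m = lact 𝕜 A M a (lact 𝕜 A M b m) := by
  rw [ract_self, mul_lact]

end Actions

/-! ### The balanced tensor product -/

section BTensor

variable (𝕜 : Type*) [RCLike 𝕜] (A : Type*) [NonUnitalRing A] [Module 𝕜 A] [Bornology A]
  (M N : Type*) [AddCommGroup M] [Module 𝕜 M] [Bornology M] [BornRightModule 𝕜 A M]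
  [AddCommGroup N] [Module 𝕜 N] [Bornology N] [BornLeftModule 𝕜 A N]

/-- The span of the elements `m a ⊗ n - m ⊗ a n`. -/
noncomputable def balRel : Submodule 𝕜 (CTensor 𝕜 M N) :=
  Submodule.span 𝕜 {t | ∃ (m : M) (a : A) (n : N),
    t = CTensor.tmul (ract 𝕜 A M m a) n - CTensor.tmul m (lact 𝕜 A N a n)}

/-- The completed `A`-balanced tensor product of a right module `M` and a left module `N`: the
cokernel, in complete spaces, of `m ⊗ a ⊗ n ↦ m a ⊗ n - m ⊗ a n`. -/
def BTensor : Type _ := CTensor 𝕜 M N ⧸ bclosure (balRel 𝕜 A M N)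

noncomputable instance : AddCommGroup (BTensor 𝕜 A M N) :=
  inferInstanceAs (AddCommGroup (CTensor 𝕜 M N ⧸ bclosure (balRel 𝕜 A M N)))

noncomputable instance : Module 𝕜 (BTensor 𝕜 A M N) :=
  inferInstanceAs (Module 𝕜 (CTensor 𝕜 M N ⧸ bclosure (balRel 𝕜 A M N)))

noncomputable instance : Bornology (BTensor 𝕜 A M N) :=
  quotBornology (bclosure (balRel 𝕜 A M N))

instance : CompleteBVS 𝕜 (BTensor 𝕜 A M N) := completeBVS_quot (bclosed_bclosure _)

/-- The quotient map onto the balanced tensor product. -/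
noncomputable def BTensor.mk : CTensor 𝕜 M N →ₗ[𝕜] BTensor 𝕜 A M N :=
  (bclosure (balRel 𝕜 A M N)).mkQ

/-- The canonical bilinear map `(m, n) ↦ m ⊗ n`. -/
noncomputable def BTensor.tmul : M →ₗ[𝕜] N →ₗ[𝕜] BTensor 𝕜 A M N :=
  CTensor.tmul.compr₂ (BTensor.mk 𝕜 A M N)

variable {M N}

theorem BTensor.mk_isBdd : IsBdd (BTensor.mk 𝕜 A M N) :=
  fun S hS => isBounded_quot_iff.2 ⟨S, hS, subset_rfl⟩

theorem BTensor.tmul_balanced (m : M) (a : A) (n : N) :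
    BTensor.tmul 𝕜 A M N (ract 𝕜 A M m a) n = BTensor.tmul 𝕜 A M N m (lact 𝕜 A N a n) :=
  (Submodule.Quotient.eq _).2 (le_bclosure _ (Submodule.subset_span ⟨m, a, n, rfl⟩))

theorem BTensor.tmul_isBddBilin : IsBddBilin (BTensor.tmul 𝕜 A M N) := by
  intro S T hS hT
  refine (BTensor.mk_isBdd 𝕜 A _ (CTensor.tmul_isBddBilin (𝕜 := 𝕜) S T hS hT)).subset ?_
  rintro _ ⟨m, hm, n, hn, rfl⟩
  exact ⟨_, ⟨m, hm, n, hn, rfl⟩, rfl⟩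

variable {Z : Type*} [AddCommGroup Z] [Module 𝕜 Z] [Bornology Z] [CompleteBVS 𝕜 Z]

/-- The bounded linear map on the balanced tensor product induced by a bounded balanced bilinear
map. -/
noncomputable def BTensor.lift (f : M →ₗ[𝕜] N →ₗ[𝕜] Z) (hf : IsBddBilin f)
    (hbal : ∀ m a n, f (ract 𝕜 A M m a) n = f m (lact 𝕜 A N a n)) : BTensor 𝕜 A M N →ₗ[𝕜] Z :=
  (bclosure (balRel 𝕜 A M N)).liftQ (CTensor.lift f hf) (by
    refine bclosure_le ?_ (CTensor.lift_isBdd f hf).bclosed_ker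
    refine Submodule.span_le.2 ?_
    rintro _ ⟨m, a, n, rfl⟩
    simp [CTensor.lift_tmul, hbal])

theorem BTensor.lift_tmul (f : M →ₗ[𝕜] N →ₗ[𝕜] Z) (hf : IsBddBilin f)
    (hbal : ∀ m a n, f (ract 𝕜 A M m a) n = f m (lact 𝕜 A N a n)) (m : M) (n : N) :
    BTensor.lift 𝕜 A f hf hbal (BTensor.tmul 𝕜 A M N m n) = f m n :=
  CTensor.lift_tmul f hf m n

/-- A family of balanced bilinear maps that is equibounded induces an equibounded family. -/
theorem BTensor.lift_equibdd {ι : Type*} (f : ι → M →ₗ[𝕜] N →ₗ[𝕜] Z)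
    (hf : ∀ i, IsBddBilin (f i))
    (hbal : ∀ i m a n, f i (ract 𝕜 A M m a) n = f i m (lact 𝕜 A N a n)) (U : Set ι)
    (hU : ∀ (S : Set M) (T : Set N), Bornology.IsBounded S → Bornology.IsBounded T →
      Bornology.IsBounded {z | ∃ i ∈ U, ∃ m ∈ S, ∃ n ∈ T, f i m n = z})
    (C : Set (BTensor 𝕜 A M N)) (hC : Bornology.IsBounded C) :
    Bornology.IsBounded {z | ∃ i ∈ U, ∃ t ∈ C, BTensor.lift 𝕜 A (f i) (hf i) (hbal i) t = z} := by
  obtain ⟨C', hC', h⟩ := isBounded_quot_iff.1 hC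
  obtain ⟨S, T, r, hS, hT, h'⟩ := CTensor.isBounded_iff.1 hC'
  obtain ⟨D, hSD, hDb, hD⟩ := CompleteBVS.exists_completant (𝕜 := 𝕜) _ (hU S T hS hT)
  refine (CompleteBVS.isBounded_smul ((r + 1 : ℝ) : 𝕜) D hDb).subset ?_
  rintro _ ⟨i, hi, t, ht, rfl⟩
  obtain ⟨s, hs, rfl⟩ := h ht
  obtain ⟨c, hc, rfl⟩ := h' hs
  exact PreTensor.lift_mem (f i) (hf i) hDb hD (by
    rintro _ ⟨m, hm, n, hn, rfl⟩; exact hSD ⟨i, hi, m, hm, n, hn, rfl⟩) hc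

theorem BTensor.lift_isBdd (f : M →ₗ[𝕜] N →ₗ[𝕜] Z) (hf : IsBddBilin f)
    (hbal : ∀ m a n, f (ract 𝕜 A M m a) n = f m (lact 𝕜 A N a n)) :
    IsBdd (BTensor.lift 𝕜 A f hf hbal) := by
  intro C hC
  refine (BTensor.lift_equibdd 𝕜 A (fun _ : Unit => f) (fun _ => hf) (fun _ => hbal) Set.univ
    (fun S T hS hT => (hf S T hS hT).subset ?_) C hC).subset ?_
  · rintro _ ⟨_, _, m, hm, n, hn, rfl⟩; exact ⟨m, hm, n, hn, rfl⟩
  · rintro _ ⟨t, ht, rfl⟩; exact ⟨(), trivial, t, ht, rfl⟩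

/-- Bounded linear maps on the balanced tensor product are determined on elementary tensors. -/
theorem BTensor.ext {g h : BTensor 𝕜 A M N →ₗ[𝕜] Z} (hg : IsBdd g) (hh : IsBdd h)
    (H : ∀ m n, g (BTensor.tmul 𝕜 A M N m n) = h (BTensor.tmul 𝕜 A M N m n)) : g = h := by
  have key : g ∘ₗ BTensor.mk 𝕜 A M N = h ∘ₗ BTensor.mk 𝕜 A M N :=
    CTensor.ext
      (fun S hS => by
        rw [LinearMap.coe_comp, Set.image_comp]; exact hg _ (BTensor.mk_isBdd 𝕜 A S hS))
      (fun S hS => by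
        rw [LinearMap.coe_comp, Set.image_comp]; exact hh _ (BTensor.mk_isBdd 𝕜 A S hS)) H
  refine LinearMap.ext fun t => ?_
  obtain ⟨c, rfl⟩ := (bclosure (balRel 𝕜 A M N)).mkQ_surjective t
  exact LinearMap.congr_fun key c

end BTensor

section TensorActions

variable {𝕜 : Type*} [RCLike 𝕜]
  {A : Type*} [NonUnitalRing A] [Module 𝕜 A] [Bornology A]
  {B : Type*} [NonUnitalRing B] [Module 𝕜 B] [Bornology B]
  {M : Type*} [AddCommGroup M] [Module 𝕜 M] [Bornology M] [BornRightModule 𝕜 A M]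
  {X : Type*} [AddCommGroup X] [Module 𝕜 X] [Bornology X] [BornLeftModule 𝕜 A X]

theorem isBdd_id : IsBdd (LinearMap.id : M →ₗ[𝕜] M) := fun S hS => by simpa using hS

theorem IsBdd.comp {V W Z : Type*} [AddCommGroup V] [Module 𝕜 V] [Bornology V]
    [AddCommGroup W] [Module 𝕜 W] [Bornology W] [AddCommGroup Z] [Module 𝕜 Z] [Bornology Z]
    {g : W →ₗ[𝕜] Z} {f : V →ₗ[𝕜] W} (hg : IsBdd g) (hf : IsBdd f) : IsBdd (g ∘ₗ f) :=
  fun S hS => by rw [LinearMap.coe_comp, Set.image_comp]; exact hg _ (hf S hS)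

theorem IsBddBilin.right {V W Z : Type*} [AddCommGroup V] [Module 𝕜 V] [Bornology V]
    [AddCommGroup W] [Module 𝕜 W] [Bornology W] [AddCommGroup Z] [Module 𝕜 Z] [Bornology Z]
    {f : V →ₗ[𝕜] W →ₗ[𝕜] Z} (hf : IsBddBilin f) (v : V) : IsBdd (f v) := fun S hS => by
  simpa using hf {v} S Bornology.isBounded_singleton hS

theorem IsBddBilin.left {V W Z : Type*} [AddCommGroup V] [Module 𝕜 V] [Bornology V]
    [AddCommGroup W] [Module 𝕜 W] [Bornology W] [AddCommGroup Z] [Module 𝕜 Z] [Bornology Z]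
    {f : V →ₗ[𝕜] W →ₗ[𝕜] Z} (hf : IsBddBilin f) (w : W) : IsBdd (f.flip w) := fun S hS =>
  (hf S {w} hS Bornology.isBounded_singleton).subset (by
    rintro _ ⟨v, hv, rfl⟩; exact ⟨v, hv, w, rfl, rfl⟩)

theorem IsBdd.add {V W : Type*} [AddCommGroup V] [Module 𝕜 V] [Bornology V]
    [AddCommGroup W] [Module 𝕜 W] [Bornology W] [CompleteBVS 𝕜 W]
    {f g : V →ₗ[𝕜] W} (hf : IsBdd f) (hg : IsBdd g) : IsBdd (f + g) := fun S hS =>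
  (CompleteBVS.isBounded_add 𝕜 _ _ (hf S hS) (hg S hS)).subset (by
    rintro _ ⟨c, hc, rfl⟩; exact ⟨_, ⟨c, hc, rfl⟩, _, ⟨c, hc, rfl⟩, rfl⟩)

theorem IsBdd.smul {V W : Type*} [AddCommGroup V] [Module 𝕜 V] [Bornology V]
    [AddCommGroup W] [Module 𝕜 W] [Bornology W] [CompleteBVS 𝕜 W]
    {f : V →ₗ[𝕜] W} (k : 𝕜) (hf : IsBdd f) : IsBdd (k • f) := fun S hS =>
  (CompleteBVS.isBounded_smul k _ (hf S hS)).subset (by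
    rintro _ ⟨c, hc, rfl⟩; exact ⟨_, ⟨c, hc, rfl⟩, rfl⟩)

theorem BTensor.compl₂_isBddBilin {g : X →ₗ[𝕜] X} (hg : IsBdd g) :
    IsBddBilin ((BTensor.tmul 𝕜 A M X).compl₂ g) := fun S T hS hT =>
  (BTensor.tmul_isBddBilin 𝕜 A S _ hS (hg T hT)).subset (by
    rintro _ ⟨m, hm, x, hx, rfl⟩; exact ⟨m, hm, _, ⟨x, hx, rfl⟩, rfl⟩)

theorem BTensor.comp_isBddBilin {g : M →ₗ[𝕜] M} (hg : IsBdd g) :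
    IsBddBilin ((BTensor.tmul 𝕜 A M X).comp g) := fun S T hS hT =>
  (BTensor.tmul_isBddBilin 𝕜 A _ T (hg S hS) hT).subset (by
    rintro _ ⟨m, hm, x, hx, rfl⟩; exact ⟨_, ⟨m, hm, rfl⟩, x, hx, rfl⟩)

/-- The endomorphism `id ⊗ g` of `M ⊗_A X`, for a bounded `A`-linear endomorphism `g` of `X`. -/
noncomputable def BTensor.mapRight (g : X →ₗ[𝕜] X) (hg : IsBdd g)
    (hA : ∀ a x, g (lact 𝕜 A X a x) = lact 𝕜 A X a (g x)) :
    BTensor 𝕜 A M X →ₗ[𝕜] BTensor 𝕜 A M X :=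
  BTensor.lift 𝕜 A ((BTensor.tmul 𝕜 A M X).compl₂ g)
    (BTensor.compl₂_isBddBilin hg)
    (fun m a x => by simp only [LinearMap.compl₂_apply, BTensor.tmul_balanced, hA])

/-- The endomorphism `g ⊗ id` of `M ⊗_A X`, for a bounded `A`-linear endomorphism `g` of `M`. -/
noncomputable def BTensor.mapLeft (g : M →ₗ[𝕜] M) (hg : IsBdd g)
    (hA : ∀ m a, g (ract 𝕜 A M m a) = ract 𝕜 A M (g m) a) :
    BTensor 𝕜 A M X →ₗ[𝕜] BTensor 𝕜 A M X :=
  BTensor.lift 𝕜 A ((BTensor.tmul 𝕜 A M X).comp g)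
    (BTensor.comp_isBddBilin hg)
    (fun m a x => by simp only [LinearMap.comp_apply, hA, BTensor.tmul_balanced])

theorem BTensor.mapRight_tmul (g : X →ₗ[𝕜] X) (hg : IsBdd g)
    (hA : ∀ a x, g (lact 𝕜 A X a x) = lact 𝕜 A X a (g x)) (m : M) (x : X) :
    BTensor.mapRight g hg hA (BTensor.tmul 𝕜 A M X m x) = BTensor.tmul 𝕜 A M X m (g x) :=
  BTensor.lift_tmul 𝕜 A _ _ _ m x

theorem BTensor.mapLeft_tmul (g : M →ₗ[𝕜] M) (hg : IsBdd g)
    (hA : ∀ m a, g (ract 𝕜 A M m a) = ract 𝕜 A M (g m) a) (m : M) (x : X) :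
    BTensor.mapLeft g hg hA (BTensor.tmul 𝕜 A M X m x) = BTensor.tmul 𝕜 A M X (g m) x :=
  BTensor.lift_tmul 𝕜 A _ _ _ m x

theorem BTensor.mapRight_isBdd (g : X →ₗ[𝕜] X) (hg : IsBdd g)
    (hA : ∀ a x, g (lact 𝕜 A X a x) = lact 𝕜 A X a (g x)) :
    IsBdd (BTensor.mapRight (M := M) g hg hA) :=
  BTensor.lift_isBdd 𝕜 A _ _ _

theorem BTensor.mapLeft_isBdd (g : M →ₗ[𝕜] M) (hg : IsBdd g)
    (hA : ∀ m a, g (ract 𝕜 A M m a) = ract 𝕜 A M (g m) a) :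
    IsBdd (BTensor.mapLeft (X := X) g hg hA) :=
  BTensor.lift_isBdd 𝕜 A _ _ _

/-- The endomorphism `m ⊗ x ↦ m ⊗ x b` of `M ⊗_A X`, for an `A`-`B`-bimodule `X`. -/
noncomputable def BTensor.rightMul [BornRightModule 𝕜 B X] [IsBimodule 𝕜 A B X] (b : B) :
    BTensor 𝕜 A M X →ₗ[𝕜] BTensor 𝕜 A M X :=
  BTensor.mapRight ((ract 𝕜 B X).flip b) ((ract_isBddBilin 𝕜 B X).left b)
    (fun a x => IsBimodule.assoc a x b)

theorem BTensor.rightMul_tmul [BornRightModule 𝕜 B X] [IsBimodule 𝕜 A B X]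
    (b : B) (m : M) (x : X) : BTensor.rightMul b (BTensor.tmul 𝕜 A M X m x)
      = BTensor.tmul 𝕜 A M X m (ract 𝕜 B X x b) :=
  BTensor.mapRight_tmul ((ract 𝕜 B X).flip b) ((ract_isBddBilin 𝕜 B X).left b)
    (fun a x => IsBimodule.assoc a x b) m x

theorem BTensor.rightMul_isBdd [BornRightModule 𝕜 B X] [IsBimodule 𝕜 A B X] (b : B) :
    IsBdd (BTensor.rightMul (𝕜 := 𝕜) (A := A) (M := M) (X := X) b) :=
  BTensor.mapRight_isBdd ((ract 𝕜 B X).flip b) ((ract_isBddBilin 𝕜 B X).left b)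
    (fun a x => IsBimodule.assoc a x b)

/-- The endomorphism `m ⊗ x ↦ b m ⊗ x` of `M ⊗_A X`, for a `B`-`A`-bimodule `M`. -/
noncomputable def BTensor.leftMul [BornLeftModule 𝕜 B M] [IsBimodule 𝕜 B A M] (b : B) :
    BTensor 𝕜 A M X →ₗ[𝕜] BTensor 𝕜 A M X :=
  BTensor.mapLeft (lact 𝕜 B M b) ((lact_isBddBilin 𝕜 B M).right b)
    (fun m a => (IsBimodule.assoc b m a).symm)

theorem BTensor.leftMul_tmul [BornLeftModule 𝕜 B M] [IsBimodule 𝕜 B A M]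
    (b : B) (m : M) (x : X) : BTensor.leftMul b (BTensor.tmul 𝕜 A M X m x)
      = BTensor.tmul 𝕜 A M X (lact 𝕜 B M b m) x :=
  BTensor.mapLeft_tmul (lact 𝕜 B M b) ((lact_isBddBilin 𝕜 B M).right b)
    (fun m a => (IsBimodule.assoc b m a).symm) m x

theorem BTensor.leftMul_isBdd [BornLeftModule 𝕜 B M] [IsBimodule 𝕜 B A M] (b : B) :
    IsBdd (BTensor.leftMul (𝕜 := 𝕜) (A := A) (M := M) (X := X) b) :=
  BTensor.mapLeft_isBdd (lact 𝕜 B M b) ((lact_isBddBilin 𝕜 B M).right b)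
    (fun m a => (IsBimodule.assoc b m a).symm)

/-- The right `B`-action on `M ⊗_A X`, for an `A`-`B`-bimodule `X`: `(m ⊗ x) b = m ⊗ x b`. -/
noncomputable def BTensor.rightAct [BornRightModule 𝕜 B X] [IsBimodule 𝕜 A B X] :
    BTensor 𝕜 A M X →ₗ[𝕜] B →ₗ[𝕜] BTensor 𝕜 A M X :=
  LinearMap.flip
    { toFun := BTensor.rightMul
      map_add' := fun b b' => BTensor.ext 𝕜 A (BTensor.rightMul_isBdd _)
        ((BTensor.rightMul_isBdd _).add (BTensor.rightMul_isBdd _)) fun m x => by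
          simp only [LinearMap.add_apply, BTensor.rightMul_tmul, map_add]
      map_smul' := fun k b => BTensor.ext 𝕜 A (BTensor.rightMul_isBdd _)
        ((BTensor.rightMul_isBdd _).smul k) fun m x => by
          simp only [LinearMap.smul_apply, BTensor.rightMul_tmul, map_smul, RingHom.id_apply] }

/-- The left `B`-action on `M ⊗_A X`, for a `B`-`A`-bimodule `M`: `b (m ⊗ x) = b m ⊗ x`. -/
noncomputable def BTensor.leftAct [BornLeftModule 𝕜 B M] [IsBimodule 𝕜 B A M] :
    B →ₗ[𝕜] BTensor 𝕜 A M X →ₗ[𝕜] BTensor 𝕜 A M X where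
  toFun := BTensor.leftMul
  map_add' b b' := BTensor.ext 𝕜 A (BTensor.leftMul_isBdd _)
    ((BTensor.leftMul_isBdd _).add (BTensor.leftMul_isBdd _)) fun m x => by
      simp only [LinearMap.add_apply, BTensor.leftMul_tmul, map_add]
  map_smul' k b := BTensor.ext 𝕜 A (BTensor.leftMul_isBdd _)
    ((BTensor.leftMul_isBdd _).smul k) fun m x => by
      simp only [LinearMap.smul_apply, BTensor.leftMul_tmul, map_smul, RingHom.id_apply]

noncomputable instance [BornRightModule 𝕜 B X] [IsBimodule 𝕜 A B X] :
    BornRightModule 𝕜 B (BTensor 𝕜 A M X) where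
  act := BTensor.rightAct
  act_mul t b b' := by
    have : BTensor.rightMul (b * b') = (BTensor.rightMul (𝕜 := 𝕜) (A := A) (M := M)
        (X := X)) b' ∘ₗ BTensor.rightMul b :=
      BTensor.ext 𝕜 A (BTensor.rightMul_isBdd _)
        ((BTensor.rightMul_isBdd _).comp (BTensor.rightMul_isBdd _)) fun m x => by
          simp only [LinearMap.comp_apply, BTensor.rightMul_tmul]
          congr 1
          exact BornRightModule.act_mul x b b'
    exact LinearMap.congr_fun this t
  act_unit e he t := by
    have : BTensor.rightMul e = (LinearMap.id : BTensor 𝕜 A M X →ₗ[𝕜] _) :=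
      BTensor.ext 𝕜 A (BTensor.rightMul_isBdd _) isBdd_id fun m x => by
        simp only [LinearMap.id_apply, BTensor.rightMul_tmul]
        congr 1
        exact BornRightModule.act_unit e he x
    exact LinearMap.congr_fun this t
  act_isBdd C U hC hU := by
    refine (BTensor.lift_equibdd 𝕜 A
      (fun b : B => (BTensor.tmul 𝕜 A M X).compl₂ ((ract 𝕜 B X).flip b))
      (fun b => BTensor.compl₂_isBddBilin ((ract_isBddBilin 𝕜 B X).left b))
      (fun b m a x => by
        simp only [LinearMap.compl₂_apply, BTensor.tmul_balanced, LinearMap.flip_apply,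
          IsBimodule.assoc]) U
      (fun S V hS hV => ?_) C hC).subset ?_
    · refine (BTensor.tmul_isBddBilin 𝕜 A S _ hS
        (ract_isBddBilin 𝕜 B X V U hV hU)).subset ?_
      rintro _ ⟨b, hb, m, hm, x, hx, rfl⟩
      exact ⟨m, hm, _, ⟨x, hx, b, hb, rfl⟩, rfl⟩
    · rintro _ ⟨t, ht, b, hb, rfl⟩
      exact ⟨b, hb, t, ht, rfl⟩

noncomputable instance [BornLeftModule 𝕜 B M] [IsBimodule 𝕜 B A M] :
    BornLeftModule 𝕜 B (BTensor 𝕜 A M X) where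
  act := BTensor.leftAct
  mul_act b b' t := by
    have : BTensor.leftMul (b * b') = (BTensor.leftMul (𝕜 := 𝕜) (A := A) (M := M)
        (X := X)) b ∘ₗ BTensor.leftMul b' :=
      BTensor.ext 𝕜 A (BTensor.leftMul_isBdd _)
        ((BTensor.leftMul_isBdd _).comp (BTensor.leftMul_isBdd _)) fun m x => by
          simp only [LinearMap.comp_apply, BTensor.leftMul_tmul]
          congr 2
          exact BornLeftModule.mul_act b b' m
    exact LinearMap.congr_fun this t
  act_unit e he t := by
    have : BTensor.leftMul e = (LinearMap.id : BTensor 𝕜 A M X →ₗ[𝕜] _) :=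
      BTensor.ext 𝕜 A (BTensor.leftMul_isBdd _) isBdd_id fun m x => by
        simp only [LinearMap.id_apply, BTensor.leftMul_tmul]
        congr 2
        exact BornLeftModule.act_unit e he m
    exact LinearMap.congr_fun this t
  act_isBdd U C hU hC := by
    refine (BTensor.lift_equibdd 𝕜 A
      (fun b : B => (BTensor.tmul 𝕜 A M X).comp (lact 𝕜 B M b))
      (fun b => BTensor.comp_isBddBilin ((lact_isBddBilin 𝕜 B M).right b))
      (fun b m a x => by
        simp only [LinearMap.comp_apply, ← IsBimodule.assoc, BTensor.tmul_balanced]) U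
      (fun S V hS hV => ?_) C hC).subset ?_
    · refine (BTensor.tmul_isBddBilin 𝕜 A _ V
        (lact_isBddBilin 𝕜 B M U S hU hS) hV).subset ?_
      rintro _ ⟨b, hb, m, hm, x, hx, rfl⟩
      exact ⟨_, ⟨b, hb, m, hm, rfl⟩, x, hx, rfl⟩
    · rintro _ ⟨b, hb, t, ht, rfl⟩
      exact ⟨b, hb, t, ht, rfl⟩

end TensorActions


/-! ### Quasi-unital and multiplicatively convex algebras -/

section Plus

variable (𝕜 : Type*) [RCLike 𝕜] (A : Type*) [NonUnitalRing A] [Module 𝕜 A] [Bornology A]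

/-- The bornological vector space `𝕜 ⊕ A` underlying the unitalization of `A`. -/
abbrev Plus : Type _ := 𝕜 × A

variable (M : Type*) [AddCommGroup M] [Module 𝕜 M] [Bornology M]

/-- The right action of the unitalization: `m (k, a) = k m + m a`. -/
def ractPlus [BornRightModule 𝕜 A M] : M →ₗ[𝕜] Plus 𝕜 A →ₗ[𝕜] M :=
  LinearMap.mk₂ 𝕜 (fun m p => p.1 • m + ract 𝕜 A M m p.2)
    (fun m m' p => by simp only [smul_add, map_add, LinearMap.add_apply]; abel)
    (fun k m p => by simp only [map_smul, LinearMap.smul_apply, smul_add, smul_comm k])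
    (fun m p q => by simp only [Prod.fst_add, Prod.snd_add, add_smul, map_add]; abel)
    (fun k m p => by
      simp only [Prod.smul_fst, Prod.smul_snd, smul_eq_mul, mul_smul, map_smul, smul_add])

/-- The left action of the unitalization: `(k, a) m = k m + a m`. -/
def lactPlus [BornLeftModule 𝕜 A M] : Plus 𝕜 A →ₗ[𝕜] M →ₗ[𝕜] M :=
  LinearMap.mk₂ 𝕜 (fun p m => p.1 • m + lact 𝕜 A M p.2 m)
    (fun p q m => by
      simp only [Prod.fst_add, Prod.snd_add, add_smul, map_add, LinearMap.add_apply]; abel)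
    (fun k p m => by
      simp only [Prod.smul_fst, Prod.smul_snd, smul_eq_mul, mul_smul, map_smul,
        LinearMap.smul_apply, smul_add])
    (fun p m m' => by simp only [smul_add, map_add]; abel)
    (fun k p m => by simp only [map_smul, smul_add, smul_comm k])

/-- Left multiplication by `a` on the unitalization: `a (k, b) = (0, k a + a b)`. -/
def mulLeftPlus [BornAlgebra 𝕜 A] (a : A) : Plus 𝕜 A →ₗ[𝕜] Plus 𝕜 A :=
  LinearMap.inr 𝕜 𝕜 A ∘ₗ ractPlus 𝕜 A A a

/-- Right multiplication by `a` on the unitalization: `(k, b) a = (0, k a + b a)`. -/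
def mulRightPlus [BornAlgebra 𝕜 A] (a : A) : Plus 𝕜 A →ₗ[𝕜] Plus 𝕜 A :=
  LinearMap.inr 𝕜 𝕜 A ∘ₗ (lactPlus 𝕜 A A).flip a

variable {𝕜 A M}

theorem isBounded_smul_image2 [CompleteBVS 𝕜 M] (K : Set 𝕜) (S : Set M)
    (hK : Bornology.IsBounded K) (hS : Bornology.IsBounded S) :
    Bornology.IsBounded (Set.image2 (fun k m => k • m) K S) := by
  obtain ⟨D, hSD, hD, hDc⟩ := CompleteBVS.exists_completant (𝕜 := 𝕜) S hS
  obtain ⟨R, hR⟩ := hK.exists_norm_le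
  refine (CompleteBVS.isBounded_smul ((max R 0 : ℝ) : 𝕜) D hD).subset ?_
  rintro _ ⟨k, hk, m, hm, rfl⟩
  exact hDc.toIsDisc.smul_mem' (a := 1) k zero_le_one
    (by rw [mul_one]; exact (hR k hk).trans (le_max_left _ _)) ⟨m, hSD hm, by simp⟩

theorem ractPlus_isBddBilin [CompleteBVS 𝕜 M] [BornRightModule 𝕜 A M] :
    IsBddBilin (ractPlus 𝕜 A M) := by
  intro S T hS hT
  obtain ⟨h1, h2⟩ := Bornology.isBounded_image_fst_and_snd.2 hT
  refine (CompleteBVS.isBounded_add 𝕜 _ _ (isBounded_smul_image2 (𝕜 := 𝕜) _ S h1 hS)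
    (BornRightModule.act_isBdd (𝕜 := 𝕜) S _ hS h2)).subset ?_
  rintro _ ⟨m, hm, p, hp, rfl⟩
  exact ⟨_, ⟨_, ⟨p, hp, rfl⟩, m, hm, rfl⟩, _, ⟨m, hm, _, ⟨p, hp, rfl⟩, rfl⟩, rfl⟩

theorem lactPlus_isBddBilin [CompleteBVS 𝕜 M] [BornLeftModule 𝕜 A M] :
    IsBddBilin (lactPlus 𝕜 A M) := by
  intro T S hT hS
  obtain ⟨h1, h2⟩ := Bornology.isBounded_image_fst_and_snd.2 hT
  refine (CompleteBVS.isBounded_add 𝕜 _ _ (isBounded_smul_image2 (𝕜 := 𝕜) _ S h1 hS)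
    (BornLeftModule.act_isBdd (𝕜 := 𝕜) _ S h2 hS)).subset ?_
  rintro _ ⟨p, hp, m, hm, rfl⟩
  exact ⟨_, ⟨_, ⟨p, hp, rfl⟩, m, hm, rfl⟩, _, ⟨_, ⟨p, hp, rfl⟩, m, hm, rfl⟩, rfl⟩

theorem inr_isBdd : IsBdd (LinearMap.inr 𝕜 𝕜 A) := fun S hS =>
  ((Bornology.isBounded_singleton (x := (0 : 𝕜))).prod hS).subset (by
    rintro _ ⟨a, ha, rfl⟩; exact ⟨rfl, ha⟩)

theorem mulLeftPlus_isBdd [BornAlgebra 𝕜 A] (a : A) : IsBdd (mulLeftPlus 𝕜 A a) :=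
  inr_isBdd.comp (ractPlus_isBddBilin.right a)

theorem mulRightPlus_isBdd [BornAlgebra 𝕜 A] (a : A) : IsBdd (mulRightPlus 𝕜 A a) :=
  inr_isBdd.comp (lactPlus_isBddBilin.left a)

/-- The map `g ⊗ h` between completed tensor products. -/
noncomputable def CTensor.map {M N M' N' : Type*}
    [AddCommGroup M] [Module 𝕜 M] [Bornology M] [AddCommGroup N] [Module 𝕜 N] [Bornology N]
    [AddCommGroup M'] [Module 𝕜 M'] [Bornology M'] [AddCommGroup N'] [Module 𝕜 N'] [Bornology N']
    (g : M →ₗ[𝕜] M') (hg : IsBdd g) (h : N →ₗ[𝕜] N') (hh : IsBdd h) :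
    CTensor 𝕜 M N →ₗ[𝕜] CTensor 𝕜 M' N' :=
  CTensor.lift (CTensor.tmul.compl₁₂ g h) (fun S T hS hT =>
    (CTensor.tmul_isBddBilin (𝕜 := 𝕜) _ _ (hg S hS) (hh T hT)).subset (by
      rintro _ ⟨m, hm, n, hn, rfl⟩; exact ⟨_, ⟨m, hm, rfl⟩, _, ⟨n, hn, rfl⟩, rfl⟩))

variable (𝕜 A)

/-- A quasi-unital algebra: it has an approximate identity on every bounded set, and the
multiplication maps `A⁺ ⊗ A → A` and `A ⊗ A⁺ → A` have bounded sections that are left,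
respectively right, `A`-linear (equivalently, `A⁺`-linear). If `A` has a unit, these sections
exist, both for `A⁺ = A` and for `A⁺ = 𝕜 ⊕ A`. -/
structure IsQuasiUnital [BornAlgebra 𝕜 A] : Prop where
  approx : ∀ S : Set A, Bornology.IsBounded S → ∃ (μ : ℕ → A) (T : Set A), S ⊆ T ∧
    Bornology.IsBounded T ∧ IsCompletant 𝕜 T ∧ ∀ ε : ℝ, 0 < ε → ∃ N : ℕ, ∀ n, N ≤ n → ∀ x ∈ S,
      μ n * x - x ∈ ((ε : ℝ) : 𝕜) • T ∧ x * μ n - x ∈ ((ε : ℝ) : 𝕜) • T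
  left_section : ∃ σ : A →ₗ[𝕜] CTensor 𝕜 (Plus 𝕜 A) A, IsBdd σ ∧
    (∀ a b, σ (a * b) =
      CTensor.map (mulLeftPlus 𝕜 A a) (mulLeftPlus_isBdd a) LinearMap.id isBdd_id (σ b)) ∧
    ∀ a, CTensor.lift (lactPlus 𝕜 A A) lactPlus_isBddBilin (σ a) = a
  right_section : ∃ σ : A →ₗ[𝕜] CTensor 𝕜 A (Plus 𝕜 A), IsBdd σ ∧
    (∀ a b, σ (b * a) =
      CTensor.map LinearMap.id isBdd_id (mulRightPlus 𝕜 A a) (mulRightPlus_isBdd a) (σ b)) ∧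
    ∀ a, CTensor.lift (ractPlus 𝕜 A A) ractPlus_isBddBilin (σ a) = a

/-- A multiplicatively convex algebra: every bounded set is absorbed by a bounded disc that is
closed under multiplication. -/
def IsMultConvex : Prop :=
  ∀ S : Set A, Bornology.IsBounded S → ∃ D : Set A, Bornology.IsBounded D ∧ IsDisc 𝕜 D ∧
    (∀ a ∈ D, ∀ b ∈ D, a * b ∈ D) ∧ ∃ r : ℝ, 0 < r ∧ S ⊆ ((r : ℝ) : 𝕜) • D

end Plus

/-! ### Finite modules and Morita equivalence bimodules -/

section Hom

set_option linter.unusedSectionVars false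

variable (𝕜 : Type*) [RCLike 𝕜] (A : Type*) [NonUnitalRing A] [Module 𝕜 A] [Bornology A]
  (P E : Type*) [AddCommGroup P] [Module 𝕜 P] [Bornology P]
  [AddCommGroup E] [Module 𝕜 E] [Bornology E] [CompleteBVS 𝕜 E]

theorem isBdd_zero : IsBdd (0 : P →ₗ[𝕜] E) := fun S _ =>
  (Bornology.isBounded_singleton (x := (0 : E))).subset (by rintro _ ⟨_, _, rfl⟩; rfl)

/-- The space of bounded linear maps of right `A`-modules. -/
def HomRight [BornRightModule 𝕜 A P] [BornRightModule 𝕜 A E] : Submodule 𝕜 (P →ₗ[𝕜] E) where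
  carrier := {f | IsBdd f ∧ ∀ x a, f (ract 𝕜 A P x a) = ract 𝕜 A E (f x) a}
  zero_mem' := ⟨isBdd_zero 𝕜 P E, by simp⟩
  add_mem' := fun hf hg => ⟨hf.1.add hg.1, fun x a => by simp [hf.2, hg.2]⟩
  smul_mem' := fun k _ hf => ⟨hf.1.smul k, fun x a => by simp [hf.2]⟩

/-- The space of bounded linear maps of left `A`-modules. -/
def HomLeft [BornLeftModule 𝕜 A P] [BornLeftModule 𝕜 A E] : Submodule 𝕜 (P →ₗ[𝕜] E) where
  carrier := {f | IsBdd f ∧ ∀ a x, f (lact 𝕜 A P a x) = lact 𝕜 A E a (f x)}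
  zero_mem' := ⟨isBdd_zero 𝕜 P E, by simp⟩
  add_mem' := fun hf hg => ⟨hf.1.add hg.1, fun x a => by simp [hf.2, hg.2]⟩
  smul_mem' := fun k _ hf => ⟨hf.1.smul k, fun x a => by simp [hf.2]⟩

variable {𝕜 P E}

/-- An equibounded set of linear maps. -/
def Equibounded (H : Set (P →ₗ[𝕜] E)) : Prop :=
  ∀ S : Set P, Bornology.IsBounded S → Bornology.IsBounded {y | ∃ f ∈ H, ∃ x ∈ S, f x = y}

end Hom

section Modules

universe u

variable (𝕜 : Type) [RCLike 𝕜] (A : Type u) [NonUnitalRing A] [Module 𝕜 A] [Bornology A]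
  (P : Type u) [AddCommGroup P] [Module 𝕜 P] [Bornology P]

/-- A projective right module: for every bounded `A`-linear map `p : E → F` with a bounded
`𝕜`-linear section, the map `p ∘ · : 𝓛_A(P, E) → 𝓛_A(P, F)` has a linear section that is bounded
for the equibounded bornologies. That is, `𝓛_A(P, ·)` takes the exact sequences with bounded
`𝕜`-linear splitting to such sequences. -/
def IsProjectiveRight [BornRightModule 𝕜 A P] : Prop :=
  ∀ (E F : Type u) [AddCommGroup E] [Module 𝕜 E] [Bornology E] [CompleteBVS 𝕜 E]
    [BornRightModule 𝕜 A E] [AddCommGroup F] [Module 𝕜 F] [Bornology F] [CompleteBVS 𝕜 F]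
    [BornRightModule 𝕜 A F], ∀ p ∈ HomRight 𝕜 A E F,
    (∃ s : F →ₗ[𝕜] E, IsBdd s ∧ ∀ y, p (s y) = y) →
    ∃ σ : HomRight 𝕜 A P F →ₗ[𝕜] HomRight 𝕜 A P E,
      (∀ h x, p ((σ h).1 x) = h.1 x) ∧
      ∀ H : Set (HomRight 𝕜 A P F), Equibounded (Subtype.val '' H) →
        Equibounded (Subtype.val '' (σ '' H))

/-- A projective left module. -/
def IsProjectiveLeft [BornLeftModule 𝕜 A P] : Prop :=
  ∀ (E F : Type u) [AddCommGroup E] [Module 𝕜 E] [Bornology E] [CompleteBVS 𝕜 E]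
    [BornLeftModule 𝕜 A E] [AddCommGroup F] [Module 𝕜 F] [Bornology F] [CompleteBVS 𝕜 F]
    [BornLeftModule 𝕜 A F], ∀ p ∈ HomLeft 𝕜 A E F,
    (∃ s : F →ₗ[𝕜] E, IsBdd s ∧ ∀ y, p (s y) = y) →
    ∃ σ : HomLeft 𝕜 A P F →ₗ[𝕜] HomLeft 𝕜 A P E,
      (∀ h x, p ((σ h).1 x) = h.1 x) ∧
      ∀ H : Set (HomLeft 𝕜 A P F), Equibounded (Subtype.val '' H) →
        Equibounded (Subtype.val '' (σ '' H))

/-- An essential right module: the natural map `P ⊗_A A → P` is a bornological isomorphism. -/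
def IsEssentialRight [BornAlgebra 𝕜 A] [CompleteBVS 𝕜 P] [BornRightModule 𝕜 A P] : Prop :=
  IsBornIso (BTensor.lift 𝕜 A (ract 𝕜 A P) (ract_isBddBilin 𝕜 A P) (ract_balanced 𝕜 A P))

/-- An essential left module: the natural map `A ⊗_A P → P` is a bornological isomorphism. -/
def IsEssentialLeft [BornAlgebra 𝕜 A] [CompleteBVS 𝕜 P] [BornLeftModule 𝕜 A P] : Prop :=
  IsBornIso (BTensor.lift 𝕜 A (lact 𝕜 A P) (lact_isBddBilin 𝕜 A P) (lact_balanced 𝕜 A P))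

/-- A finitely generated right module: for some `n` there is an admissible epimorphism
`(A⁺)ⁿ → P`, that is, an `A`-linear map `c ↦ ∑ eᵢ cᵢ` with a bounded `𝕜`-linear section.
If `A` has a unit, then using `𝕜 ⊕ A` or `A` for `A⁺` makes no difference here, because the unit
of `A` acts as the identity on `P`. -/
def IsFinGenRight [BornRightModule 𝕜 A P] : Prop :=
  ∃ (n : ℕ) (e : Fin n → P) (s : P →ₗ[𝕜] (Fin n → Plus 𝕜 A)), IsBdd s ∧
    ∀ x, ∑ i, ractPlus 𝕜 A P (e i) (s x i) = x

/-- A finite right module: finitely generated, projective and essential. -/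
structure IsFiniteRight [BornAlgebra 𝕜 A] [CompleteBVS 𝕜 P] [BornRightModule 𝕜 A P] :
    Prop where
  finGen : IsFinGenRight 𝕜 A P
  projective : IsProjectiveRight 𝕜 A P
  essential : IsEssentialRight 𝕜 A P

end Modules

section Morita

universe u

variable (𝕜 : Type) [RCLike 𝕜]
  (A : Type u) [NonUnitalRing A] [Module 𝕜 A] [Bornology A] [BornAlgebra 𝕜 A]
  (B : Type u) [NonUnitalRing B] [Module 𝕜 B] [Bornology B] [BornAlgebra 𝕜 B]
  (X : Type u) [AddCommGroup X] [Module 𝕜 X] [Bornology X] [CompleteBVS 𝕜 X]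
  [BornLeftModule 𝕜 A X] [BornRightModule 𝕜 B X] [IsBimodule 𝕜 A B X]

/-- `X ⊗_B Y ≃ A` as bornological `A`-`A`-bimodules, for an `A`-`B`-bimodule `X` and a
`B`-`A`-bimodule `Y`. -/
def TensorIsoAlgebra (Y : Type u) [AddCommGroup Y] [Module 𝕜 Y] [Bornology Y]
    [BornLeftModule 𝕜 B Y] [BornRightModule 𝕜 A Y] [IsBimodule 𝕜 B A Y] : Prop :=
  ∃ φ : BTensor 𝕜 B X Y →ₗ[𝕜] A, IsBornIso φ ∧
    (∀ a t, φ (lact 𝕜 A _ a t) = a * φ t) ∧ ∀ t a, φ (ract 𝕜 A _ t a) = φ t * a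

/-- A Morita equivalence `A`-`B`-bimodule: an essential `A`-`B`-bimodule `X` for which there is an
essential `B`-`A`-bimodule `Y`, projective on both sides, with bornological bimodule isomorphisms
`A ≃ X ⊗_B Y` and `B ≃ Y ⊗_A X`. -/
structure IsMoritaBimodule : Prop where
  essential_left : IsEssentialLeft 𝕜 A X
  essential_right : IsEssentialRight 𝕜 B X
  exists_dual : ∃ (Y : Type u) (_ : AddCommGroup Y) (_ : Module 𝕜 Y) (_ : Bornology Y)
    (_ : CompleteBVS 𝕜 Y) (_ : BornLeftModule 𝕜 B Y) (_ : BornRightModule 𝕜 A Y)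
    (_ : IsBimodule 𝕜 B A Y),
    IsEssentialLeft 𝕜 B Y ∧ IsEssentialRight 𝕜 A Y ∧
    IsProjectiveLeft 𝕜 B Y ∧ IsProjectiveRight 𝕜 A Y ∧
    TensorIsoAlgebra 𝕜 A B X Y ∧ TensorIsoAlgebra 𝕜 B A Y X

end Morita

end Borno

open Borno

universe u

namespace Borno

/-! ### Unconditionally convergent series and the Neumann series. -/

section Series

variable {𝕜 : Type*} [RCLike 𝕜] {V Z : Type*}
  [AddCommGroup V] [Module 𝕜 V] [Bornology V] [AddCommGroup Z] [Module 𝕜 Z] [Bornology Z]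

/-! Write P = M ⊗_A X, and let φ : X ⊗_B Y ≃ A and ψ : Y ⊗_A X ≃ B be the given isomorphisms.
Nothing ties φ to ψ, so φ(x ⊗ y)x' and xψ(y ⊗ x') may differ, but they do so only by a bimodule
endomorphism θ of X (`exists_twist`). Inserting θ produces an A-linear unit η : M → P ⊗_B Y that
satisfies one triangle identity exactly: the pairing (x, p ⊗ y) ↦ pψ(y ⊗ x) takes (x, η(m)) to m ⊗ x
(`exists_unit`). Projectivity and finite generation both rest on this identity; the full equivalence
of categories is not needed.

Projectivity (`IsProjectiveRight.tensor`): by the identity, Hom_B(P, E) is a natural retract of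
Hom_A(M, E ⊗_B Y). The functor – ⊗_B Y preserves linearly split surjections, because the
multiplication B ⊗ Y → Y has a B-linear section, and then projectivity of M applies. Essentiality
(`IsEssentialRight.tensor`) is associativity of the tensor product together with X ⊗_B B ≃ X.

Finite generation (`IsFinGenRight.tensor`): M has a finite dual basis e_i, c_i
(`IsFiniteRight.exists_dual_basis`), so t = ∑ e_i ⊗ C_i(t) on P with C_i(m ⊗ x) = c_i(m)x. By the
triangle identity e_i ⊗ x is the pairing of x with η(e_i), and η(e_i) is an absolutely summable
series ∑ ω_i(p, y) p ⊗ y. Hence the identity of P is ∑_i ∑ ω_i(p, y) p · G_i(y, –) with G_i(y, t) =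
ψ(y ⊗ C_i(t)) in B.

This series is infinite, so it has to be truncated (`isFinGenRight_of_nuclear`). A finite part Φ
factors through a finite free module, and R = 1 - Φ has small coefficients. The power R^N is a
series of words p₁ G(y₁, p₂) ⋯ G(y_{N-1}, p_N) G(y_N, t). Multiplicative convexity of B puts all
inner factors into r D with D D ⊆ D, so their products grow at most like powers of r, and small
coefficients beat this growth. The Neumann series then gives a bounded right inverse of Φ
(`exists_rightInverse_one_sub`), hence a linear section of the map from the free module. -/

theorem HasBSum.map {ι : Type*} {g : ι → V} {l : V} (h : HasBSum 𝕜 g l) {f : V →ₗ[𝕜] Z}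
    (hf : IsBdd f) : HasBSum 𝕜 (fun i => f (g i)) (f l) := by
  obtain ⟨D, hD, h⟩ := h
  refine ⟨f '' D, hf D hD, fun ε hε => ?_⟩
  obtain ⟨F₀, hF⟩ := h ε hε
  refine ⟨F₀, fun F hF' => ?_⟩
  obtain ⟨d, hd, e⟩ := hF F hF'
  refine ⟨f d, ⟨d, hd, rfl⟩, ?_⟩
  have := congrArg f e
  simpa only [map_smul, map_sub, map_sum] using this

/-- Peels the zeroth term off the Neumann series, which turns its sum G into the equation G t = t +
R (G t). -/
theorem HasBSum.of_succ {g : ℕ → V} {l : V} (h : HasBSum 𝕜 (fun k => g (k + 1)) l) :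
    HasBSum 𝕜 g (g 0 + l) := by
  classical
  obtain ⟨D, hD, h⟩ := h
  refine ⟨D, hD, fun ε hε => ?_⟩
  obtain ⟨F₀, hF⟩ := h ε hε
  refine ⟨insert 0 (F₀.image Nat.succ), fun F hF' => ?_⟩
  have h0 : 0 ∈ F := hF' (Finset.mem_insert_self _ _)
  set F' := F.preimage Nat.succ Nat.succ_injective.injOn
  have e : F = insert 0 (F'.image Nat.succ) := by
    ext k
    rcases k with _ | k <;> simp [F', h0]
  have e' : ∑ k ∈ F, g k = g 0 + ∑ k ∈ F', g (k + 1) := by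
    rw [e, Finset.sum_insert (by simp), Finset.sum_image (Nat.succ_injective.injOn)]
  rw [e', add_sub_add_left_eq_sub]
  refine hF F' fun k hk => ?_
  rw [Finset.mem_preimage]
  exact hF' (Finset.mem_insert_of_mem (Finset.mem_image_of_mem _ hk))

/-- The Neumann series: `1 - R` has a bounded right inverse if the powers of `R` decay
geometrically on bounded sets. -/
theorem exists_rightInverse_one_sub [CompleteBVS 𝕜 V] {R : Module.End 𝕜 V} (hR : IsBdd R)
    (h : ∀ U : Set V, Bornology.IsBounded U → ∃ K : Set V, Bornology.IsBounded K ∧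
      IsCompletant 𝕜 K ∧ ∀ t ∈ U, ∀ N : ℕ, (R ^ N) t ∈ (((1 / 2 : ℝ) ^ N : ℝ) : 𝕜) • K) :
    ∃ G : V →ₗ[𝕜] V, IsBdd G ∧ ∀ t, G t - R (G t) = t := by
  have key : ∀ U : Set V, Bornology.IsBounded U → ∃ K : Set V, Bornology.IsBounded K ∧
      ∀ t ∈ U, ∃ l ∈ K, HasBSum 𝕜 (fun N => (R ^ N) t) l := by
    intro U hU
    obtain ⟨K, hK, hKc, hd⟩ := h U hU
    -- The 2 is the sum of the weights (1/2)^N, and the 1 is the slack in `IsCompletant.hasBSum`.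
    -- The set depends on U alone, which is what makes G bounded.
    refine ⟨((2 + 1 : ℝ) : 𝕜) • K, CompleteBVS.isBounded_smul _ _ hK, fun t ht => ?_⟩
    choose z hz hzt using hd t ht
    have e : ∀ k : ℕ, ‖(((1 / 2 : ℝ) ^ k : ℝ) : 𝕜)‖ = (1 / 2 : ℝ) ^ k := fun k => by
      rw [RCLike.norm_ofReal, abs_of_nonneg (by positivity)]
    obtain ⟨l, hl, hlK⟩ := hKc.hasBSum hK (fun N : ℕ => (((1 / 2 : ℝ) ^ N : ℝ) : 𝕜)) z
      (fun i _ => hz i) (r := 2)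
      (by simp only [e]; exact summable_geometric_two)
      (by simp only [e]; exact tsum_geometric_two.le)
    exact ⟨l, hlK, by simpa only [hzt] using hl⟩
  have hex : ∀ t, ∃ l, HasBSum 𝕜 (fun N => (R ^ N) t) l := fun t => by
    obtain ⟨K, -, hK⟩ := key {t} Bornology.isBounded_singleton
    obtain ⟨l, -, hl⟩ := hK t rfl
    exact ⟨l, hl⟩
  -- Linearity of the chosen sums follows from uniqueness of limits.
  choose G hG using hex
  refine ⟨{ toFun := G, map_add' := fun a b => ?_, map_smul' := fun k a => ?_ }, ?_, fun t => ?_⟩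
  · refine (hG (a + b)).unique (𝕜 := 𝕜) ?_
    convert (hG a).add (hG b) using 1
    funext N
    simp
  · refine (hG (k • a)).unique (𝕜 := 𝕜) ?_
    have : (fun N => (R ^ N) (k • a)) = k • fun N => (R ^ N) a := by
      funext N
      simp
    rw [this]
    exact (hG a).smul k
  · intro U hU
    obtain ⟨K, hK, h'⟩ := key U hU
    refine hK.subset ?_
    rintro _ ⟨t, ht, rfl⟩
    obtain ⟨l, hl, hs⟩ := h' t ht
    rwa [LinearMap.coe_mk, AddHom.coe_mk, (hG t).unique hs]
  · have h1 : HasBSum 𝕜 (fun N => (R ^ (N + 1)) t) (R (G t)) := by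
      have := (hG t).map hR
      simpa only [pow_succ', Module.End.mul_apply] using this
    have h2 := (hG t).unique h1.of_succ
    simp only [LinearMap.coe_mk, AddHom.coe_mk, pow_zero, Module.End.one_apply] at h2 ⊢
    rw [sub_eq_iff_eq_add]
    exact h2

end Series

/-! ### Truncation of absolutely summable families. -/

section Tails

set_option linter.unusedSectionVars false

variable {𝕜 : Type*} [RCLike 𝕜] {M N Z : Type*}
  [AddCommGroup M] [Module 𝕜 M] [Bornology M]
  [AddCommGroup N] [Module 𝕜 N] [Bornology N]
  [AddCommGroup Z] [Module 𝕜 Z] [Bornology Z]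

/-- Every absolutely summable family is a finite sum up to a small remainder. -/
theorem PreTensor.exists_tail (c : PreTensor 𝕜 M N) : ∃ (S : Set M) (T : Set N),
    Bornology.IsBounded S ∧ Bornology.IsBounded T ∧ ∀ ε : ℝ, 0 < ε → ∃ F : Finset (M × N),
      c - ∑ p ∈ F, c.val p • PreTensor.delta p.1 p.2 ∈ preDisc S T ε := by
  classical
  obtain ⟨S, T, r, hS, hT, hc⟩ := isBounded_pre_iff.1 (Bornology.isBounded_singleton (x := c))
  have hc := hc rfl
  -- The supporting sets are fixed before ε, so that a bound on S × T can decide how small ε has to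
  -- be.
  refine ⟨S, T, hS, hT, fun ε hε => ?_⟩
  have hs := lp.hasSum_single (E := fun _ : M × N => 𝕜) (p := 1) (by simp) c.val
  obtain ⟨F, hF⟩ := (Metric.tendsto_atTop.1 hs) ε hε
  have hF := hF F le_rfl
  have hval : (∑ p ∈ F, c.val p • PreTensor.delta p.1 p.2 : PreTensor 𝕜 M N).val
      = ∑ p ∈ F, lp.single 1 p (c.val p) := by
    rw [map_sum]
    refine Finset.sum_congr rfl fun p _ => ?_
    rw [map_smul, val_delta, ← lp.single_smul, smul_eq_mul, mul_one]
  refine ⟨F, ?_, fun p hp => ?_⟩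
  · rw [map_sub, hval, norm_sub_rev, ← dist_eq_norm]
    exact hF.le
  · by_contra hpn
    refine hp ?_
    have e1 : c.val p = 0 := by_contra fun h => hpn (hc.2 p h)
    have e2 : (∑ q ∈ F, lp.single 1 q (c.val q) : lp (fun _ : M × N => 𝕜) 1) p = 0 := by
      rw [lp.coeFn_sum, Finset.sum_apply]
      refine Finset.sum_eq_zero fun q _ => ?_
      rw [lp.single_apply]
      by_cases hq : p = q
      · subst hq; simp [e1]
      · exact Pi.single_eq_of_ne hq _
    rw [map_sub, hval]
    change c.val p - (∑ q ∈ F, lp.single 1 q (c.val q) : lp (fun _ : M × N => 𝕜) 1) p = 0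
    rw [e1, e2, sub_zero]

theorem preDisc_mono {S S' : Set M} {T T' : Set N} (r : ℝ) (hS : S ⊆ S') (hT : T ⊆ T') :
    (preDisc S T r : Set (PreTensor 𝕜 M N)) ⊆ preDisc S' T' r :=
  fun _ hc => ⟨hc.1, fun p hp => Set.prod_mono hS hT (hc.2 p hp)⟩

variable [CompleteBVS 𝕜 Z]

/-- A bounded linear functional of a lifted map, estimated on a small family. -/
theorem PreTensor.map_lift_mem {V : Type*} [AddCommGroup V] [Module 𝕜 V] [Bornology V]
    [CompleteBVS 𝕜 V] (f : M →ₗ[𝕜] N →ₗ[𝕜] V) (hf : IsBddBilin f) (Λ : V →ₗ[𝕜] Z) (hΛ : IsBdd Λ)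
    {S : Set M} {T : Set N} {a ε : ℝ} (hε : 0 < ε) {K : Set Z}
    (hKb : Bornology.IsBounded K) (hK : IsCompletant 𝕜 K)
    (hS : ∀ m ∈ S, ∀ n ∈ T, Λ (f m n) ∈ ((a : ℝ) : 𝕜) • K) {c : PreTensor 𝕜 M N}
    (hc : c ∈ preDisc S T ε) :
    Λ (PreTensor.lift f hf c) ∈ ((2 * ε * a : ℝ) : 𝕜) • K := by
  have hε' : (ε : 𝕜) ≠ 0 := by exact_mod_cast hε.ne'
  -- Off the support of c nothing is known about the values of f, and z is an arbitrary default
  -- there.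
  have hz : ∀ p : M × N, ∃ z : Z, c.val p ≠ 0 → z ∈ K ∧ ((a : ℝ) : 𝕜) • z = Λ (f p.1 p.2) := by
    intro p
    by_cases hp : c.val p = 0
    · exact ⟨0, fun h => (h hp).elim⟩
    · obtain ⟨z, hz, e⟩ := hS _ (hc.2 p hp).1 _ (hc.2 p hp).2
      exact ⟨z, fun _ => ⟨hz, e⟩⟩
  choose z hz using hz
  have hn : ∀ p, ‖(ε : 𝕜)⁻¹ * c.val p‖ = ε⁻¹ * ‖c.val p‖ := fun p => by
    rw [norm_mul, norm_inv, RCLike.norm_ofReal, abs_of_pos hε]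
  -- Dividing by ε brings the ℓ¹-norm down to 1 before `IsCompletant.hasBSum` adds its slack of 1.
  -- This yields the factor 2ε; without the rescaling the bound would be ε + 1, useless for small
  -- remainders.
  obtain ⟨l, hl, hlK⟩ := hK.hasBSum hKb (fun p => (ε : 𝕜)⁻¹ * c.val p) z
    (fun p hp => (hz p (right_ne_zero_of_mul hp)).1)
    (by simp only [hn]; exact c.summable_norm.mul_left _) (r := 1) (by
      simp only [hn]
      rw [tsum_mul_left, ← c.norm_val, inv_mul_le_iff₀ hε, mul_one]
      exact hc.1)
  have h1 := hl.smul ((ε * a : ℝ) : 𝕜)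
  have h2 := (hasBSum_lift f hf c).map hΛ
  have e : (fun p => Λ (c.val p • f p.1 p.2))
      = ((ε * a : ℝ) : 𝕜) • fun p => ((ε : 𝕜)⁻¹ * c.val p) • z p := by
    funext p
    by_cases hp : c.val p = 0
    · simp [hp]
    · rw [map_smul, ← (hz p hp).2, Pi.smul_apply, smul_smul, smul_smul]
      congr 1
      push_cast
      field_simp
  rw [e] at h2
  rw [h2.unique h1]
  obtain ⟨k, hk, rfl⟩ := hlK
  refine ⟨k, hk, ?_⟩
  simp only [smul_smul]
  congr 1
  push_cast
  ring

end Tails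

/-! ### Finite generation from a summable expansion of the identity. -/

section FinGen

variable {𝕜 : Type} [RCLike 𝕜] {B : Type u} [NonUnitalRing B] [Module 𝕜 B] [Bornology B]
  [BornAlgebra 𝕜 B] {P : Type u} [AddCommGroup P] [Module 𝕜 P] [Bornology P] [CompleteBVS 𝕜 P]
  [BornRightModule 𝕜 B P] {Y : Type*} [AddCommGroup Y] [Module 𝕜 Y] [Bornology Y]

theorem IsBddBilin.compl₂ {V W W' Z : Type*} [AddCommGroup V] [Module 𝕜 V] [Bornology V]
    [AddCommGroup W] [Module 𝕜 W] [Bornology W] [AddCommGroup W'] [Module 𝕜 W'] [Bornology W']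
    [AddCommGroup Z] [Module 𝕜 Z] [Bornology Z]
    {f : V →ₗ[𝕜] W →ₗ[𝕜] Z} (hf : IsBddBilin f) {g : W' →ₗ[𝕜] W} (hg : IsBdd g) :
    IsBddBilin (f.compl₂ g) := fun S T hS hT => (hf S _ hS (hg T hT)).subset (by
  rintro _ ⟨v, hv, w, hw, rfl⟩
  exact ⟨v, hv, _, ⟨w, hw, rfl⟩, rfl⟩)

theorem IsBdd.sum {V W ι : Type*} [AddCommGroup V] [Module 𝕜 V] [Bornology V]
    [AddCommGroup W] [Module 𝕜 W] [Bornology W] [CompleteBVS 𝕜 W] (F : Finset ι)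
    {f : ι → V →ₗ[𝕜] W} (hf : ∀ i, IsBdd (f i)) : IsBdd (∑ i ∈ F, f i) := by
  classical
  induction F using Finset.induction_on with
  | empty => simpa using isBdd_zero 𝕜 V W
  | insert i F hi ih => rw [Finset.sum_insert hi]; exact (hf i).add ih

theorem IsDisc.finset_sum_mem {V ι : Type*} [AddCommGroup V] [Module 𝕜 V] {D : Set V}
    (hD : IsDisc 𝕜 D) {a : ℝ} (ha : 0 ≤ a) (F : Finset ι) (z : ι → V)
    (hz : ∀ i, z i ∈ ((a : ℝ) : 𝕜) • D) : ∑ i ∈ F, z i ∈ ((F.card * a : ℝ) : 𝕜) • D := by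
  classical
  induction F using Finset.induction_on with
  | empty => simpa using hD.zero_mem' (𝕜 := 𝕜) 0
  | insert i F hi ih =>
    rw [Finset.sum_insert hi, Finset.card_insert_of_notMem hi]
    have := hD.add_mem ha (by positivity) (hz i) ih
    convert this using 3
    push_cast
    ring

/-- If the identity of `P` is a finite sum of absolutely summable series of maps factoring through
`B` and `B` is multiplicatively convex, then `P` is finitely generated. -/
theorem isFinGenRight_of_nuclear (hBm : IsMultConvex 𝕜 B) {n : ℕ} (G : Fin n → Y →ₗ[𝕜] P →ₗ[𝕜] B)
    (hG : ∀ i, IsBddBilin (G i))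
    (hGB : ∀ i y t b, G i y (ract 𝕜 B P t b) = G i y t * b)
    (ω : Fin n → PreTensor 𝕜 P Y)
    (hω : ∀ t, ∑ i, PreTensor.lift ((ract 𝕜 B P).compl₂ ((G i).flip t))
      ((ract_isBddBilin 𝕜 B P).compl₂ ((hG i).left t)) (ω i) = t) :
    IsFinGenRight 𝕜 B P := by
  classical
  choose S T hS hT hF using fun i => (ω i).exists_tail
  set S' : Set P := ⋃ i, S i
  set T' : Set Y := ⋃ i, T i
  have hS' : Bornology.IsBounded S' := Bornology.isBounded_iUnion.2 hS
  have hT' : Bornology.IsBounded T' := Bornology.isBounded_iUnion.2 hT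
  -- The inner factors of all powers of the remainder lie in this one set, whatever the truncation
  -- turns out to be. Multiplicative convexity controls their products.
  obtain ⟨D, hD, hDd, hDm, r, hr, hDr⟩ := hBm (⋃ i, Set.image2 (fun y p => G i y p) T' S')
    (Bornology.isBounded_iUnion.2 fun i => hG i _ _ hT' hS')
  -- One application of R costs a factor 2nε, times r for an inner factor. This ε makes both at most
  -- 1/2; adding 1 to n and r covers both bounds at once and the case n = 0.
  set ε : ℝ := 1 / (4 * (n + 1) * (r + 1)) with hεdef
  have hε : 0 < ε := by positivity
  have hε1 : 4 * (n * ε) ≤ 1 := by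
    rw [hεdef, mul_one_div, ← mul_div_assoc, div_le_one (by positivity)]
    nlinarith [Nat.cast_nonneg (α := ℝ) n]
  have hε2 : 4 * (n * (ε * r)) ≤ 1 := by
    rw [hεdef, one_div_mul_eq_div, ← mul_div_assoc, ← mul_div_assoc, div_le_one (by positivity)]
    nlinarith [Nat.cast_nonneg (α := ℝ) n, mul_nonneg (Nat.cast_nonneg (α := ℝ) n) hr.le]
  choose F hF using fun i => hF i ε hε
  set tail : Fin n → PreTensor 𝕜 P Y := fun i =>
    ω i - ∑ p ∈ F i, (ω i).val p • PreTensor.delta p.1 p.2 with htail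
  have htm : ∀ i, tail i ∈ preDisc S' T' ε := fun i =>
    preDisc_mono ε (Set.subset_iUnion S i) (Set.subset_iUnion T i) (hF i)
  -- The truncated identity. Having finitely many terms, it factors through a finite power of B.
  set Φ : P →ₗ[𝕜] P := ∑ i, ∑ p ∈ F i, (ω i).val p • (ract 𝕜 B P p.1).comp (G i p.2) with hΦ
  have hΦb : IsBdd Φ := IsBdd.sum _ fun i => IsBdd.sum _ fun p =>
    (((ract_isBddBilin 𝕜 B P).right p.1).comp ((hG i).right p.2)).smul _
  have hΦB : ∀ t b, Φ (ract 𝕜 B P t b) = ract 𝕜 B P (Φ t) b := fun t b => by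
    simp only [hΦ, LinearMap.sum_apply, LinearMap.smul_apply, LinearMap.comp_apply, hGB, ract_mul,
      map_sum, map_smul]
  set R : Module.End 𝕜 P := LinearMap.id - Φ with hR
  have hRb : IsBdd R := by
    rw [hR, sub_eq_add_neg, ← neg_one_smul 𝕜]
    exact isBdd_id.add (hΦb.smul _)
  have hRB : ∀ t b, R (ract 𝕜 B P t b) = ract 𝕜 B P (R t) b := fun t b => by
    simp only [hR, LinearMap.sub_apply, LinearMap.id_apply, hΦB, map_sub]
  -- The whole series sums to the identity, so R is what the tails contribute.
  have hRt : ∀ t, R t = ∑ i, PreTensor.lift ((ract 𝕜 B P).compl₂ ((G i).flip t))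
      ((ract_isBddBilin 𝕜 B P).compl₂ ((hG i).left t)) (tail i) := fun t => by
    simp only [htail, map_sub, map_sum, map_smul, PreTensor.lift_delta, Finset.sum_sub_distrib, hω]
    simp [hR, hΦ]
  have hRN : ∀ N : ℕ, IsBdd (R ^ N) ∧
      ∀ t b, (R ^ N) (ract 𝕜 B P t b) = ract 𝕜 B P ((R ^ N) t) b := by
    intro N
    induction N with
    | zero => exact ⟨by rw [pow_zero]; exact isBdd_id, fun t b => rfl⟩
    | succ N ih =>
      refine ⟨by rw [pow_succ]; exact ih.1.comp hRb, fun t b => ?_⟩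
      rw [pow_succ, Module.End.mul_apply, Module.End.mul_apply, hRB, ih.2]
  -- The cost of one application of R: n comes from the sum over i and 2ε from
  -- `PreTensor.map_lift_mem`. The map Λ stands for the operations still to be applied, so that a
  -- bound on words of length N gives one on words of length N + 1.
  have est : ∀ (Λ : P →ₗ[𝕜] P), IsBdd Λ → ∀ K : Set P, Bornology.IsBounded K → IsCompletant 𝕜 K →
      ∀ (t : P) (a : ℝ), 0 < a →
      (∀ i, ∀ p ∈ S', ∀ y ∈ T', Λ (ract 𝕜 B P p (G i y t)) ∈ ((a : ℝ) : 𝕜) • K) →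
      Λ (R t) ∈ ((n * (2 * ε * a) : ℝ) : 𝕜) • K := by
    intro Λ hΛ K hKb hK t a ha h
    rw [hRt, map_sum]
    have := hK.toIsDisc.finset_sum_mem (a := 2 * ε * a) (by positivity) Finset.univ _ fun i =>
      PreTensor.map_lift_mem _ ((ract_isBddBilin 𝕜 B P).compl₂ ((hG i).left t)) Λ hΛ hε hKb hK
        (h i) (htm i)
    rwa [Finset.card_univ, Fintype.card_fin] at this
  obtain ⟨g, hg, hgR⟩ := exists_rightInverse_one_sub hRb fun U hU => by
    set V : Set B := ⋃ i, Set.image2 (fun y p => G i y p) T' U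
    have hV : Bornology.IsBounded V :=
      Bornology.isBounded_iUnion.2 fun i => hG i _ _ hT' hU
    -- V contains the possible last factors G_i(y, t). Adding D V gives a bounded set that contains
    -- V and absorbs multiplication by D from the left.
    set W : Set B := V ∪ D * V
    have hW : Bornology.IsBounded W := hV.union (BornAlgebra.isBounded_mul (𝕜 := 𝕜) _ _ hD hV)
    have hDW : ∀ d ∈ D, ∀ w ∈ W, d * w ∈ W := by
      rintro d hd w (hw | ⟨d', hd', v, hv, rfl⟩)
      · exact Or.inr ⟨d, hd, w, hw, rfl⟩
      · exact Or.inr ⟨d * d', hDm d hd d' hd', v, hv, mul_assoc _ _ _⟩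
    obtain ⟨K, hSK, hKb, hK⟩ := CompleteBVS.exists_completant (𝕜 := 𝕜) _
      ((ract_isBddBilin 𝕜 B P S' W hS' hW).union hU)
    refine ⟨K, hKb, hK, ?_⟩
    -- Words whose innermost vector lies in S', multiplied by an element of W. Keeping w arbitrary
    -- in W lets the induction move inner factors from D into w.
    have step : ∀ (N : ℕ), ∀ p ∈ S', ∀ w ∈ W,
        ract 𝕜 B P ((R ^ N) p) w ∈ (((1 / 2 : ℝ) ^ N : ℝ) : 𝕜) • K := by
      intro N
      induction N with
      | zero =>
        intro p hp w hw
        exact ⟨_, hSK (Or.inl ⟨p, hp, w, hw, rfl⟩), by simp⟩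
      | succ N ih =>
        intro p hp w hw
        -- Here R^N(q · G_i(y, p)) w = R^N(q) · (G_i(y, p) w). Since G_i(y, p) = r d with d in D and
        -- d w is again in W, the induction hypothesis applies at the price of r.
        have := est (((ract 𝕜 B P).flip w).comp (R ^ N))
          (((ract_isBddBilin 𝕜 B P).left w).comp (hRN N).1) K hKb hK p (r * (1 / 2 : ℝ) ^ N)
          (by positivity) fun i q hq y hy => by
            obtain ⟨d, hd, e⟩ := hDr (Set.mem_iUnion.2 ⟨i, y, hy, p, hp, rfl⟩)
            obtain ⟨k, hk, e'⟩ := ih q hq _ (hDW d hd w hw)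
            refine ⟨k, hk, ?_⟩
            simp only at e e'
            simp only [LinearMap.comp_apply, LinearMap.flip_apply, (hRN N).2, ← ract_mul, ← e,
              map_smul, ← e', smul_smul]
            push_cast
            rfl
        rw [pow_succ R, Module.End.mul_apply]
        refine hK.toIsDisc.mono (by positivity) ?_ this
        rw [pow_succ]
        have h0 : (0 : ℝ) < (1 / 2) ^ N := by positivity
        nlinarith
    intro t ht N
    rcases N with _ | N
    · exact ⟨t, hSK (Or.inr ht), by simp⟩
    -- The last factor G_i(y, t) involves t, so it need not lie in r D, but it lies in V ⊆ W. No
    -- factor r arises, and the first bound on ε suffices.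
    · have := est (R ^ N) (hRN N).1 K hKb hK t ((1 / 2 : ℝ) ^ N) (by positivity)
        fun i q hq y hy => by
          rw [(hRN N).2]
          exact step N q hq _ (Or.inl (Set.mem_iUnion.2 ⟨i, y, hy, t, ht, rfl⟩))
      rw [pow_succ R, Module.End.mul_apply]
      refine hK.toIsDisc.mono (by positivity) ?_ this
      rw [pow_succ]
      have h0 : (0 : ℝ) < (1 / 2) ^ N := by positivity
      nlinarith
  have hΦg : ∀ t, Φ (g t) = t := fun t => by
    have := hgR t
    simpa [hR] using this
  -- There is one generator for each retained term: its vector p. The coordinates of the section are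
  -- the corresponding scalars times G_i(y, g x), placed in B inside the unitalization.
  let J := Σ i : Fin n, {p // p ∈ F i}
  let e := Fintype.equivFin J
  let s : J → P →ₗ[𝕜] Plus 𝕜 B := fun j =>
    (ω j.1).val j.2.1 • (LinearMap.inr 𝕜 𝕜 B ∘ₗ G j.1 j.2.1.2 ∘ₗ g)
  have hs : ∀ j, IsBdd (s j) := fun j => by
    have h : s j = LinearMap.inr 𝕜 𝕜 B ∘ₗ ((ω j.1).val j.2.1 • (G j.1 j.2.1.2 ∘ₗ g)) :=
      (LinearMap.comp_smul _ _ _).symm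
    rw [h]
    exact inr_isBdd.comp ((((hG j.1).right _).comp hg).smul _)
  refine ⟨Fintype.card J, fun k => (e.symm k).2.1.1, LinearMap.pi fun k => s (e.symm k),
    fun U hU => ?_, fun x => ?_⟩
  · refine Bornology.forall_isBounded_image_eval_iff.1 fun k => ?_
    rw [← Set.image_comp]
    exact hs (e.symm k) U hU
  · simp only [LinearMap.pi_apply]
    rw [e.symm.sum_comp (fun j : J => ractPlus 𝕜 B P j.2.1.1 (s j x)), Fintype.sum_sigma]
    conv_rhs => rw [← hΦg x]
    simp only [hΦ, LinearMap.sum_apply, LinearMap.smul_apply, LinearMap.comp_apply]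
    refine Finset.sum_congr rfl fun i _ => ?_
    rw [← Finset.sum_coe_sort (F i)]
    refine Finset.sum_congr rfl fun p _ => ?_
    simp [s, ractPlus]

end FinGen

/-! ### Tensor lifts that depend on a parameter, and inverses of bornological isomorphisms. -/

section Trilinear

set_option linter.unusedSectionVars false

variable {𝕜 : Type*} [RCLike 𝕜] {V W W' M N Z Z' : Type*}
  [AddCommGroup V] [Module 𝕜 V] [Bornology V] [AddCommGroup W] [Module 𝕜 W] [Bornology W]
  [AddCommGroup W'] [Module 𝕜 W'] [Bornology W']
  [AddCommGroup M] [Module 𝕜 M] [Bornology M] [AddCommGroup N] [Module 𝕜 N] [Bornology N]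
  [AddCommGroup Z] [Module 𝕜 Z] [Bornology Z] [AddCommGroup Z'] [Module 𝕜 Z'] [Bornology Z']

/-- A trilinear map is bounded if it sends products of bounded sets to bounded sets. -/
def IsBddTrilin (f : W →ₗ[𝕜] M →ₗ[𝕜] N →ₗ[𝕜] Z) : Prop :=
  ∀ (U : Set W) (S : Set M) (T : Set N), Bornology.IsBounded U → Bornology.IsBounded S →
    Bornology.IsBounded T → Bornology.IsBounded {z | ∃ w ∈ U, ∃ m ∈ S, ∃ n ∈ T, f w m n = z}

theorem IsBddTrilin.apply {f : W →ₗ[𝕜] M →ₗ[𝕜] N →ₗ[𝕜] Z} (hf : IsBddTrilin f) (w : W) :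
    IsBddBilin (f w) := fun S T hS hT =>
  (hf {w} S T Bornology.isBounded_singleton hS hT).subset (by
    rintro _ ⟨m, hm, n, hn, rfl⟩; exact ⟨w, rfl, m, hm, n, hn, rfl⟩)

theorem IsBddBilin.compr₂_trilin {f : V →ₗ[𝕜] W →ₗ[𝕜] M} (hf : IsBddBilin f)
    {g : M →ₗ[𝕜] N →ₗ[𝕜] Z} (hg : IsBddBilin g) : IsBddTrilin (f.compr₂ g) :=
  fun U S T hU hS hT => (hg _ T (hf U S hU hS) hT).subset (by
    rintro _ ⟨v, hv, w, hw, n, hn, rfl⟩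
    exact ⟨_, ⟨v, hv, w, hw, rfl⟩, n, hn, rfl⟩)

theorem IsBddBilin.compr₂ {f : V →ₗ[𝕜] W →ₗ[𝕜] M} (hf : IsBddBilin f) {g : M →ₗ[𝕜] Z}
    (hg : IsBdd g) : IsBddBilin (f.compr₂ g) :=
  fun S T hS hT => (hg _ (hf S T hS hT)).subset (by
    rintro _ ⟨v, hv, w, hw, rfl⟩
    exact ⟨_, ⟨v, hv, w, hw, rfl⟩, rfl⟩)

theorem IsBddBilin.comp {f : V →ₗ[𝕜] W →ₗ[𝕜] Z} (hf : IsBddBilin f) {g : M →ₗ[𝕜] V}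
    (hg : IsBdd g) : IsBddBilin (f.comp g) :=
  fun S T hS hT => (hf _ T (hg S hS) hT).subset (by
    rintro _ ⟨v, hv, w, hw, rfl⟩
    exact ⟨_, ⟨v, hv, rfl⟩, w, hw, rfl⟩)

theorem IsBddBilin.flip {f : V →ₗ[𝕜] W →ₗ[𝕜] Z} (hf : IsBddBilin f) : IsBddBilin f.flip :=
  fun S T hS hT => (hf T S hT hS).subset (by
    rintro _ ⟨v, hv, w, hw, rfl⟩
    exact ⟨w, hw, v, hv, rfl⟩)

/-- The trilinear map `(w, v, u) ↦ f (v, g (w, u))`. -/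
def compRight (f : V →ₗ[𝕜] M →ₗ[𝕜] Z) (g : W →ₗ[𝕜] N →ₗ[𝕜] M) :
    W →ₗ[𝕜] V →ₗ[𝕜] N →ₗ[𝕜] Z where
  toFun w := f.compl₂ (g w)
  map_add' w w' := by ext; simp
  map_smul' k w := by ext; simp

theorem compRight_apply (f : V →ₗ[𝕜] M →ₗ[𝕜] Z) (g : W →ₗ[𝕜] N →ₗ[𝕜] M) (w : W) (v : V) (n : N) :
    compRight f g w v n = f v (g w n) := rfl

theorem compRight_isBddTrilin {f : V →ₗ[𝕜] M →ₗ[𝕜] Z} {g : W →ₗ[𝕜] N →ₗ[𝕜] M}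
    (hf : IsBddBilin f) (hg : IsBddBilin g) : IsBddTrilin (compRight f g) :=
  fun U S T hU hS hT => (hf S _ hS (hg U T hU hT)).subset (by
    rintro _ ⟨w, hw, v, hv, n, hn, rfl⟩
    exact ⟨v, hv, _, ⟨w, hw, n, hn, rfl⟩, rfl⟩)

variable [CompleteBVS 𝕜 Z]

/-- The bounded bilinear map on `W × (M ⊗ N)` induced by a bounded trilinear map. -/
noncomputable def CTensor.liftParam (f : W →ₗ[𝕜] M →ₗ[𝕜] N →ₗ[𝕜] Z) (hf : IsBddTrilin f) :
    W →ₗ[𝕜] CTensor 𝕜 M N →ₗ[𝕜] Z where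
  toFun w := CTensor.lift (f w) (hf.apply w)
  map_add' w w' := CTensor.ext (CTensor.lift_isBdd _ _)
    ((CTensor.lift_isBdd _ _).add (CTensor.lift_isBdd _ _)) fun m n => by
      simp only [LinearMap.add_apply, CTensor.lift_tmul, map_add]
  map_smul' k w := CTensor.ext (CTensor.lift_isBdd _ _)
    ((CTensor.lift_isBdd _ _).smul k) fun m n => by
      simp only [LinearMap.smul_apply, CTensor.lift_tmul, map_smul, RingHom.id_apply]

theorem CTensor.liftParam_tmul (f : W →ₗ[𝕜] M →ₗ[𝕜] N →ₗ[𝕜] Z) (hf : IsBddTrilin f)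
    (w : W) (m : M) (n : N) : CTensor.liftParam f hf w (CTensor.tmul m n) = f w m n :=
  CTensor.lift_tmul _ _ m n

/-- Boundedness is joint because a single completant disc containing f(U, S, T) serves for every
parameter in U. -/
theorem CTensor.liftParam_isBddBilin (f : W →ₗ[𝕜] M →ₗ[𝕜] N →ₗ[𝕜] Z) (hf : IsBddTrilin f) :
    IsBddBilin (CTensor.liftParam f hf) := by
  intro U C hU hC
  obtain ⟨S, T, r, hS, hT, h'⟩ := CTensor.isBounded_iff.1 hC
  obtain ⟨D, hSD, hDb, hD⟩ := CompleteBVS.exists_completant (𝕜 := 𝕜) _ (hf U S T hU hS hT)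
  refine (CompleteBVS.isBounded_smul ((r + 1 : ℝ) : 𝕜) D hDb).subset ?_
  rintro _ ⟨w, hw, t, ht, rfl⟩
  obtain ⟨c, hc, rfl⟩ := h' ht
  exact PreTensor.lift_mem (f w) (hf.apply w) hDb hD (by
    rintro _ ⟨m, hm, n, hn, rfl⟩; exact hSD ⟨w, hw, m, hm, n, hn, rfl⟩) hc

variable (𝕜) in
/-- Two bounded bilinear maps on `W × (M ⊗ N)` that agree on elementary tensors are equal. -/
theorem CTensor.ext_param {f g : W →ₗ[𝕜] CTensor 𝕜 M N →ₗ[𝕜] Z} (hf : IsBddBilin f)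
    (hg : IsBddBilin g) (H : ∀ w m n, f w (CTensor.tmul m n) = g w (CTensor.tmul m n)) (w : W)
    (t : CTensor 𝕜 M N) : f w t = g w t :=
  LinearMap.congr_fun (CTensor.ext (hf.right w) (hg.right w) (H w)) t

variable {A : Type*} [NonUnitalRing A] [Module 𝕜 A] [Bornology A]
  [BornRightModule 𝕜 A M] [BornLeftModule 𝕜 A N]

variable (A) in
/-- The bounded bilinear map on `W × (M ⊗_A N)` induced by a bounded balanced trilinear map. -/
noncomputable def BTensor.liftParam (f : W →ₗ[𝕜] M →ₗ[𝕜] N →ₗ[𝕜] Z) (hf : IsBddTrilin f)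
    (hbal : ∀ w m a n, f w (ract 𝕜 A M m a) n = f w m (lact 𝕜 A N a n)) :
    W →ₗ[𝕜] BTensor 𝕜 A M N →ₗ[𝕜] Z where
  toFun w := BTensor.lift 𝕜 A (f w) (hf.apply w) (hbal w)
  map_add' w w' := BTensor.ext 𝕜 A (BTensor.lift_isBdd 𝕜 A _ _ _)
    ((BTensor.lift_isBdd 𝕜 A _ _ _).add (BTensor.lift_isBdd 𝕜 A _ _ _)) fun m n => by
      simp only [LinearMap.add_apply, BTensor.lift_tmul, map_add]
  map_smul' k w := BTensor.ext 𝕜 A (BTensor.lift_isBdd 𝕜 A _ _ _)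
    ((BTensor.lift_isBdd 𝕜 A _ _ _).smul k) fun m n => by
      simp only [LinearMap.smul_apply, BTensor.lift_tmul, map_smul, RingHom.id_apply]

theorem BTensor.liftParam_tmul (f : W →ₗ[𝕜] M →ₗ[𝕜] N →ₗ[𝕜] Z) (hf : IsBddTrilin f)
    (hbal : ∀ w m a n, f w (ract 𝕜 A M m a) n = f w m (lact 𝕜 A N a n))
    (w : W) (m : M) (n : N) :
    BTensor.liftParam A f hf hbal w (BTensor.tmul 𝕜 A M N m n) = f w m n :=
  BTensor.lift_tmul 𝕜 A _ _ (hbal w) m n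

theorem BTensor.liftParam_isBddBilin (f : W →ₗ[𝕜] M →ₗ[𝕜] N →ₗ[𝕜] Z) (hf : IsBddTrilin f)
    (hbal : ∀ w m a n, f w (ract 𝕜 A M m a) n = f w m (lact 𝕜 A N a n)) :
    IsBddBilin (BTensor.liftParam A f hf hbal) := fun U C hU hC =>
  (BTensor.lift_equibdd 𝕜 A (fun w => f w) (fun w => hf.apply w) hbal U
    (fun S T hS hT => hf U S T hU hS hT) C hC).subset (by
      rintro _ ⟨w, hw, t, ht, rfl⟩; exact ⟨w, hw, t, ht, rfl⟩)

theorem IsBornIso.exists_inverse {f : V →ₗ[𝕜] W} (hf : IsBornIso f) :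
    ∃ g : W →ₗ[𝕜] V, IsBdd g ∧ (∀ v, g (f v) = v) ∧ ∀ w, f (g w) = w := by
  let e := LinearEquiv.ofBijective f hf.1
  refine ⟨e.symm, fun S hS => (hf.2 _).1 ?_, e.symm_apply_apply, e.apply_symm_apply⟩
  have : f '' (e.symm '' S) = S := e.image_symm_image S
  change Bornology.IsBounded (f '' (e.symm '' S))
  rwa [this]

theorem IsBornIso.of_inverse {f : V →ₗ[𝕜] W} (hf : IsBdd f) {g : W →ₗ[𝕜] V} (hg : IsBdd g)
    (h : ∀ v, g (f v) = v) (h' : ∀ w, f (g w) = w) : IsBornIso f := by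
  refine ⟨⟨Function.LeftInverse.injective h, Function.RightInverse.surjective h'⟩,
    fun S => ⟨fun hS => ?_, hf S⟩⟩
  have := hg _ hS
  rwa [← Set.image_comp, show (g ∘ f) = id from funext h, Set.image_id] at this

end Trilinear

/-! ### Module structures on completed tensor products. -/

section TensorModules

variable {𝕜 : Type*} [RCLike 𝕜]
  {A : Type*} [NonUnitalRing A] [Module 𝕜 A] [Bornology A]
  {B : Type*} [NonUnitalRing B] [Module 𝕜 B] [Bornology B]
  {M : Type*} [AddCommGroup M] [Module 𝕜 M] [Bornology M]
  {X : Type*} [AddCommGroup X] [Module 𝕜 X] [Bornology X]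

theorem BTensor.ract_tmul [BornRightModule 𝕜 A M] [BornLeftModule 𝕜 A X] [BornRightModule 𝕜 B X]
    [IsBimodule 𝕜 A B X] (m : M) (x : X) (b : B) :
    ract 𝕜 B (BTensor 𝕜 A M X) (BTensor.tmul 𝕜 A M X m x) b
      = BTensor.tmul 𝕜 A M X m (ract 𝕜 B X x b) :=
  BTensor.rightMul_tmul b m x

theorem BTensor.lact_tmul [BornRightModule 𝕜 A M] [BornLeftModule 𝕜 A X] [BornLeftModule 𝕜 B M]
    [IsBimodule 𝕜 B A M] (m : M) (x : X) (b : B) :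
    lact 𝕜 B (BTensor 𝕜 A M X) b (BTensor.tmul 𝕜 A M X m x)
      = BTensor.tmul 𝕜 A M X (lact 𝕜 B M b m) x :=
  BTensor.leftMul_tmul b m x

/-- The left action of `B` on `M ⊗ X` through `M`. -/
noncomputable def CTensor.leftAct [BornLeftModule 𝕜 B M] :
    B →ₗ[𝕜] CTensor 𝕜 M X →ₗ[𝕜] CTensor 𝕜 M X :=
  CTensor.liftParam ((lact 𝕜 B M).compr₂ CTensor.tmul)
    ((lact_isBddBilin 𝕜 B M).compr₂_trilin CTensor.tmul_isBddBilin)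

theorem CTensor.leftAct_tmul [BornLeftModule 𝕜 B M] (b : B) (m : M) (x : X) :
    CTensor.leftAct b (CTensor.tmul (𝕜 := 𝕜) m x) = CTensor.tmul (lact 𝕜 B M b m) x :=
  CTensor.liftParam_tmul ((lact 𝕜 B M).compr₂ CTensor.tmul)
    ((lact_isBddBilin 𝕜 B M).compr₂_trilin CTensor.tmul_isBddBilin) b m x

theorem CTensor.leftAct_isBddBilin [BornLeftModule 𝕜 B M] :
    IsBddBilin (CTensor.leftAct (𝕜 := 𝕜) (B := B) (M := M) (X := X)) :=
  CTensor.liftParam_isBddBilin _ _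

/-- The right action of `B` on `M ⊗ X` through `X`. -/
noncomputable def CTensor.rightAct [BornRightModule 𝕜 B X] :
    CTensor 𝕜 M X →ₗ[𝕜] B →ₗ[𝕜] CTensor 𝕜 M X :=
  (CTensor.liftParam (compRight CTensor.tmul (ract 𝕜 B X).flip)
    (compRight_isBddTrilin CTensor.tmul_isBddBilin (ract_isBddBilin 𝕜 B X).flip)).flip

theorem CTensor.rightAct_tmul [BornRightModule 𝕜 B X] (b : B) (m : M) (x : X) :
    CTensor.rightAct (CTensor.tmul (𝕜 := 𝕜) m x) b = CTensor.tmul m (ract 𝕜 B X x b) :=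
  CTensor.liftParam_tmul (compRight CTensor.tmul (ract 𝕜 B X).flip)
    (compRight_isBddTrilin CTensor.tmul_isBddBilin (ract_isBddBilin 𝕜 B X).flip) b m x

theorem CTensor.rightAct_isBddBilin [BornRightModule 𝕜 B X] :
    IsBddBilin (CTensor.rightAct (𝕜 := 𝕜) (B := B) (M := M) (X := X)) :=
  (CTensor.liftParam_isBddBilin _ _).flip

/-- With M = B this is the left module B ⊗ X, against whose multiplication map to X projectivity of
X is tested. -/
noncomputable instance CTensor.bornLeftModule [BornLeftModule 𝕜 B M] :
    BornLeftModule 𝕜 B (CTensor 𝕜 M X) where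
  act := CTensor.leftAct
  mul_act a b t := by
    refine LinearMap.congr_fun (CTensor.ext (h := CTensor.leftAct a ∘ₗ CTensor.leftAct b)
      (CTensor.leftAct_isBddBilin.right _) ((CTensor.leftAct_isBddBilin.right a).comp
        (CTensor.leftAct_isBddBilin.right b)) fun m x => ?_) t
    simp only [LinearMap.comp_apply, CTensor.leftAct_tmul, mul_lact]
  act_unit e he t := by
    refine LinearMap.congr_fun (CTensor.ext (h := LinearMap.id)
      (CTensor.leftAct_isBddBilin.right e) isBdd_id fun m x => ?_) t
    rw [CTensor.leftAct_tmul, LinearMap.id_apply]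
    exact congrArg (fun m => CTensor.tmul m x) (BornLeftModule.act_unit e he m)
  act_isBdd := CTensor.leftAct_isBddBilin

noncomputable instance CTensor.bornRightModule [BornRightModule 𝕜 B X] :
    BornRightModule 𝕜 B (CTensor 𝕜 M X) where
  act := CTensor.rightAct
  act_mul t a b := by
    refine LinearMap.congr_fun (CTensor.ext (g := CTensor.rightAct.flip (a * b))
      (h := CTensor.rightAct.flip b ∘ₗ CTensor.rightAct.flip a)
      (CTensor.rightAct_isBddBilin.left _) ((CTensor.rightAct_isBddBilin.left b).comp
        (CTensor.rightAct_isBddBilin.left a)) fun m x => ?_) t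
    simp only [LinearMap.comp_apply, LinearMap.flip_apply, CTensor.rightAct_tmul, ract_mul]
  act_unit e he t := by
    refine LinearMap.congr_fun (CTensor.ext (g := CTensor.rightAct.flip e) (h := LinearMap.id)
      (CTensor.rightAct_isBddBilin.left e) isBdd_id fun m x => ?_) t
    rw [LinearMap.flip_apply, CTensor.rightAct_tmul, LinearMap.id_apply]
    exact congrArg (CTensor.tmul m) (BornRightModule.act_unit e he x)
  act_isBdd := CTensor.rightAct_isBddBilin

theorem CTensor.lact_tmul [BornLeftModule 𝕜 B M] (b : B) (m : M) (x : X) :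
    lact 𝕜 B (CTensor 𝕜 M X) b (CTensor.tmul m x) = CTensor.tmul (lact 𝕜 B M b m) x :=
  CTensor.leftAct_tmul b m x

theorem CTensor.ract_tmul [BornRightModule 𝕜 B X] (b : B) (m : M) (x : X) :
    ract 𝕜 B (CTensor 𝕜 M X) (CTensor.tmul m x) b = CTensor.tmul m (ract 𝕜 B X x b) :=
  CTensor.rightAct_tmul b m x

theorem CTensor.map_tmul {M' X' : Type*} [AddCommGroup M'] [Module 𝕜 M'] [Bornology M']
    [AddCommGroup X'] [Module 𝕜 X'] [Bornology X']
    (g : M →ₗ[𝕜] M') (hg : IsBdd g) (h : X →ₗ[𝕜] X') (hh : IsBdd h) (m : M) (x : X) :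
    CTensor.map g hg h hh (CTensor.tmul m x) = CTensor.tmul (g m) (h x) :=
  CTensor.lift_tmul _ _ m x

theorem CTensor.map_isBdd {M' X' : Type*} [AddCommGroup M'] [Module 𝕜 M'] [Bornology M']
    [AddCommGroup X'] [Module 𝕜 X'] [Bornology X']
    (g : M →ₗ[𝕜] M') (hg : IsBdd g) (h : X →ₗ[𝕜] X') (hh : IsBdd h) :
    IsBdd (CTensor.map g hg h hh) :=
  CTensor.lift_isBdd _ _

end TensorModules

/-! ### Essential modules, sections of multiplication maps and dual bases. -/

section Sections

variable {𝕜 : Type} [RCLike 𝕜] {B : Type u} [NonUnitalRing B] [Module 𝕜 B] [Bornology B]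
  [BornAlgebra 𝕜 B] {Y : Type u} [AddCommGroup Y] [Module 𝕜 Y] [Bornology Y] [CompleteBVS 𝕜 Y]

/-- A substitute for a unit in B: Y is a quotient of Y ⊗_B B, and there bounded maps are determined
by elementary tensors. Identities between bounded maps on Y thus need checking only on products y b.
-/
theorem IsEssentialRight.ext [BornRightModule 𝕜 B Y] (h : IsEssentialRight 𝕜 B Y) {Z : Type*}
    [AddCommGroup Z] [Module 𝕜 Z] [Bornology Z] [CompleteBVS 𝕜 Z] {f g : Y →ₗ[𝕜] Z}
    (hf : IsBdd f) (hg : IsBdd g) (H : ∀ y b, f (ract 𝕜 B Y y b) = g (ract 𝕜 B Y y b)) (y : Y) :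
    f y = g y := by
  obtain ⟨t, rfl⟩ := h.1.2 y
  refine LinearMap.congr_fun (BTensor.ext 𝕜 B (g := f ∘ₗ _) (h := g ∘ₗ _)
    (hf.comp (BTensor.lift_isBdd 𝕜 B _ _ _)) (hg.comp (BTensor.lift_isBdd 𝕜 B _ _ _))
    fun y b => ?_) t
  simp only [LinearMap.comp_apply, BTensor.lift_tmul, H]

/-- A bounded balanced bilinear map on `Y × B` factors through the action on an essential right
module `Y`. -/
theorem IsEssentialRight.exists_lift [BornRightModule 𝕜 B Y] (h : IsEssentialRight 𝕜 B Y)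
    {Z : Type*} [AddCommGroup Z] [Module 𝕜 Z] [Bornology Z] [CompleteBVS 𝕜 Z]
    {f : Y →ₗ[𝕜] B →ₗ[𝕜] Z} (hf : IsBddBilin f)
    (hbal : ∀ y b b', f (ract 𝕜 B Y y b) b' = f y (b * b')) :
    ∃ g : Y →ₗ[𝕜] Z, IsBdd g ∧ ∀ y b, g (ract 𝕜 B Y y b) = f y b := by
  obtain ⟨i, hi, hl, -⟩ := IsBornIso.exists_inverse h
  refine ⟨BTensor.lift 𝕜 B f hf hbal ∘ₗ i, (BTensor.lift_isBdd 𝕜 B _ _ _).comp hi, fun y b => ?_⟩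
  have := hl (BTensor.tmul 𝕜 B Y B y b)
  rw [BTensor.lift_tmul] at this
  rw [LinearMap.comp_apply, this]
  exact BTensor.lift_tmul 𝕜 B _ _ _ _ _

theorem IsEssentialLeft.ext [BornLeftModule 𝕜 B Y] (h : IsEssentialLeft 𝕜 B Y) {Z : Type*}
    [AddCommGroup Z] [Module 𝕜 Z] [Bornology Z] [CompleteBVS 𝕜 Z] {f g : Y →ₗ[𝕜] Z}
    (hf : IsBdd f) (hg : IsBdd g) (H : ∀ b y, f (lact 𝕜 B Y b y) = g (lact 𝕜 B Y b y)) (y : Y) :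
    f y = g y := by
  obtain ⟨t, rfl⟩ := h.1.2 y
  refine LinearMap.congr_fun (BTensor.ext 𝕜 B (g := f ∘ₗ _) (h := g ∘ₗ _)
    (hf.comp (BTensor.lift_isBdd 𝕜 B _ _ _)) (hg.comp (BTensor.lift_isBdd 𝕜 B _ _ _))
    fun y b => ?_) t
  simp only [LinearMap.comp_apply, BTensor.lift_tmul, H]

/-- A bounded balanced bilinear map on `B × Y` factors through the action on an essential left
module `Y`. -/
theorem IsEssentialLeft.exists_lift [BornLeftModule 𝕜 B Y] (h : IsEssentialLeft 𝕜 B Y)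
    {Z : Type*} [AddCommGroup Z] [Module 𝕜 Z] [Bornology Z] [CompleteBVS 𝕜 Z]
    {f : B →ₗ[𝕜] Y →ₗ[𝕜] Z} (hf : IsBddBilin f)
    (hbal : ∀ b b' y, f (b * b') y = f b (lact 𝕜 B Y b' y)) :
    ∃ g : Y →ₗ[𝕜] Z, IsBdd g ∧ ∀ b y, g (lact 𝕜 B Y b y) = f b y := by
  obtain ⟨i, hi, hl, -⟩ := IsBornIso.exists_inverse h
  refine ⟨BTensor.lift 𝕜 B f hf hbal ∘ₗ i, (BTensor.lift_isBdd 𝕜 B _ _ _).comp hi, fun b y => ?_⟩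
  have := hl (BTensor.tmul 𝕜 B B Y b y)
  rw [BTensor.lift_tmul] at this
  rw [LinearMap.comp_apply, this]
  exact BTensor.lift_tmul 𝕜 B _ _ _ _ _

/-- The multiplication map `B ⊗ Y → Y` of an essential projective left module over a quasi-unital
algebra has a bounded `B`-linear section. -/
theorem IsProjectiveLeft.exists_section (hB : IsQuasiUnital 𝕜 B) [BornLeftModule 𝕜 B Y]
    (he : IsEssentialLeft 𝕜 B Y) (hp : IsProjectiveLeft 𝕜 B Y) :
    ∃ τ ∈ HomLeft 𝕜 B Y (CTensor 𝕜 B Y), ∀ y,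
      CTensor.lift (lact 𝕜 B Y) (lact_isBddBilin 𝕜 B Y) (τ y) = y := by
  -- A left module calls for the right-linear section: the formula s(b y) = σ(b) y with (c ⊗ q) y =
  -- c ⊗ q y is balanced because σ(b b') = σ(b) b'. The resulting s is a section of π, but only a
  -- 𝕜-linear one.
  obtain ⟨σ, hσ, hσB, hσs⟩ := hB.right_section
  set π := CTensor.lift (lact 𝕜 B Y) (lact_isBddBilin 𝕜 B Y) with hπ
  have hπb : IsBdd π := CTensor.lift_isBdd _ _
  have hg : IsBddTrilin (compRight (CTensor.tmul (𝕜 := 𝕜) (M := B) (N := Y))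
      (lactPlus 𝕜 B Y).flip) :=
    compRight_isBddTrilin CTensor.tmul_isBddBilin lactPlus_isBddBilin.flip
  set L := CTensor.liftParam _ hg with hL
  have hLb : IsBddBilin L := CTensor.liftParam_isBddBilin _ hg
  obtain ⟨s, hs, hsL⟩ := he.exists_lift (f := L.flip.comp σ) (hLb.flip.comp hσ) fun b b' y => by
    simp only [LinearMap.comp_apply, LinearMap.flip_apply, hσB]
    refine CTensor.ext_param 𝕜 (f := L.compl₂ (CTensor.map LinearMap.id isBdd_id
      (mulRightPlus 𝕜 B b') (mulRightPlus_isBdd b'))) (g := L.comp (lact 𝕜 B Y b'))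
      (hLb.compl₂ (CTensor.map_isBdd _ _ _ _)) (hLb.comp ((lact_isBddBilin 𝕜 B Y).right b'))
      (fun y c q => ?_) y (σ b)
    simp only [LinearMap.compl₂_apply, LinearMap.comp_apply, CTensor.map_tmul, hL,
      CTensor.liftParam_tmul, compRight_apply, LinearMap.flip_apply, LinearMap.id_apply]
    simp [lactPlus, mulRightPlus, lact_self, mul_lact]
  have hπs : ∀ y, π (s y) = y := he.ext (g := LinearMap.id) (hπb.comp hs) isBdd_id fun b y => by
    rw [LinearMap.comp_apply, hsL, LinearMap.comp_apply, LinearMap.flip_apply, LinearMap.id_apply]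
    conv_rhs => rw [← hσs b]
    refine CTensor.ext_param 𝕜 (f := L.compr₂ π)
      (g := (lact 𝕜 B Y).flip.compl₂ (CTensor.lift (ractPlus 𝕜 B B) ractPlus_isBddBilin))
      (hLb.compr₂ hπb) ((lact_isBddBilin 𝕜 B Y).flip.compl₂ (CTensor.lift_isBdd _ _))
      (fun y c q => ?_) y (σ b)
    simp only [LinearMap.compr₂_apply, LinearMap.compl₂_apply, LinearMap.flip_apply, hL, hπ,
      CTensor.liftParam_tmul, compRight_apply, CTensor.lift_tmul]
    simp [lactPlus, ractPlus, ract_self, mul_lact]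
  -- Now π is B-linear with a bounded 𝕜-linear section, so projectivity lifts the identity of Y to a
  -- B-linear section.
  obtain ⟨lft, hlft, -⟩ := hp (CTensor 𝕜 B Y) Y π ⟨hπb, fun b t => by
    refine LinearMap.congr_fun (CTensor.ext (g := π ∘ₗ lact 𝕜 B (CTensor 𝕜 B Y) b)
      (h := lact 𝕜 B Y b ∘ₗ π) (hπb.comp ((lact_isBddBilin 𝕜 B _).right b))
      (((lact_isBddBilin 𝕜 B Y).right b).comp hπb) fun c y => ?_) t
    simp only [LinearMap.comp_apply, CTensor.lact_tmul, hπ, CTensor.lift_tmul, lact_self,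
      mul_lact]⟩ ⟨s, hs, hπs⟩
  let i : HomLeft 𝕜 B Y Y := ⟨LinearMap.id, isBdd_id, fun _ _ => rfl⟩
  exact ⟨(lft i).1, (lft i).2, fun y => hlft i y⟩

/-- The multiplication map `Y ⊗ B → Y` of an essential projective right module over a quasi-unital
algebra has a bounded `B`-linear section. -/
theorem IsProjectiveRight.exists_section (hB : IsQuasiUnital 𝕜 B) [BornRightModule 𝕜 B Y]
    (he : IsEssentialRight 𝕜 B Y) (hp : IsProjectiveRight 𝕜 B Y) :
    ∃ τ ∈ HomRight 𝕜 B Y (CTensor 𝕜 Y B), ∀ y,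
      CTensor.lift (ract 𝕜 B Y) (ract_isBddBilin 𝕜 B Y) (τ y) = y := by
  -- The mirror image: s(y b) = y σ(b) with y (q ⊗ c) = y q ⊗ c, balanced by left linearity of σ.
  obtain ⟨σ, hσ, hσB, hσs⟩ := hB.left_section
  set π := CTensor.lift (ract 𝕜 B Y) (ract_isBddBilin 𝕜 B Y) with hπ
  have hπb : IsBdd π := CTensor.lift_isBdd _ _
  have hg : IsBddTrilin ((ractPlus 𝕜 B Y).compr₂ (CTensor.tmul (𝕜 := 𝕜) (M := Y) (N := B))) :=
    ractPlus_isBddBilin.compr₂_trilin CTensor.tmul_isBddBilin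
  set L := CTensor.liftParam _ hg with hL
  have hLb : IsBddBilin L := CTensor.liftParam_isBddBilin _ hg
  obtain ⟨s, hs, hsL⟩ := he.exists_lift (f := L.compl₂ σ) (hLb.compl₂ hσ) fun y b b' => by
    simp only [LinearMap.compl₂_apply, hσB]
    refine CTensor.ext_param 𝕜 (f := L.comp ((ract 𝕜 B Y).flip b))
      (g := L.compl₂ (CTensor.map (mulLeftPlus 𝕜 B b) (mulLeftPlus_isBdd b)
        LinearMap.id isBdd_id))
      (hLb.comp ((ract_isBddBilin 𝕜 B Y).left b)) (hLb.compl₂ (CTensor.map_isBdd _ _ _ _))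
      (fun y q c => ?_) y (σ b')
    simp only [LinearMap.compl₂_apply, LinearMap.comp_apply, CTensor.map_tmul, hL,
      CTensor.liftParam_tmul, LinearMap.compr₂_apply, LinearMap.flip_apply, LinearMap.id_apply]
    simp [ractPlus, mulLeftPlus, ract_self, ract_mul]
  have hπs : ∀ y, π (s y) = y := he.ext (g := LinearMap.id) (hπb.comp hs) isBdd_id fun y b => by
    rw [LinearMap.comp_apply, hsL, LinearMap.compl₂_apply, LinearMap.id_apply]
    conv_rhs => rw [← hσs b]
    refine CTensor.ext_param 𝕜 (f := L.compr₂ π)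
      (g := (ract 𝕜 B Y).compl₂ (CTensor.lift (lactPlus 𝕜 B B) lactPlus_isBddBilin))
      (hLb.compr₂ hπb) ((ract_isBddBilin 𝕜 B Y).compl₂ (CTensor.lift_isBdd _ _))
      (fun y q c => ?_) y (σ b)
    simp only [LinearMap.compr₂_apply, LinearMap.compl₂_apply, hL, hπ,
      CTensor.liftParam_tmul, CTensor.lift_tmul]
    simp [lactPlus, ractPlus, lact_self, ract_mul]
  obtain ⟨lft, hlft, -⟩ := hp (CTensor 𝕜 Y B) Y π ⟨hπb, fun t b => by
    refine LinearMap.congr_fun (CTensor.ext (g := π ∘ₗ (ract 𝕜 B (CTensor 𝕜 Y B)).flip b)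
      (h := (ract 𝕜 B Y).flip b ∘ₗ π) (hπb.comp ((ract_isBddBilin 𝕜 B _).left b))
      (((ract_isBddBilin 𝕜 B Y).left b).comp hπb) fun y c => ?_) t
    simp only [LinearMap.comp_apply, LinearMap.flip_apply, CTensor.ract_tmul, hπ,
      CTensor.lift_tmul, ract_self, ract_mul]⟩ ⟨s, hs, hπs⟩
  let i : HomRight 𝕜 B Y Y := ⟨LinearMap.id, isBdd_id, fun _ _ => rfl⟩
  exact ⟨(lft i).1, (lft i).2, fun y => hlft i y⟩

/-- A finite right module over a quasi-unital algebra has a finite dual basis of `A`-linear maps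
into `A`. -/
theorem IsFiniteRight.exists_dual_basis (hB : IsQuasiUnital 𝕜 B) [BornRightModule 𝕜 B Y]
    (h : IsFiniteRight 𝕜 B Y) : ∃ (n : ℕ) (e : Fin n → Y) (c : Fin n → Y →ₗ[𝕜] B),
      (∀ i, IsBdd (c i)) ∧ (∀ i y b, c i (ract 𝕜 B Y y b) = c i y * b) ∧
      ∀ y, ∑ i, ract 𝕜 B Y (e i) (c i y) = y := by
  obtain ⟨n, e, s, hs, hes⟩ := h.finGen
  obtain ⟨τ, ⟨hτ, hτB⟩, hτs⟩ := h.projective.exists_section hB h.essential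
  have hsi : ∀ i, IsBdd (LinearMap.proj (R := 𝕜) (φ := fun _ : Fin n => Plus 𝕜 B) i ∘ₗ s) :=
    fun i S hS => by
      rw [LinearMap.coe_comp, Set.image_comp]
      exact Bornology.forall_isBounded_image_eval_iff.2 (hs S hS) i
  have hgb := fun i => (lactPlus_isBddBilin (𝕜 := 𝕜) (A := B) (M := B)).comp (hsi i)
  -- The coordinates s_i of the given section are merely 𝕜-linear and take values in the
  -- unitalization. Setting d_i(y ⊗ b) = s_i(y) b repairs both: the values lie in B, and B acts
  -- through the second factor. Composition with the B-linear τ brings the d_i back to Y.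
  set d : Fin n → CTensor 𝕜 Y B →ₗ[𝕜] B := fun i => CTensor.lift _ (hgb i) with hd
  have hdb : ∀ i, IsBdd (d i) := fun i => CTensor.lift_isBdd _ _
  refine ⟨n, e, fun i => d i ∘ₗ τ, fun i => (hdb i).comp hτ, fun i y b => ?_, fun y => ?_⟩
  · rw [LinearMap.comp_apply, LinearMap.comp_apply, hτB, ← ract_self (𝕜 := 𝕜)]
    refine LinearMap.congr_fun (CTensor.ext (g := d i ∘ₗ (ract 𝕜 B (CTensor 𝕜 Y B)).flip b)
      (h := (ract 𝕜 B B).flip b ∘ₗ d i) ((hdb i).comp ((ract_isBddBilin 𝕜 B _).left b))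
      (((ract_isBddBilin 𝕜 B B).left b).comp (hdb i)) fun y c => ?_) (τ y)
    simp only [LinearMap.comp_apply, LinearMap.flip_apply, CTensor.ract_tmul, hd,
      CTensor.lift_tmul]
    simp [lactPlus, ract_self, lact_self, mul_assoc]
  · conv_rhs => rw [← hτs y]
    -- On y ⊗ b this reads ∑ e_i (s_i(y) b) = (∑ e_i s_i(y)) b = y b.
    have key : ∑ i, (ract 𝕜 B Y (e i)) ∘ₗ d i
        = CTensor.lift (ract 𝕜 B Y) (ract_isBddBilin 𝕜 B Y) := by
      refine CTensor.ext (IsBdd.sum _ fun i => ((ract_isBddBilin 𝕜 B Y).right _).comp (hdb i))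
        (CTensor.lift_isBdd _ _) fun y b => ?_
      simp only [LinearMap.sum_apply, LinearMap.comp_apply, hd, CTensor.lift_tmul]
      conv_rhs => rw [← hes y]
      simp [lactPlus, ractPlus, lact_self, ract_mul]
    simpa using LinearMap.congr_fun key (τ y)

end Sections

/-! ### Essentiality of M ⊗_A X and the evaluation pairing. -/

section Context

set_option linter.unusedSectionVars false

variable {𝕜 : Type} [RCLike 𝕜]
  {A : Type u} [NonUnitalRing A] [Module 𝕜 A] [Bornology A] [BornAlgebra 𝕜 A]
  {B : Type u} [NonUnitalRing B] [Module 𝕜 B] [Bornology B] [BornAlgebra 𝕜 B]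
  {X : Type u} [AddCommGroup X] [Module 𝕜 X] [Bornology X] [CompleteBVS 𝕜 X]
  [BornLeftModule 𝕜 A X] [BornRightModule 𝕜 B X] [IsBimodule 𝕜 A B X]
  {Y : Type u} [AddCommGroup Y] [Module 𝕜 Y] [Bornology Y] [CompleteBVS 𝕜 Y]
  [BornLeftModule 𝕜 B Y] [BornRightModule 𝕜 A Y] [IsBimodule 𝕜 B A Y]
  {M : Type u} [AddCommGroup M] [Module 𝕜 M] [Bornology M] [CompleteBVS 𝕜 M]
  [BornRightModule 𝕜 A M]

theorem BTensor.map_ract_of_tmul {N Z : Type*} [AddCommGroup N] [Module 𝕜 N] [Bornology N]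
    [BornRightModule 𝕜 A N] [AddCommGroup Z] [Module 𝕜 Z] [Bornology Z] [CompleteBVS 𝕜 Z]
    [BornRightModule 𝕜 B Z] {f : BTensor 𝕜 A N X →ₗ[𝕜] Z} (hf : IsBdd f)
    (H : ∀ n x b, f (BTensor.tmul 𝕜 A N X n (ract 𝕜 B X x b))
      = ract 𝕜 B Z (f (BTensor.tmul 𝕜 A N X n x)) b) (t : BTensor 𝕜 A N X) (b : B) :
    f (ract 𝕜 B _ t b) = ract 𝕜 B Z (f t) b := by
  refine LinearMap.congr_fun (BTensor.ext 𝕜 A (g := f ∘ₗ (ract 𝕜 B (BTensor 𝕜 A N X)).flip b)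
    (h := (ract 𝕜 B Z).flip b ∘ₗ f) (hf.comp ((ract_isBddBilin 𝕜 B _).left b))
    (((ract_isBddBilin 𝕜 B Z).left b).comp hf) fun n x => ?_) t
  simp only [LinearMap.comp_apply, LinearMap.flip_apply, BTensor.ract_tmul, H]

/-- If `X` is an essential right `B`-module, then so is `M ⊗_A X`. -/
theorem IsEssentialRight.tensor (hX : IsEssentialRight 𝕜 B X) :
    IsEssentialRight 𝕜 B (BTensor 𝕜 A M X) := by
  obtain ⟨i, hi, hl, -⟩ := IsBornIso.exists_inverse hX
  have hib : ∀ x b, i (ract 𝕜 B X x b) = BTensor.tmul 𝕜 B X B x b := fun x b => by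
    have := hl (BTensor.tmul 𝕜 B X B x b)
    rwa [BTensor.lift_tmul] at this
  set P := BTensor 𝕜 A M X
  have hf : IsBddTrilin ((BTensor.tmul 𝕜 A M X).compr₂ (BTensor.tmul 𝕜 B P B)) :=
    (BTensor.tmul_isBddBilin 𝕜 A).compr₂_trilin (BTensor.tmul_isBddBilin 𝕜 B)
  -- J(m, x ⊗ b) = (m ⊗ x) ⊗ b is the associativity map. The inverse of P ⊗_B B → P will be m ⊗ x ↦
  -- J(m, i(x)), where i inverts X ⊗_B B → X.
  set J := BTensor.liftParam B _ hf fun m x b b' => by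
    simp only [LinearMap.compr₂_apply, ← BTensor.ract_tmul]
    exact BTensor.tmul_balanced 𝕜 B _ _ _
  have hJb : IsBddBilin J := BTensor.liftParam_isBddBilin _ _ _
  have hJt : ∀ m x b, J m (BTensor.tmul 𝕜 B X B x b)
      = BTensor.tmul 𝕜 B P B (BTensor.tmul 𝕜 A M X m x) b :=
    fun m x b => BTensor.liftParam_tmul _ hf _ m x b
  have hbal : ∀ m a x, (J.compl₂ i) (ract 𝕜 A M m a) x = (J.compl₂ i) m (lact 𝕜 A X a x) := by
    intro m a x
    -- The map i is explicit only on products, i(x b) = x ⊗ b, so the balancing is checked there.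
    refine hX.ext (f := J.compl₂ i (ract 𝕜 A M m a)) (g := J.compl₂ i m ∘ₗ lact 𝕜 A X a)
      ((hJb.compl₂ hi).right _) (((hJb.compl₂ hi).right _).comp ((lact_isBddBilin 𝕜 A X).right a))
      (fun x b => ?_) x
    simp only [LinearMap.compl₂_apply, LinearMap.comp_apply, ← IsBimodule.assoc, hib, hJt,
      BTensor.tmul_balanced]
  have hg : IsBdd (BTensor.lift 𝕜 A (J.compl₂ i) (hJb.compl₂ hi) hbal) :=
    BTensor.lift_isBdd 𝕜 A _ _ _
  have hgt : ∀ m x b, BTensor.lift 𝕜 A (J.compl₂ i) (hJb.compl₂ hi) hbal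
      (BTensor.tmul 𝕜 A M X m (ract 𝕜 B X x b))
        = BTensor.tmul 𝕜 B P B (BTensor.tmul 𝕜 A M X m x) b := fun m x b => by
    rw [BTensor.lift_tmul, LinearMap.compl₂_apply, hib, hJt]
  set g := BTensor.lift 𝕜 A (J.compl₂ i) (hJb.compl₂ hi) hbal
  have hε : IsBdd (BTensor.lift 𝕜 B (ract 𝕜 B P) (ract_isBddBilin 𝕜 B P) (ract_balanced 𝕜 B P)) :=
    BTensor.lift_isBdd 𝕜 B _ _ _
  refine IsBornIso.of_inverse hε hg (fun t => ?_) fun p => ?_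
  · refine LinearMap.congr_fun (BTensor.ext 𝕜 B (g := g ∘ₗ _) (h := LinearMap.id)
      (hg.comp hε) isBdd_id fun p b => ?_) t
    simp only [LinearMap.comp_apply, BTensor.lift_tmul, LinearMap.id_apply]
    refine LinearMap.congr_fun (BTensor.ext 𝕜 A (g := g ∘ₗ (ract 𝕜 B P).flip b)
      (h := (BTensor.tmul 𝕜 B P B).flip b) (hg.comp ((ract_isBddBilin 𝕜 B P).left b))
      ((BTensor.tmul_isBddBilin 𝕜 B).left b) fun m x => ?_) p
    simp only [LinearMap.comp_apply, LinearMap.flip_apply, P, BTensor.ract_tmul, hgt]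
  · refine LinearMap.congr_fun (BTensor.ext 𝕜 A (g := _ ∘ₗ g) (h := LinearMap.id)
      (hε.comp hg) isBdd_id fun m x => ?_) p
    refine hX.ext (f := (_ ∘ₗ g) ∘ₗ BTensor.tmul 𝕜 A M X m) (g := BTensor.tmul 𝕜 A M X m)
      ((hε.comp hg).comp ((BTensor.tmul_isBddBilin 𝕜 A).right m))
      ((BTensor.tmul_isBddBilin 𝕜 A).right m) (fun x b => ?_) x
    simp only [LinearMap.comp_apply, hgt, BTensor.lift_tmul, P, BTensor.ract_tmul]

section Pairing

variable (ψ : BTensor 𝕜 A Y X →ₗ[𝕜] B) (hψ : IsBdd ψ)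
  (hψl : ∀ b t, ψ (lact 𝕜 B _ b t) = b * ψ t) (hψr : ∀ t b, ψ (ract 𝕜 B _ t b) = ψ t * b)
  (E : Type*) [AddCommGroup E] [Module 𝕜 E] [Bornology E] [CompleteBVS 𝕜 E]
  [BornRightModule 𝕜 B E]

/-- The pairing `(x, e ⊗ y) ↦ e ψ(y ⊗ x)` between `X` and `E ⊗_B Y`. -/
noncomputable def evalPairing : X →ₗ[𝕜] BTensor 𝕜 B E Y →ₗ[𝕜] E :=
  BTensor.liftParam B (compRight (ract 𝕜 B E) ((BTensor.tmul 𝕜 A Y X).compr₂ ψ).flip)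
    (compRight_isBddTrilin (ract_isBddBilin 𝕜 B E)
      ((BTensor.tmul_isBddBilin 𝕜 A).compr₂ hψ).flip)
    fun x e b y => by
      simp only [compRight_apply, LinearMap.flip_apply, LinearMap.compr₂_apply,
        ← BTensor.lact_tmul, hψl, ract_mul]

theorem evalPairing_tmul (x : X) (e : E) (y : Y) :
    evalPairing ψ hψ hψl E x (BTensor.tmul 𝕜 B E Y e y)
      = ract 𝕜 B E e (ψ (BTensor.tmul 𝕜 A Y X y x)) :=
  BTensor.liftParam_tmul _ _ _ x e y

theorem evalPairing_isBddBilin : IsBddBilin (evalPairing ψ hψ hψl E) :=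
  BTensor.liftParam_isBddBilin _ _ _

/-- This is the balancing that lets an A-linear map M → E ⊗_B Y induce a map M ⊗_A X → E. -/
theorem evalPairing_ract (x : X) (t : BTensor 𝕜 B E Y) (a : A) :
    evalPairing ψ hψ hψl E x (ract 𝕜 A _ t a) = evalPairing ψ hψ hψl E (lact 𝕜 A X a x) t := by
  have hb := evalPairing_isBddBilin ψ hψ hψl E
  refine LinearMap.congr_fun (BTensor.ext 𝕜 B (g := evalPairing ψ hψ hψl E x ∘ₗ
    (ract 𝕜 A (BTensor 𝕜 B E Y)).flip a) ((hb.right x).comp ((ract_isBddBilin 𝕜 A _).left a))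
    (hb.right _) fun e y => ?_) t
  simp only [LinearMap.comp_apply, LinearMap.flip_apply, BTensor.ract_tmul, evalPairing_tmul,
    BTensor.tmul_balanced]

include hψr in
-- This makes the map M ⊗_A X → E induced by a map M → E ⊗_B Y linear over B.
theorem evalPairing_ract_left (x : X) (t : BTensor 𝕜 B E Y) (b : B) :
    evalPairing ψ hψ hψl E (ract 𝕜 B X x b) t = ract 𝕜 B E (evalPairing ψ hψ hψl E x t) b := by
  have hb := evalPairing_isBddBilin ψ hψ hψl E
  refine LinearMap.congr_fun (BTensor.ext 𝕜 B (h := (ract 𝕜 B E).flip b ∘ₗ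
    evalPairing ψ hψ hψl E x) (hb.right _) (((ract_isBddBilin 𝕜 B E).left b).comp (hb.right x))
    fun e y => ?_) t
  simp only [LinearMap.comp_apply, LinearMap.flip_apply, evalPairing_tmul, ← ract_mul,
    ← BTensor.ract_tmul, hψr]

end Pairing

end Context

/-! ### The Morita unit, and finite generation and projectivity of M ⊗_A X. -/

section Equivalence

set_option linter.unusedSectionVars false

variable {𝕜 : Type} [RCLike 𝕜]
  {A : Type u} [NonUnitalRing A] [Module 𝕜 A] [Bornology A] [BornAlgebra 𝕜 A]
  {B : Type u} [NonUnitalRing B] [Module 𝕜 B] [Bornology B] [BornAlgebra 𝕜 B]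
  {X : Type u} [AddCommGroup X] [Module 𝕜 X] [Bornology X] [CompleteBVS 𝕜 X]
  [BornLeftModule 𝕜 A X] [BornRightModule 𝕜 B X] [IsBimodule 𝕜 A B X]
  {Y : Type u} [AddCommGroup Y] [Module 𝕜 Y] [Bornology Y] [CompleteBVS 𝕜 Y]
  [BornLeftModule 𝕜 B Y] [BornRightModule 𝕜 A Y] [IsBimodule 𝕜 B A Y]
  {M : Type u} [AddCommGroup M] [Module 𝕜 M] [Bornology M] [CompleteBVS 𝕜 M]
  [BornRightModule 𝕜 A M]

/-- Two isomorphisms `φ : X ⊗_B Y ≃ A` and `ψ : Y ⊗_A X ≃ B` are compatible up to an endomorphism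
of the bimodule `X`. -/
theorem exists_twist (hX : IsEssentialRight 𝕜 B X)
    {φ : BTensor 𝕜 B X Y →ₗ[𝕜] A} (hφ : IsBornIso φ) (hφl : ∀ a t, φ (lact 𝕜 A _ a t) = a * φ t)
    (hφr : ∀ t a, φ (ract 𝕜 A _ t a) = φ t * a)
    {ψ : BTensor 𝕜 A Y X →ₗ[𝕜] B} (hψ : IsBornIso ψ) (hψl : ∀ b t, ψ (lact 𝕜 B _ b t) = b * ψ t)
    (hψr : ∀ t b, ψ (ract 𝕜 B _ t b) = ψ t * b) :
    ∃ θ : X →ₗ[𝕜] X, IsBdd θ ∧ (∀ a x, θ (lact 𝕜 A X a x) = lact 𝕜 A X a (θ x)) ∧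
      (∀ x b, θ (ract 𝕜 B X x b) = ract 𝕜 B X (θ x) b) ∧
      ∀ x y x', θ (ract 𝕜 B X x (ψ (BTensor.tmul 𝕜 A Y X y x')))
        = lact 𝕜 A X (φ (BTensor.tmul 𝕜 B X Y x y)) x' := by
  obtain ⟨ψ', hψ', hl, hr⟩ := hψ.exists_inverse
  have hψ'l : ∀ b c, ψ' (b * c) = lact 𝕜 B _ b (ψ' c) := fun b c => by
    rw [← hl (lact 𝕜 B _ b (ψ' c)), hψl, hr]
  have hψ'r : ∀ c b, ψ' (c * b) = ract 𝕜 B _ (ψ' c) b := fun c b => by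
    rw [← hl (ract 𝕜 B _ (ψ' c) b), hψr, hr]
  have hφb : IsBdd φ := fun S hS => (hφ.2 S).2 hS
  have hf : IsBddTrilin (((BTensor.tmul 𝕜 B X Y).compr₂ φ).compr₂ (lact 𝕜 A X)) :=
    ((BTensor.tmul_isBddBilin 𝕜 B).compr₂ hφb).compr₂_trilin (lact_isBddBilin 𝕜 A X)
  have hfb : ∀ (x : X) (y : Y) (a : A) (x' : X),
      ((BTensor.tmul 𝕜 B X Y).compr₂ φ).compr₂ (lact 𝕜 A X) x (ract 𝕜 A Y y a) x'
        = ((BTensor.tmul 𝕜 B X Y).compr₂ φ).compr₂ (lact 𝕜 A X) x y (lact 𝕜 A X a x') := by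
    intro x y a x'
    simp only [LinearMap.compr₂_apply, ← BTensor.ract_tmul, hφr, mul_lact]
  -- L(x, y ⊗ x') = φ(x ⊗ y) x'. It is B-balanced between x and Y ⊗_A X, so transporting the second
  -- variable along ψ⁻¹ gives a balanced map on X × B.
  set L := BTensor.liftParam A _ hf hfb
  have hLb : IsBddBilin L := BTensor.liftParam_isBddBilin _ _ _
  have hLt : ∀ x y x', L x (BTensor.tmul 𝕜 A Y X y x')
      = lact 𝕜 A X (φ (BTensor.tmul 𝕜 B X Y x y)) x' :=
    fun x y x' => BTensor.liftParam_tmul _ hf hfb x y x'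
  have hLB : ∀ x b t, L (ract 𝕜 B X x b) t = L x (lact 𝕜 B _ b t) := fun x b t => by
    refine LinearMap.congr_fun (BTensor.ext 𝕜 A (h := L x ∘ₗ lact 𝕜 B (BTensor 𝕜 A Y X) b)
      (hLb.right _) ((hLb.right _).comp ((lact_isBddBilin 𝕜 B _).right b)) fun y x' => ?_) t
    simp only [LinearMap.comp_apply, BTensor.lact_tmul, hLt, BTensor.tmul_balanced]
  have hLr : ∀ x t b, L x (ract 𝕜 B _ t b) = ract 𝕜 B X (L x t) b := fun x t b =>
    BTensor.map_ract_of_tmul (hLb.right x) (fun y x' b => by rw [hLt, hLt, IsBimodule.assoc]) t b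
  have hLA : ∀ a x t, L (lact 𝕜 A X a x) t = lact 𝕜 A X a (L x t) := fun a x t => by
    refine LinearMap.congr_fun (BTensor.ext 𝕜 A (h := lact 𝕜 A X a ∘ₗ L x)
      (hLb.right _) (((lact_isBddBilin 𝕜 A X).right a).comp (hLb.right _)) fun y x' => ?_) t
    simp only [LinearMap.comp_apply, hLt, ← BTensor.lact_tmul, hφl, mul_lact]
  -- θ is determined by θ(x b) = L(x, ψ⁻¹(b)), and b = ψ(y ⊗ x') gives the stated relation.
  obtain ⟨θ, hθ, hθL⟩ := hX.exists_lift (hLb.compl₂ hψ') fun x b b' => by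
    simp only [LinearMap.compl₂_apply, hLB, hψ'l]
  simp only [LinearMap.compl₂_apply] at hθL
  refine ⟨θ, hθ, fun a x => ?_, fun x b => ?_, fun x y x' => ?_⟩
  · refine hX.ext (f := θ ∘ₗ lact 𝕜 A X a) (g := lact 𝕜 A X a ∘ₗ θ)
      (hθ.comp ((lact_isBddBilin 𝕜 A X).right a)) (((lact_isBddBilin 𝕜 A X).right a).comp hθ)
      (fun x b => ?_) x
    simp only [LinearMap.comp_apply, ← IsBimodule.assoc, hθL, hLA]
  · refine hX.ext (f := θ ∘ₗ (ract 𝕜 B X).flip b) (g := (ract 𝕜 B X).flip b ∘ₗ θ)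
      (hθ.comp ((ract_isBddBilin 𝕜 B X).left b)) (((ract_isBddBilin 𝕜 B X).left b).comp hθ)
      (fun x c => ?_) x
    simp only [LinearMap.comp_apply, LinearMap.flip_apply, ← ract_mul, hθL, hψ'r, hLr]
  · rw [hθL, hl, hLt]

/-- The unit `M → (M ⊗_A X) ⊗_B Y` of the equivalence, for an essential module `M`. -/
theorem exists_unit (hX : IsEssentialRight 𝕜 B X) (hM : IsEssentialRight 𝕜 A M)
    {φ : BTensor 𝕜 B X Y →ₗ[𝕜] A} (hφ : IsBornIso φ) (hφl : ∀ a t, φ (lact 𝕜 A _ a t) = a * φ t)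
    (hφr : ∀ t a, φ (ract 𝕜 A _ t a) = φ t * a)
    {ψ : BTensor 𝕜 A Y X →ₗ[𝕜] B} (hψ : IsBornIso ψ) (hψb : IsBdd ψ)
    (hψl : ∀ b t, ψ (lact 𝕜 B _ b t) = b * ψ t)
    (hψr : ∀ t b, ψ (ract 𝕜 B _ t b) = ψ t * b) :
    ∃ η ∈ HomRight 𝕜 A M (BTensor 𝕜 B (BTensor 𝕜 A M X) Y), ∀ m x,
      evalPairing ψ hψb hψl (BTensor 𝕜 A M X) x (η m) = BTensor.tmul 𝕜 A M X m x := by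
  obtain ⟨θ, hθ, hθA, hθB, hθψ⟩ := exists_twist hX hφ hφl hφr hψ hψl hψr
  obtain ⟨φ', hφ', hl, hr⟩ := hφ.exists_inverse
  have hφ'l : ∀ a c, φ' (a * c) = lact 𝕜 A _ a (φ' c) := fun a c => by
    rw [← hl (lact 𝕜 A _ a (φ' c)), hφl, hr]
  have hφ'r : ∀ c a, φ' (c * a) = ract 𝕜 A _ (φ' c) a := fun c a => by
    rw [← hl (ract 𝕜 A _ (φ' c) a), hφr, hr]
  have hφb : IsBdd φ := fun S hS => (hφ.2 S).2 hS
  set P := BTensor 𝕜 A M X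
  set κ := evalPairing ψ hψb hψl P with hκ
  have hκb : IsBddBilin κ := evalPairing_isBddBilin _ _ _ _
  have hf : IsBddTrilin (((BTensor.tmul 𝕜 A M X).compl₂ θ).compr₂ (BTensor.tmul 𝕜 B P Y)) :=
    ((BTensor.tmul_isBddBilin 𝕜 A).compl₂ hθ).compr₂_trilin (BTensor.tmul_isBddBilin 𝕜 B)
  have hfb : ∀ (m : M) (x : X) (b : B) (y : Y),
      ((BTensor.tmul 𝕜 A M X).compl₂ θ).compr₂ (BTensor.tmul 𝕜 B P Y) m (ract 𝕜 B X x b) y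
      = ((BTensor.tmul 𝕜 A M X).compl₂ θ).compr₂ (BTensor.tmul 𝕜 B P Y) m x (lact 𝕜 B Y b y) := by
    intro m x b y
    simp only [LinearMap.compr₂_apply, LinearMap.compl₂_apply, hθB, ← BTensor.ract_tmul]
    exact BTensor.tmul_balanced 𝕜 B _ _ _
  -- J(m, x ⊗ y) = (m ⊗ θx) ⊗ y. The twist compensates for the possible incompatibility of φ and ψ.
  set J := BTensor.liftParam B _ hf hfb
  have hJb : IsBddBilin J := BTensor.liftParam_isBddBilin _ _ _
  have hJt : ∀ m x y, J m (BTensor.tmul 𝕜 B X Y x y)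
      = BTensor.tmul 𝕜 B P Y (BTensor.tmul 𝕜 A M X m (θ x)) y :=
    fun m x y => BTensor.liftParam_tmul _ hf hfb m x y
  have hJA : ∀ m a t, J (ract 𝕜 A M m a) t = J m (lact 𝕜 A _ a t) := fun m a t => by
    refine LinearMap.congr_fun (BTensor.ext 𝕜 B (h := J m ∘ₗ lact 𝕜 A (BTensor 𝕜 B X Y) a)
      (hJb.right _) ((hJb.right _).comp ((lact_isBddBilin 𝕜 A _).right a)) fun x y => ?_) t
    simp only [LinearMap.comp_apply, BTensor.lact_tmul, hJt, hθA, BTensor.tmul_balanced]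
  have hJr : ∀ m t a, J m (ract 𝕜 A _ t a) = ract 𝕜 A _ (J m t) a := fun m t a =>
    BTensor.map_ract_of_tmul (hJb.right m) (fun x y b => by rw [hJt, hJt, BTensor.ract_tmul]) t a
  -- η is determined by η(m a) = J(m, φ⁻¹(a)).
  obtain ⟨η, hη, hηJ⟩ := hM.exists_lift (hJb.compl₂ hφ') fun m a a' => by
    simp only [LinearMap.compl₂_apply, hJA, hφ'l]
  simp only [LinearMap.compl₂_apply] at hηJ
  refine ⟨η, ⟨hη, fun m a => ?_⟩, fun m x => ?_⟩
  · refine hM.ext (f := η ∘ₗ (ract 𝕜 A M).flip a) (g := (ract 𝕜 A _).flip a ∘ₗ η)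
      (hη.comp ((ract_isBddBilin 𝕜 A M).left a)) (((ract_isBddBilin 𝕜 A _).left a).comp hη)
      (fun m c => ?_) m
    simp only [LinearMap.comp_apply, LinearMap.flip_apply, ← ract_mul, hηJ, hφ'r, hJr]
  · have hPt : ∀ m x b, ract 𝕜 B P (BTensor.tmul 𝕜 A M X m x) b
        = BTensor.tmul 𝕜 A M X m (ract 𝕜 B X x b) := fun m x b => BTensor.ract_tmul m x b
    -- For t = x' ⊗ y: (m ⊗ θx') ψ(y ⊗ x) = m ⊗ θ(x' ψ(y ⊗ x)) = m ⊗ φ(x' ⊗ y) x. With t = φ⁻¹(a)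
    -- this becomes m ⊗ a x = m a ⊗ x.
    have key : ∀ m t, κ x (J m t) = BTensor.tmul 𝕜 A M X m (lact 𝕜 A X (φ t) x) := fun m t => by
      refine LinearMap.congr_fun (BTensor.ext 𝕜 B (g := κ x ∘ₗ J m)
        (h := BTensor.tmul 𝕜 A M X m ∘ₗ (lact 𝕜 A X).flip x ∘ₗ φ)
        ((hκb.right x).comp (hJb.right m)) (((BTensor.tmul_isBddBilin 𝕜 A).right m).comp
          (((lact_isBddBilin 𝕜 A X).left x).comp hφb)) fun x' y => ?_) t
      simp only [LinearMap.comp_apply, LinearMap.flip_apply, hJt, hκ, evalPairing_tmul,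
        hPt, ← hθB, hθψ]
    refine hM.ext (f := κ x ∘ₗ η) (g := (BTensor.tmul 𝕜 A M X).flip x)
      ((hκb.right x).comp hη) ((BTensor.tmul_isBddBilin 𝕜 A).left x) (fun m a => ?_) m
    rw [LinearMap.comp_apply, hηJ, key, hr, LinearMap.flip_apply, BTensor.tmul_balanced]

/-- If `M` is a finite right `A`-module, then `M ⊗_A X` is a finitely generated `B`-module. -/
theorem IsFinGenRight.tensor (hA : IsQuasiUnital 𝕜 A) (hBm : IsMultConvex 𝕜 B)
    (hM : IsFiniteRight 𝕜 A M)
    {ψ : BTensor 𝕜 A Y X →ₗ[𝕜] B} (hψb : IsBdd ψ) (hψl : ∀ b t, ψ (lact 𝕜 B _ b t) = b * ψ t)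
    (hψr : ∀ t b, ψ (ract 𝕜 B _ t b) = ψ t * b)
    {η : M →ₗ[𝕜] BTensor 𝕜 B (BTensor 𝕜 A M X) Y}
    (hη : ∀ m x, evalPairing ψ hψb hψl (BTensor 𝕜 A M X) x (η m) = BTensor.tmul 𝕜 A M X m x) :
    IsFinGenRight 𝕜 B (BTensor 𝕜 A M X) := by
  obtain ⟨n, e, c, hc, hcA, hec⟩ := hM.exists_dual_basis hA
  set P := BTensor 𝕜 A M X
  have hCb : ∀ i, IsBddBilin ((lact 𝕜 A X).comp (c i)) := fun i =>
    (lact_isBddBilin 𝕜 A X).comp (hc i)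
  set C : Fin n → P →ₗ[𝕜] X := fun i => BTensor.lift 𝕜 A ((lact 𝕜 A X).comp (c i)) (hCb i)
    fun m a x => by simp only [LinearMap.comp_apply, hcA, mul_lact] with hC
  have hCbd : ∀ i, IsBdd (C i) := fun i => BTensor.lift_isBdd 𝕜 A _ _ _
  have hCt : ∀ i m x, C i (BTensor.tmul 𝕜 A M X m x) = lact 𝕜 A X (c i m) x :=
    fun i m x => BTensor.lift_tmul 𝕜 A _ _ _ m x
  have hCB : ∀ i t b, C i (ract 𝕜 B P t b) = ract 𝕜 B X (C i t) b := fun i t b =>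
    BTensor.map_ract_of_tmul (hCbd i) (fun m x b => by rw [hCt, hCt, IsBimodule.assoc]) t b
  have hsum : ∀ t, ∑ i, BTensor.tmul 𝕜 A M X (e i) (C i t) = t := fun t => by
    have := LinearMap.congr_fun (BTensor.ext 𝕜 A
      (g := ∑ i, BTensor.tmul 𝕜 A M X (e i) ∘ₗ C i) (h := LinearMap.id)
      (IsBdd.sum _ fun i => ((BTensor.tmul_isBddBilin 𝕜 A).right _).comp (hCbd i)) isBdd_id
      fun m x => by
        simp only [LinearMap.sum_apply, LinearMap.comp_apply, hCt, ← BTensor.tmul_balanced,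
          LinearMap.id_apply]
        rw [← LinearMap.sum_apply, ← map_sum, hec]) t
    simpa using this
  -- Elements of the completed tensor product are classes of summable families; a representative of
  -- η(e_i) supplies the coefficients of the expansion of the identity.
  have hω : ∀ m, ∃ ω : PreTensor 𝕜 P Y, BTensor.mk 𝕜 B P Y (CTensor.mk ω) = η m := fun m => by
    obtain ⟨t, ht⟩ := (bclosure (balRel 𝕜 B P Y)).mkQ_surjective (η m)
    obtain ⟨ω, rfl⟩ := CTensor.mk_surjective t
    exact ⟨ω, ht⟩
  choose ω hω using hω
  have hGb : ∀ i, IsBddBilin (((BTensor.tmul 𝕜 A Y X).compr₂ ψ).compl₂ (C i)) := fun i =>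
    ((BTensor.tmul_isBddBilin 𝕜 A).compr₂ hψb).compl₂ (hCbd i)
  refine isFinGenRight_of_nuclear hBm
    (fun i => ((BTensor.tmul 𝕜 A Y X).compr₂ ψ).compl₂ (C i)) hGb
    (fun i y t b => ?_) (fun i => ω (e i)) fun t => ?_
  · change ψ (BTensor.tmul 𝕜 A Y X y (C i (ract 𝕜 B P t b)))
      = ψ (BTensor.tmul 𝕜 A Y X y (C i t)) * b
    rw [hCB, ← BTensor.ract_tmul, hψr]
  · conv_rhs => rw [← hsum t]
    refine Finset.sum_congr rfl fun i _ => ?_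
    -- The term e_i ⊗ C_i(t) becomes the pairing of C_i(t) with the class of ω_i. On representatives
    -- that pairing is by definition the sum of ω_i(p, y) p · ψ(y ⊗ C_i(t)).
    rw [← hη, ← hω]
    rfl

/-- The map `g ⊗ id : M ⊗_A X → N ⊗_A X` for a bounded `A`-linear map `g : M → N`. -/
noncomputable def BTensor.mapFst {N : Type*} [AddCommGroup N] [Module 𝕜 N] [Bornology N]
    [BornRightModule 𝕜 A N] (g : M →ₗ[𝕜] N) (hg : IsBdd g)
    (hA : ∀ m a, g (ract 𝕜 A M m a) = ract 𝕜 A N (g m) a) :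
    BTensor 𝕜 A M X →ₗ[𝕜] BTensor 𝕜 A N X :=
  BTensor.lift 𝕜 A ((BTensor.tmul 𝕜 A N X).comp g) ((BTensor.tmul_isBddBilin 𝕜 A).comp hg)
    (fun m a x => by simp only [LinearMap.comp_apply, hA, BTensor.tmul_balanced])

theorem BTensor.mapFst_tmul {N : Type*} [AddCommGroup N] [Module 𝕜 N] [Bornology N]
    [BornRightModule 𝕜 A N] (g : M →ₗ[𝕜] N) (hg : IsBdd g)
    (hA : ∀ m a, g (ract 𝕜 A M m a) = ract 𝕜 A N (g m) a) (m : M) (x : X) :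
    BTensor.mapFst g hg hA (BTensor.tmul 𝕜 A M X m x) = BTensor.tmul 𝕜 A N X (g m) x :=
  BTensor.lift_tmul 𝕜 A _ _ _ m x

theorem BTensor.mapFst_isBdd {N : Type*} [AddCommGroup N] [Module 𝕜 N] [Bornology N]
    [BornRightModule 𝕜 A N] (g : M →ₗ[𝕜] N) (hg : IsBdd g)
    (hA : ∀ m a, g (ract 𝕜 A M m a) = ract 𝕜 A N (g m) a) :
    IsBdd (BTensor.mapFst (X := X) g hg hA) :=
  BTensor.lift_isBdd 𝕜 A _ _ _

theorem BTensor.mapFst_ract {N : Type*} [AddCommGroup N] [Module 𝕜 N] [Bornology N]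
    [BornRightModule 𝕜 A N] (g : M →ₗ[𝕜] N) (hg : IsBdd g)
    (hA : ∀ m a, g (ract 𝕜 A M m a) = ract 𝕜 A N (g m) a) (t : BTensor 𝕜 A M X) (b : B) :
    BTensor.mapFst g hg hA (ract 𝕜 B _ t b) = ract 𝕜 B _ (BTensor.mapFst g hg hA t) b :=
  BTensor.map_ract_of_tmul (BTensor.mapFst_isBdd g hg hA)
    (fun m x b => by rw [BTensor.mapFst_tmul, BTensor.mapFst_tmul, BTensor.ract_tmul]) t b

/-- Tensoring with an essential projective left module preserves maps with a bounded section. -/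
theorem BTensor.mapFst_exists_section {E F : Type u} [AddCommGroup E] [Module 𝕜 E] [Bornology E]
    [CompleteBVS 𝕜 E] [BornRightModule 𝕜 A E] [AddCommGroup F] [Module 𝕜 F] [Bornology F]
    [CompleteBVS 𝕜 F] [BornRightModule 𝕜 A F] {p : E →ₗ[𝕜] F} (hp : IsBdd p)
    (hpA : ∀ m a, p (ract 𝕜 A E m a) = ract 𝕜 A F (p m) a)
    {s : F →ₗ[𝕜] E} (hs : IsBdd s) (hps : ∀ y, p (s y) = y)
    {τ : X →ₗ[𝕜] CTensor 𝕜 A X} (hτ : τ ∈ HomLeft 𝕜 A X (CTensor 𝕜 A X))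
    (hτs : ∀ x, CTensor.lift (lact 𝕜 A X) (lact_isBddBilin 𝕜 A X) (τ x) = x) :
    ∃ S : BTensor 𝕜 A F X →ₗ[𝕜] BTensor 𝕜 A E X, IsBdd S ∧
      ∀ t, BTensor.mapFst p hp hpA (S t) = t := by
  have hf : IsBddTrilin ((ract 𝕜 A F).compr₂ (CTensor.tmul (𝕜 := 𝕜) (M := F) (N := X))) :=
    (ract_isBddBilin 𝕜 A F).compr₂_trilin CTensor.tmul_isBddBilin
  set k := CTensor.liftParam _ hf with hk
  have hkb : IsBddBilin k := CTensor.liftParam_isBddBilin _ hf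
  have hkt : ∀ z a x, k z (CTensor.tmul a x) = CTensor.tmul (ract 𝕜 A F z a) x :=
    fun z a x => CTensor.liftParam_tmul _ hf z a x
  -- Since s is not A-linear, s ⊗ id exists only on the unbalanced F ⊗ X. The section therefore
  -- first goes from F ⊗_A X to F ⊗ X by z ⊗ x ↦ z τ(x), where z (a ⊗ x) = z a ⊗ x; A-linearity of τ
  -- makes this balanced.
  set r : CTensor 𝕜 F X →ₗ[𝕜] BTensor 𝕜 A E X :=
    BTensor.mk 𝕜 A E X ∘ₗ CTensor.map s hs LinearMap.id isBdd_id with hr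
  have hrb : IsBdd r := (BTensor.mk_isBdd 𝕜 A).comp (CTensor.map_isBdd _ _ _ _)
  have hrt : ∀ z x, r (CTensor.tmul z x) = BTensor.tmul 𝕜 A E X (s z) x := fun z x => by
    rw [hr, LinearMap.comp_apply, CTensor.map_tmul]
    rfl
  have hbal : ∀ z a x, (k.compl₂ τ) (ract 𝕜 A F z a) x = (k.compl₂ τ) z (lact 𝕜 A X a x) := by
    intro z a x
    rw [LinearMap.compl₂_apply, LinearMap.compl₂_apply, hτ.2]
    refine LinearMap.congr_fun (CTensor.ext (h := k z ∘ₗ lact 𝕜 A (CTensor 𝕜 A X) a)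
      (hkb.right _) ((hkb.right z).comp ((lact_isBddBilin 𝕜 A _).right a)) fun b x => ?_) (τ x)
    rw [LinearMap.comp_apply, CTensor.lact_tmul, hkt, hkt, lact_self, ract_mul]
  have hT : IsBdd (BTensor.lift 𝕜 A (k.compl₂ τ) (hkb.compl₂ hτ.1) hbal) :=
    BTensor.lift_isBdd 𝕜 A _ _ _
  have hpb := BTensor.mapFst_isBdd (X := X) p hp hpA
  refine ⟨r ∘ₗ BTensor.lift 𝕜 A (k.compl₂ τ) (hkb.compl₂ hτ.1) hbal, hrb.comp hT, fun t => ?_⟩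
  refine LinearMap.congr_fun (BTensor.ext 𝕜 A (g := BTensor.mapFst p hp hpA ∘ₗ r ∘ₗ
    BTensor.lift 𝕜 A (k.compl₂ τ) (hkb.compl₂ hτ.1) hbal) (h := LinearMap.id)
    (hpb.comp (hrb.comp hT)) isBdd_id fun z x => ?_) t
  rw [LinearMap.comp_apply, LinearMap.comp_apply, BTensor.lift_tmul, LinearMap.compl₂_apply,
    LinearMap.id_apply]
  conv_rhs => rw [← hτs x]
  -- On a ⊗ x the composite is p(s(z a)) ⊗ x = z a ⊗ x = z ⊗ a x, which is z ⊗ – applied to the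
  -- product a x. Evaluating at τ(x) gives z ⊗ x.
  refine LinearMap.congr_fun (CTensor.ext (g := BTensor.mapFst p hp hpA ∘ₗ r ∘ₗ k z)
    (h := BTensor.tmul 𝕜 A F X z ∘ₗ CTensor.lift (lact 𝕜 A X) (lact_isBddBilin 𝕜 A X))
    (hpb.comp (hrb.comp (hkb.right z))) (((BTensor.tmul_isBddBilin 𝕜 A).right z).comp
      (CTensor.lift_isBdd _ _)) fun a x => ?_) (τ x)
  simp only [LinearMap.comp_apply, hkt, hrt, BTensor.mapFst_tmul, hps, CTensor.lift_tmul,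
    BTensor.tmul_balanced]

/-- If `M` is a projective right `A`-module, then `M ⊗_A X` is a projective `B`-module. -/
theorem IsProjectiveRight.tensor (hM : IsProjectiveRight 𝕜 A M)
    {τ : Y →ₗ[𝕜] CTensor 𝕜 B Y} (hτ : τ ∈ HomLeft 𝕜 B Y (CTensor 𝕜 B Y))
    (hτs : ∀ y, CTensor.lift (lact 𝕜 B Y) (lact_isBddBilin 𝕜 B Y) (τ y) = y)
    {ψ : BTensor 𝕜 A Y X →ₗ[𝕜] B} (hψb : IsBdd ψ) (hψl : ∀ b t, ψ (lact 𝕜 B _ b t) = b * ψ t)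
    (hψr : ∀ t b, ψ (ract 𝕜 B _ t b) = ψ t * b)
    {η : M →ₗ[𝕜] BTensor 𝕜 B (BTensor 𝕜 A M X) Y}
    (hηA : η ∈ HomRight 𝕜 A M (BTensor 𝕜 B (BTensor 𝕜 A M X) Y))
    (hη : ∀ m x, evalPairing ψ hψb hψl (BTensor 𝕜 A M X) x (η m) = BTensor.tmul 𝕜 A M X m x) :
    IsProjectiveRight 𝕜 B (BTensor 𝕜 A M X) := by
  intro E F _ _ _ _ _ _ _ _ _ _ p hp ⟨s, hs, hps⟩
  obtain ⟨S, hS, hpS⟩ := BTensor.mapFst_exists_section (X := Y) hp.1 hp.2 hs hps hτ hτs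
  have hκE := evalPairing_isBddBilin ψ hψb hψl E
  obtain ⟨σ, hσ, hσb⟩ := hM (BTensor 𝕜 B E Y) (BTensor 𝕜 B F Y)
    (BTensor.mapFst p hp.1 hp.2) ⟨BTensor.mapFst_isBdd _ _ _, BTensor.mapFst_ract _ _ _⟩
    ⟨S, hS, hpS⟩
  -- Naturality of the pairing in the module is used twice below: for p, and for the map h that is
  -- to be lifted.
  have natural : ∀ {G G' : Type u} [AddCommGroup G] [Module 𝕜 G] [Bornology G] [CompleteBVS 𝕜 G]
      [BornRightModule 𝕜 B G] [AddCommGroup G'] [Module 𝕜 G'] [Bornology G'] [CompleteBVS 𝕜 G']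
      [BornRightModule 𝕜 B G'] (q : G →ₗ[𝕜] G') (hq : IsBdd q)
      (hqB : ∀ m a, q (ract 𝕜 B G m a) = ract 𝕜 B G' (q m) a) (x : X) (t : BTensor 𝕜 B G Y),
      evalPairing ψ hψb hψl G' x (BTensor.mapFst q hq hqB t)
        = q (evalPairing ψ hψb hψl G x t) := by
    intro G G' _ _ _ _ _ _ _ _ _ _ q hq hqB x t
    have h1 := evalPairing_isBddBilin ψ hψb hψl G
    have h2 := evalPairing_isBddBilin ψ hψb hψl G'
    refine LinearMap.congr_fun (BTensor.ext 𝕜 B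
      (g := evalPairing ψ hψb hψl G' x ∘ₗ BTensor.mapFst q hq hqB)
      (h := q ∘ₗ evalPairing ψ hψb hψl G x) ((h2.right x).comp (BTensor.mapFst_isBdd _ _ _))
      (hq.comp (h1.right x)) fun e y => ?_) t
    simp only [LinearMap.comp_apply, BTensor.mapFst_tmul, evalPairing_tmul, hqB]
  have hfb : ∀ g : HomRight 𝕜 A M (BTensor 𝕜 B E Y),
      IsBddBilin ((evalPairing ψ hψb hψl E).flip.comp g.1) := fun g => hκE.flip.comp g.2.1
  have hfbal : ∀ (g : HomRight 𝕜 A M (BTensor 𝕜 B E Y)) (m : M) (a : A) (x : X),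
      ((evalPairing ψ hψb hψl E).flip.comp g.1) (ract 𝕜 A M m a) x
        = ((evalPairing ψ hψb hψl E).flip.comp g.1) m (lact 𝕜 A X a x) := fun g m a x => by
    simp only [LinearMap.comp_apply, LinearMap.flip_apply, g.2.2, evalPairing_ract]
  have hKb : ∀ g, IsBdd (BTensor.lift 𝕜 A _ (hfb g) (hfbal g)) :=
    fun g => BTensor.lift_isBdd 𝕜 A _ _ _
  have hKt : ∀ g m x, BTensor.lift 𝕜 A _ (hfb g) (hfbal g) (BTensor.tmul 𝕜 A M X m x)
      = evalPairing ψ hψb hψl E x (g.1 m) := fun g m x => BTensor.lift_tmul 𝕜 A _ _ _ m x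
  -- K and the following U go back and forth between maps on M and maps on M ⊗_A X: K(g)(m ⊗ x)
  -- pairs x with g(m), and U(h) = (h ⊗ id) ∘ η.
  let K : HomRight 𝕜 A M (BTensor 𝕜 B E Y) →ₗ[𝕜] HomRight 𝕜 B (BTensor 𝕜 A M X) E :=
    { toFun := fun g => ⟨BTensor.lift 𝕜 A _ (hfb g) (hfbal g), hKb g, fun t b =>
        BTensor.map_ract_of_tmul (hKb g) (fun m x b => by
          rw [hKt, hKt, evalPairing_ract_left ψ hψb hψl hψr]) t b⟩
      map_add' := fun g g' => Subtype.ext (BTensor.ext 𝕜 A (hKb _) ((hKb g).add (hKb g'))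
        fun m x => (hKt (g + g') m x).trans ((map_add _ _ _).trans
          (congrArg₂ (· + ·) (hKt g m x) (hKt g' m x)).symm))
      map_smul' := fun k g => Subtype.ext (BTensor.ext 𝕜 A (hKb _) ((hKb g).smul k)
        fun m x => (hKt (k • g) m x).trans ((map_smul _ _ _).trans
          (congrArg (k • ·) (hKt g m x)).symm)) }
  have hUb : ∀ h : HomRight 𝕜 B (BTensor 𝕜 A M X) F,
      IsBdd (BTensor.mapFst (X := Y) h.1 h.2.1 h.2.2) :=
    fun h => BTensor.mapFst_isBdd _ _ _
  let U : HomRight 𝕜 B (BTensor 𝕜 A M X) F →ₗ[𝕜] HomRight 𝕜 A M (BTensor 𝕜 B F Y) :=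
    { toFun := fun h => ⟨BTensor.mapFst h.1 h.2.1 h.2.2 ∘ₗ η, (hUb h).comp hηA.1, fun m a => by
        simp only [LinearMap.comp_apply, hηA.2, BTensor.mapFst_ract]⟩
      map_add' := fun h h' => Subtype.ext <| LinearMap.ext fun m =>
        LinearMap.congr_fun (BTensor.ext 𝕜 B (hUb (h + h')) ((hUb h).add (hUb h'))
          fun q y => by simp [BTensor.mapFst_tmul]) (η m)
      map_smul' := fun k h => Subtype.ext <| LinearMap.ext fun m =>
        LinearMap.congr_fun (BTensor.ext 𝕜 B (hUb (k • h)) ((hUb h).smul k)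
          fun q y => by simp [BTensor.mapFst_tmul]) (η m) }
  -- With κ the pairing: p(κ(x, σ(Uh)(m))) = κ(x, (Uh)(m)) = h(κ(x, η(m))) = h(m ⊗ x), the last
  -- equality being the triangle identity.
  refine ⟨K ∘ₗ σ ∘ₗ U, fun h t => ?_, fun H hH => ?_⟩
  · refine LinearMap.congr_fun (BTensor.ext 𝕜 A (g := p ∘ₗ (K (σ (U h))).1) (h := h.1)
      (hp.1.comp (hKb _)) h.2.1 fun m x => ?_) t
    change p (BTensor.lift 𝕜 A _ (hfb (σ (U h))) (hfbal (σ (U h))) (BTensor.tmul 𝕜 A M X m x)) = _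
    rw [hKt, ← natural p hp.1 hp.2, hσ]
    change evalPairing ψ hψb hψl F x (BTensor.mapFst h.1 h.2.1 h.2.2 (η m)) = _
    rw [natural, hη]
  -- Each of U, σ and K preserves equiboundedness: σ by projectivity of M, the other two because
  -- `BTensor.lift_equibdd` treats a whole family of lifts at once.
  · have h1 : Equibounded (Subtype.val '' (U '' H)) := by
      intro S hS
      refine (BTensor.lift_equibdd 𝕜 B
        (fun h : HomRight 𝕜 B (BTensor 𝕜 A M X) F => (BTensor.tmul 𝕜 B F Y).comp h.1)
        (fun h => (BTensor.tmul_isBddBilin 𝕜 B).comp h.2.1)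
        (fun h q b y => by simp only [LinearMap.comp_apply, h.2.2, BTensor.tmul_balanced]) H
        (fun S' T' hS' hT' => ?_) _ (hηA.1 S hS)).subset ?_
      · refine (BTensor.tmul_isBddBilin 𝕜 B _ T' (hH S' hS') hT').subset ?_
        rintro _ ⟨h, hh, q, hq, y, hy, rfl⟩
        exact ⟨_, ⟨h.1, ⟨h, hh, rfl⟩, q, hq, rfl⟩, y, hy, rfl⟩
      · rintro _ ⟨_, ⟨_, ⟨h, hh, rfl⟩, rfl⟩, m, hm, rfl⟩
        exact ⟨h, hh, η m, ⟨m, hm, rfl⟩, rfl⟩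
    have h2 := hσb _ h1
    intro C hC
    refine (BTensor.lift_equibdd 𝕜 A
      (fun g : HomRight 𝕜 A M (BTensor 𝕜 B E Y) => (evalPairing ψ hψb hψl E).flip.comp g.1)
      hfb hfbal (σ '' (U '' H)) (fun S' T' hS' hT' => ?_) C hC).subset ?_
    · refine (hκE T' _ hT' (h2 S' hS')).subset ?_
      rintro _ ⟨g, hg, m, hm, x, hx, rfl⟩
      exact ⟨x, hx, _, ⟨g.1, ⟨g, hg, rfl⟩, m, hm, rfl⟩, rfl⟩
    · rintro _ ⟨_, ⟨_, ⟨h, hh, rfl⟩, rfl⟩, t, ht, rfl⟩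
      exact ⟨σ (U h), ⟨_, ⟨h, hh, rfl⟩, rfl⟩, t, ht, rfl⟩

end Equivalence

end Borno

theorem propositionP {𝕜 : Type} [RCLike 𝕜]
    {A : Type u} [NonUnitalRing A] [Module 𝕜 A] [Bornology A] [BornAlgebra 𝕜 A]
    {B : Type u} [NonUnitalRing B] [Module 𝕜 B] [Bornology B] [BornAlgebra 𝕜 B]
    (hA : IsQuasiUnital 𝕜 A) (hB : IsQuasiUnital 𝕜 B) (hBm : IsMultConvex 𝕜 B)
    {X : Type u} [AddCommGroup X] [Module 𝕜 X] [Bornology X] [CompleteBVS 𝕜 X]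
    [BornLeftModule 𝕜 A X] [BornRightModule 𝕜 B X] [IsBimodule 𝕜 A B X]
    (hX : IsMoritaBimodule 𝕜 A B X)
    {M : Type u} [AddCommGroup M] [Module 𝕜 M] [Bornology M] [CompleteBVS 𝕜 M]
    [BornRightModule 𝕜 A M] (hM : IsFiniteRight 𝕜 A M) :
    IsFiniteRight 𝕜 B (BTensor 𝕜 A M X) := by
  obtain ⟨Y, _, _, _, _, _, _, _, hYl, -, hYp, -, ⟨φ, hφ, hφl, hφr⟩, ψ, hψ, hψl, hψr⟩ :=
    hX.exists_dual
  have hψb : IsBdd ψ := fun S hS => (hψ.2 S).2 hS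
  obtain ⟨η, hηA, hη⟩ :=
    exists_unit hX.essential_right hM.essential hφ hφl hφr hψ hψb hψl hψr
  -- This section is what makes – ⊗_B Y preserve linearly split surjections.
  obtain ⟨τ, hτ, hτs⟩ := hYp.exists_section hB hYl
  exact ⟨IsFinGenRight.tensor hA hBm hM hψb hψl hψr hη,
    hM.projective.tensor hτ hτs hψb hψl hψr hηA hη, hX.essential_right.tensor⟩
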